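/- Fix $(\varepsilon,\varepsilon^*)\in\{(1,1),(1,0),(0,0)\}$, a nonzero $q\in\mathbb C$ that is not a root of unity, and a nonzero $s\in\mathbb C$. Write $[j]=(q^j-q^{-j})/(q-q^{-1})$. **Loop algebra.** Let $\mathcal L=U_q(L(sl_2))$ be the unital associative $\mathbb C$-algebra generated by $e_i^{\pm},k_i^{\pm1}$ $(i=0,1)$ with relations $k_0k_1=k_1k_0=1$, $k_ik_i^{-1}=k_i^{-1}k_i=1$, $k_ie_i^{\pm}k_i^{-1}=q^{\pm2}e_i^{\pm}$, $k_ie_j^{\pm}k_i^{-1}=q^{\mp2}e_j^{\pm}$ $(i\ne j)$, $[e_i^+,e_i^-]=(k_i-k_i^{-1})/(q-q^{-1})$, $[e_i^+,e_j^-]=0$ $(i\neq j)$, and $[e_i^{\pm},(e_i^{\pm})^2e_j^{\pm}-(q^2+q^{-2})e_i^{\pm}e_j^{\pm}e_i^{\pm}+e_j^{\pm}(e_i^{\pm})^2]=0$ $(i\ne j)$, with the coproduct $\Delta(k_i^{\pm1})=k_i^{\pm1}\otimes k_i^{\pm1}$, $\Delta(e_i^+)=k_i\otimes e_i^++e_i^+\otimes1$,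 $\Delta(e_i^-k_i)=k_i\otimes e_i^-k_i+e_i^-k_i\otimes1$. Let $\mathcal L_{\varepsilon,\varepsilon^*}\subseteq\mathcal L$ be $\mathcal L$ itself if $(\varepsilon,\varepsilon^*)=(1,1)$, the subalgebra generated by $e_0^+,e_1^{\pm},k_0^{\pm1},k_1^{\pm1}$ if $(\varepsilon,\varepsilon^*)=(1,0)$, and the Borel subalgebra generated by $e_0^+,e_1^+,k_0^{\pm1},k_1^{\pm1}$ if $(\varepsilon,\varepsilon^*)=(0,0)$. $\Delta$ restricts to these subalgebras, and tensor products of $\mathcal L_{\varepsilon,\varepsilon^*}$-modules are formed through $\Delta$. **Augmented TD-algebra.** Let $\mathcal T$ be the unital associative $\mathbb C$-algebra generated by $x,y,k^{\pm1}$ with relations $kk^{-1}=k^{-1}k=1$, $kxk^{-1}=q^2x$, $kyk^{-1}=q^{-2}y$, $$[x,x^2y-\beta xyx+yx^2]=\delta'(\varepsilon^*x^2k^2-\varepsilon k^{-2}x^2),\qquad [y,y^2x-\beta yxy+xy^2]=\delta'(-\varepsilon^*k^2y^2+\varepsilon y^2k^{-2}),$$ where $\beta=q^2+q^{-2}$ and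 $\delta'=-(q-q^{-1})(q^2-q^{-2})(q^3-q^{-3})q^4$. Let $\varphi_s:\mathcal T\to\mathcal L_{\varepsilon,\varepsilon^*}$ be the algebra homomorphism $$x\mapsto -q^{-1}(q-q^{-1})^2(se_0^++\varepsilon s^{-1}e_1^-k_1),\quad y\mapsto\varepsilon^*se_0^-k_0+s^{-1}e_1^+,\quad k\mapsto sk_0 .$$ An $\mathcal L_{\varepsilon,\varepsilon^*}$-module regarded as a $\mathcal T$-module through $\varphi_s$ is called a $\mathcal T$-module via $\varphi_s$. **Evaluation modules.** For an integer $\ell\ge1$ and $a\in\mathbb C$, where $a\neq0$ unless $(\varepsilon,\varepsilon^*)=(1,0)$, let $V(\ell,a)$ be the $\mathcal L_{\varepsilon,\varepsilon^*}$-module with basis $v_0,\dots,v_\ell$ (and $v_{-1}=v_{\ell+1}=0$) on which those of the following generators that lie in the generating set of $\mathcal L_{\varepsilon,\varepsilon^*}$ act by $$k_0v_i=q^{2i-\ell}v_i,\ \ k_1v_i=q^{\ell-2i}v_i,\ \ e_0^+v_i=aq[i+1]v_{i+1},\ \ e_0^-v_i=a^{-1}q^{-1}[\ell-i+1]v_{i-1},\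 \ e_1^+v_i=[\ell-i+1]v_{i-1},\ \ e_1^-v_i=[i+1]v_{i+1}.$$ **Drinfel'd polynomial.** Say that a $\mathcal T$-module $V$ satisfies (D) with type $r\in\mathbb C\setminus\{0\}$ and diameter $d\ge0$ if $V=\bigoplus_{i=0}^dU_i$, where $U_i=\{v\in V: kv=rq^{2i-d}v\}$, and the highest weight space $U_0$ has dimension $1$. Then $y^ix^i$ acts on $U_0$ as a scalar $\sigma_i(V)$, and one puts $$P_V(\lambda)=Q_d^{-1}\sum_{i=0}^d\sigma_i(V)\prod_{j=i+1}^d(q^j-q^{-j})^2\bigl(\varepsilon r^{-2}q^{2(d-j)}+\varepsilon^*r^2q^{-2(d-j)}-\lambda\bigr),\qquad Q_d=(-1)^d\prod_{j=1}^d(q^j-q^{-j})^2 .$$ **Theorem.** (i) Let $V$ be a finite-dimensional $\mathcal L_{\varepsilon,\varepsilon^*}$-module which, as a $\mathcal T$-module via $\varphi_s$, satisfies (D) with type $r$ and diameter $d$. Let $V'$ be an $\mathcal L_{\varepsilon,\varepsilon^*}$-module isomorphic to a tensor product $V(\ell_1,a_1)\otimes\cdots\otimes V(\ell_n,a_n)$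 of evaluation modules, $n\ge1$, and put $d'=\ell_1+\cdots+\ell_n$. Then, as $\mathcal T$-modules via $\varphi_s$, $V'$ satisfies (D) with type $s$ and diameter $d'$, $V\otimes V'$ satisfies (D) with type $r$ and diameter $d+d'$, and, with respect to these types and diameters, $$P_{V\otimes V'}(\lambda)=P_V(\lambda)\,P_{V'}(\lambda).$$ (ii) The $\mathcal T$-module $V(\ell,a)$ via $\varphi_s$ satisfies (D) with type $s$ and diameter $\ell$, and $$P_{V(\ell,a)}(\lambda)=\prod_{c\in S(\ell,a)}(\lambda+c+\varepsilon\varepsilon^*c^{-1}),$$ where $S(\ell,a)$ is the multiset $\{aq^{2i-\ell+1}\mid 0\le i\le\ell-1\}$ and $\varepsilon\varepsilon^*c^{-1}$ means $0$ if $\varepsilon\varepsilon^*=0$. In particular $P_{V(\ell,0)}(\lambda)=\lambda^\ell$ in the case $(\varepsilon,\varepsilon^*)=(1,0)$, $a=0$. -/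

import Mathlib

open scoped TensorProduct

set_option linter.unusedSimpArgs false

namespace AugTD

/-- The `q`-Serre expression `[x, x² y - (q² + q⁻²) x y x + y x²]`. -/
noncomputable def qSerre {A : Type*} [Ring A] [Algebra ℂ A] (q : ℂˣ) (x y : A) : A :=
  ⁅x, x ^ 2 * y - ((q : ℂ) ^ 2 + (q : ℂ)⁻¹ ^ 2) • (x * y * x) + y * x ^ 2⁆

section
variable {A : Type*} [Ring A] [Algebra ℂ A]

theorem qSerre_eq (q : ℂˣ) (x y : A) : qSerre q x y = x * x * x * y
    - ((q : ℂ) ^ 2 + (q : ℂ)⁻¹ ^ 2 + 1) • (x * x * y * x)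
    + ((q : ℂ) ^ 2 + (q : ℂ)⁻¹ ^ 2 + 1) • (x * y * x * x) - y * x * x * x := by
  simp only [qSerre, Ring.lie_def, pow_two, mul_add, mul_sub, add_mul, sub_mul,
    smul_mul_assoc, mul_smul_comm, mul_assoc]
  module

theorem qSerre_add_right (q : ℂˣ) (x y z : A) :
    qSerre q x (y + z) = qSerre q x y + qSerre q x z := by
  simp only [qSerre_eq, mul_add, add_mul, smul_add]; abel

theorem qSerre_smul_right (q : ℂˣ) (x y : A) (c : ℂ) :
    qSerre q x (c • y) = c • qSerre q x y := by
  simp only [qSerre_eq, smul_mul_assoc, mul_smul_comm, smul_add, smul_sub, smul_comm c]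

theorem qSerre_smul_left (q : ℂˣ) (x y : A) (c : ℂ) :
    qSerre q (c • x) y = c ^ 3 • qSerre q x y := by
  simp only [qSerre_eq, smul_mul_assoc, mul_smul_comm, smul_add, smul_sub, smul_smul]
  module

theorem assoc_rule {x y z : A} {c : ℂ} (h : x * y = c • z) (w : A) :
    x * (y * w) = c • (z * w) := by
  rw [← mul_assoc, h, smul_mul_assoc]

theorem qSerre_add_add (q : ℂˣ) {X Y X' Y' : A}
    (h1 : X * Y = (q : ℂ) ^ 2 • (Y * X)) (h2 : X * Y' = (q : ℂ)⁻¹ ^ 2 • (Y' * X))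
    (h3 : X' * Y = (q : ℂ)⁻¹ ^ 2 • (Y * X'))
    (hX : qSerre q X X' = 0) (hY : qSerre q Y Y' = 0) :
    qSerre q (X + Y) (X' + Y') = 0 := by
  have hq : (q : ℂ) ≠ 0 := q.ne_zero
  have e : qSerre q (X + Y) (X' + Y') = qSerre q X X' + qSerre q Y Y' := by
    simp only [qSerre_eq, mul_add, add_mul, mul_assoc, h1, h2, h3, assoc_rule h1,
      assoc_rule h2, assoc_rule h3, mul_smul_comm, smul_mul_assoc, smul_add, smul_smul]
    match_scalars <;> field_simp <;> ring
  rw [e, hX, hY, add_zero]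

theorem qSerre_of_sl2 (q : ℂˣ) {E F K K' : A} (hKK : K * K' = 1) (hKK' : K' * K = 1)
    (hE : K * E = (q : ℂ) ^ 2 • (E * K)) (hF : K * F = (q : ℂ)⁻¹ ^ 2 • (F * K))
    (h : E * F - F * E = ((q : ℂ) - (q : ℂ)⁻¹)⁻¹ • (K - K')) :
    qSerre q F E = 0 ∧ qSerre q E F = 0 := by
  have hq : (q : ℂ) ≠ 0 := q.ne_zero
  have inv : ∀ (x : A) (c d : ℂ), d * c = 1 → K * x = c • (x * K) → K' * x = d • (x * K') := by
    intro x c d hcd hx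
    have : x * K' = c • (K' * x) := by
      calc x * K' = K' * (K * x) * K' := by rw [← mul_assoc, hKK', one_mul]
        _ = c • (K' * x) := by
          rw [hx]; simp [mul_assoc, hKK]
    rw [this, smul_smul, hcd, one_smul]
  have hE' := inv E _ ((q : ℂ)⁻¹ ^ 2) (by field_simp) hE
  have hF' := inv F _ ((q : ℂ) ^ 2) (by field_simp) hF
  set c := ((q : ℂ) - (q : ℂ)⁻¹)⁻¹ with hc
  have h' : E * F = F * E + c • (K - K') := by rw [← h]; abel
  have h'' : ∀ w, E * (F * w) = F * (E * w) + c • (K * w - K' * w) := by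
    intro w; rw [← mul_assoc, h', add_mul, smul_mul_assoc, sub_mul, mul_assoc]
  constructor
  all_goals
    simp only [qSerre_eq, mul_add, add_mul, mul_sub, sub_mul, mul_assoc, h', h'', hE, hF, hE', hF',
      assoc_rule hE, assoc_rule hF, assoc_rule hE', assoc_rule hF', mul_smul_comm, smul_mul_assoc,
      smul_add, smul_sub, smul_smul]
    match_scalars <;> field_simp <;> ring


theorem swap_rule {x y : A} {c d : ℂ} (hcd : d * c = 1) (h : x * y = c • (y * x)) :
    y * x = d • (x * y) := by
  rw [h, smul_smul, hcd, one_smul]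

theorem inv_rule {k k' x : A} {c d : ℂ} (hk : k * k' = 1) (hk' : k' * k = 1) (hcd : d * c = 1)
    (h : k * x = c • (x * k)) : k' * x = d • (x * k') := by
  have : x * k' = c • (k' * x) := by
    calc x * k' = k' * (k * x) * k' := by rw [← mul_assoc, hk', one_mul]
      _ = c • (k' * x) := by rw [h]; simp [mul_assoc, hk]
  rw [this, smul_smul, hcd, one_smul]

set_option maxHeartbeats 1000000 in
theorem td_aux (q : ℂˣ) (c p r u w : ℂ) {A' B C D k k' : A} (hk : k * k' = 1) (hk' : k' * k = 1)
    (hA : k * A' = (q : ℂ) ^ 2 • (A' * k)) (hB : k * B = (q : ℂ) ^ 2 • (B * k))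
    (hC : k * C = (q : ℂ)⁻¹ ^ 2 • (C * k)) (hD : k * D = (q : ℂ)⁻¹ ^ 2 • (D * k))
    (hAB : A' * B = (q : ℂ) ^ 2 • (B * A')) (hDC : D * C = (q : ℂ) ^ 2 • (C * D))
    (hAC : A' * C = (q : ℂ)⁻¹ ^ 2 • (C * A') + c • (k * k - 1))
    (hBD : B * D = (q : ℂ) ^ 2 • (D * B) - ((q : ℂ) ^ 2 * c) • (k' * k' - 1))
    (s1 : qSerre q A' D = 0) (s2 : qSerre q B C = 0)
    (s3 : qSerre q C B = 0) (s4 : qSerre q D A' = 0) :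
    let m : ℂ := c * (q : ℂ) ^ 5 * (q ^ 2 - (q : ℂ)⁻¹ ^ 2) * (q ^ 3 - (q : ℂ)⁻¹ ^ 3)
    let x := p • A' + r • B
    let y := u • C + w • D
    qSerre q x C = (p * m) • (x ^ 2 * k ^ 2) ∧
    qSerre q x D = - (r * m) • (k' ^ 2 * x ^ 2) ∧
    qSerre q y A' = - (u * m) • (k ^ 2 * y ^ 2) ∧
    qSerre q y B = (w * m) • (y ^ 2 * k' ^ 2) := by
  intro m x y
  have hq : (q : ℂ) ≠ 0 := q.ne_zero
  have i1 : (q : ℂ)⁻¹ ^ 2 * (q : ℂ) ^ 2 = 1 := by field_simp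
  have i2 : (q : ℂ) ^ 2 * (q : ℂ)⁻¹ ^ 2 = 1 := by field_simp
  have kA := swap_rule i1 hA
  have kB := swap_rule i1 hB
  have kC := swap_rule i2 hC
  have kD := swap_rule i2 hD
  have jA := swap_rule i2 (inv_rule hk hk' i1 hA)
  have jB := swap_rule i2 (inv_rule hk hk' i1 hB)
  have jC := swap_rule i1 (inv_rule hk hk' i2 hC)
  have jD := swap_rule i1 (inv_rule hk hk' i2 hD)
  have hBA := swap_rule i1 hAB
  have hCD := swap_rule i1 hDC
  have hAC' : ∀ t, A' * (C * t) = (q : ℂ)⁻¹ ^ 2 • (C * (A' * t)) + c • (k * (k * t) - t) := by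
    intro t; rw [← mul_assoc, hAC, add_mul, smul_mul_assoc, smul_mul_assoc, sub_mul, mul_assoc,
      mul_assoc, one_mul]
  have hBD' : ∀ t, B * (D * t) = (q : ℂ) ^ 2 • (D * (B * t))
      - ((q : ℂ) ^ 2 * c) • (k' * (k' * t) - t) := by
    intro t; rw [← mul_assoc, hBD, sub_mul, smul_mul_assoc, smul_mul_assoc, sub_mul, mul_assoc,
      mul_assoc, one_mul]
  refine ⟨?_, ?_, ?_, ?_⟩
  · have : qSerre q x C = r ^ 3 • qSerre q B C + (p * m) • (x ^ 2 * k ^ 2) := by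
      simp only [x, m, qSerre_eq, pow_two (_ : A), mul_add, add_mul, mul_sub, sub_mul, mul_assoc, hAC, hAC', hAB,
        assoc_rule hAB, kA, kB, kC, assoc_rule kA, assoc_rule kB, assoc_rule kC,
        mul_smul_comm, smul_mul_assoc, smul_add, smul_sub, smul_smul, mul_one, one_mul]
      match_scalars <;> field_simp <;> ring
    rw [this, s2, smul_zero, zero_add]
  · have : qSerre q x D = p ^ 3 • qSerre q A' D + - (r * m) • (k' ^ 2 * x ^ 2) := by
      simp only [x, m, qSerre_eq, pow_two (_ : A), mul_add, add_mul, mul_sub, sub_mul, mul_assoc, hBD, hBD', hBA,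
        assoc_rule hBA, jA, jB, jD, assoc_rule jA, assoc_rule jB, assoc_rule jD,
        mul_smul_comm, smul_mul_assoc, smul_add, smul_sub, smul_smul, mul_one, one_mul]
      match_scalars <;> field_simp <;> ring
    rw [this, s1, smul_zero, zero_add]
  · have : qSerre q y A' = w ^ 3 • qSerre q D A' + - (u * m) • (k ^ 2 * y ^ 2) := by
      simp only [y, m, qSerre_eq, pow_two (_ : A), mul_add, add_mul, mul_sub, sub_mul, mul_assoc, hAC, hAC', hDC,
        assoc_rule hDC, kA, kD, kC, assoc_rule kA, assoc_rule kD, assoc_rule kC,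
        mul_smul_comm, smul_mul_assoc, smul_add, smul_sub, smul_smul, mul_one, one_mul]
      match_scalars <;> field_simp <;> ring
    rw [this, s4, smul_zero, zero_add]
  · have : qSerre q y B = u ^ 3 • qSerre q C B + (w * m) • (y ^ 2 * k' ^ 2) := by
      simp only [y, m, qSerre_eq, pow_two (_ : A), mul_add, add_mul, mul_sub, sub_mul, mul_assoc, hBD, hBD', hCD,
        assoc_rule hCD, jB, jC, jD, assoc_rule jB, assoc_rule jC, assoc_rule jD,
        mul_smul_comm, smul_mul_assoc, smul_add, smul_sub, smul_smul, mul_one, one_mul]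
      match_scalars <;> field_simp <;> ring
    rw [this, s3, smul_zero, zero_add]
end


/-- The generators `e⁺ᵢ`, `e⁻ᵢ`, `kᵢ`, `kᵢ⁻¹` (`i = 0, 1`). -/
inductive LoopGen : Type
  | ePos (i : Fin 2)
  | eNeg (i : Fin 2)
  | k (i : Fin 2)
  | kInv (i : Fin 2)

namespace LoopGen
abbrev E (i : Fin 2) : FreeAlgebra ℂ LoopGen := FreeAlgebra.ι ℂ (ePos i)
abbrev F (i : Fin 2) : FreeAlgebra ℂ LoopGen := FreeAlgebra.ι ℂ (eNeg i)
abbrev K (i : Fin 2) : FreeAlgebra ℂ LoopGen := FreeAlgebra.ι ℂ (k i)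
abbrev KI (i : Fin 2) : FreeAlgebra ℂ LoopGen := FreeAlgebra.ι ℂ (kInv i)
end LoopGen

open LoopGen in
/-- The defining relations of the `U_q(sl₂)`-loop algebra. -/
inductive LoopRel (q : ℂˣ) : FreeAlgebra ℂ LoopGen → FreeAlgebra ℂ LoopGen → Prop
  | k_mul_k (i j : Fin 2) (h : i ≠ j) : LoopRel q (K i * K j) 1
  | k_mul_kInv (i : Fin 2) : LoopRel q (K i * KI i) 1
  | kInv_mul_k (i : Fin 2) : LoopRel q (KI i * K i) 1
  | k_ePos_same (i : Fin 2) : LoopRel q (K i * E i * KI i) ((q : ℂ) ^ 2 • E i)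
  | k_eNeg_same (i : Fin 2) : LoopRel q (K i * F i * KI i) ((q : ℂ)⁻¹ ^ 2 • F i)
  | k_ePos_ne (i j : Fin 2) (h : i ≠ j) :
      LoopRel q (K i * E j * KI i) ((q : ℂ)⁻¹ ^ 2 • E j)
  | k_eNeg_ne (i j : Fin 2) (h : i ≠ j) :
      LoopRel q (K i * F j * KI i) ((q : ℂ) ^ 2 • F j)
  | comm_same (i : Fin 2) :
      LoopRel q ⁅E i, F i⁆ (((q : ℂ) - (q : ℂ)⁻¹)⁻¹ • (K i - KI i))
  | comm_ne (i j : Fin 2) (h : i ≠ j) : LoopRel q ⁅E i, F j⁆ 0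
  | serre_ePos (i j : Fin 2) (h : i ≠ j) : LoopRel q (qSerre q (E i) (E j)) 0
  | serre_eNeg (i j : Fin 2) (h : i ≠ j) : LoopRel q (qSerre q (F i) (F j)) 0

/-- The `U_q(sl₂)`-loop algebra `𝓛 = U_q(L(sl₂))`, by generators and relations. -/
def LoopAlg (q : ℂˣ) : Type := RingQuot (LoopRel q)

noncomputable instance (q : ℂˣ) : Ring (LoopAlg q) := inferInstanceAs (Ring (RingQuot (LoopRel q)))
noncomputable instance (q : ℂˣ) : Algebra ℂ (LoopAlg q) :=
  inferInstanceAs (Algebra ℂ (RingQuot (LoopRel q)))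

namespace LoopAlg

/-- The image of a generator in `𝓛`. -/
noncomputable def gen (q : ℂˣ) (g : LoopGen) : LoopAlg q :=
  RingQuot.mkAlgHom ℂ (LoopRel q) (FreeAlgebra.ι ℂ g)

noncomputable abbrev ePos (q : ℂˣ) (i : Fin 2) : LoopAlg q := gen q (.ePos i)
noncomputable abbrev eNeg (q : ℂˣ) (i : Fin 2) : LoopAlg q := gen q (.eNeg i)
noncomputable abbrev k (q : ℂˣ) (i : Fin 2) : LoopAlg q := gen q (.k i)
noncomputable abbrev kInv (q : ℂˣ) (i : Fin 2) : LoopAlg q := gen q (.kInv i)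

theorem map_qSerre {A B : Type*} [Ring A] [Algebra ℂ A] [Ring B] [Algebra ℂ B] (q : ℂˣ)
    (f : A →ₐ[ℂ] B) (x y : A) : f (qSerre q x y) = qSerre q (f x) (f y) := by
  simp only [qSerre_eq, map_sub, map_add, map_mul, map_smul]

/-- A family of elements of `A` satisfying the defining relations of `𝓛`. -/
structure IsLoopFamily {A : Type*} [Ring A] [Algebra ℂ A] (q : ℂˣ) (E F K KI : Fin 2 → A) :
    Prop where
  k_mul_k : ∀ i j : Fin 2, i ≠ j → K i * K j = 1
  k_mul_kInv : ∀ i, K i * KI i = 1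
  kInv_mul_k : ∀ i, KI i * K i = 1
  k_ePos_same : ∀ i, K i * E i = (q : ℂ) ^ 2 • (E i * K i)
  k_eNeg_same : ∀ i, K i * F i = (q : ℂ)⁻¹ ^ 2 • (F i * K i)
  k_ePos_ne : ∀ i j : Fin 2, i ≠ j → K i * E j = (q : ℂ)⁻¹ ^ 2 • (E j * K i)
  k_eNeg_ne : ∀ i j : Fin 2, i ≠ j → K i * F j = (q : ℂ) ^ 2 • (F j * K i)
  comm_same : ∀ i, E i * F i - F i * E i = ((q : ℂ) - (q : ℂ)⁻¹)⁻¹ • (K i - KI i)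
  comm_ne : ∀ i j : Fin 2, i ≠ j → E i * F j = F j * E i
  serre_ePos : ∀ i j : Fin 2, i ≠ j → qSerre q (E i) (E j) = 0
  serre_eNeg : ∀ i j : Fin 2, i ≠ j → qSerre q (F i) (F j) = 0

theorem isLoopFamily (q : ℂˣ) : IsLoopFamily q (ePos q) (eNeg q) (k q) (kInv q) := by
  have rel : ∀ {a b}, LoopRel q a b →
      RingQuot.mkAlgHom ℂ (LoopRel q) a = RingQuot.mkAlgHom ℂ (LoopRel q) b :=
    fun h => RingQuot.mkAlgHom_rel ℂ h
  have inv : ∀ i, kInv q i * k q i = 1 := fun i => by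
    have := rel (.kInv_mul_k i); rwa [map_mul, map_one] at this
  have conj : ∀ (i : Fin 2) (g : LoopGen) (c : ℂ), k q i * gen q g * kInv q i = c • gen q g →
      k q i * gen q g = c • (gen q g * k q i) := by
    intro i g c h
    rw [← smul_mul_assoc, ← h, mul_assoc _ (kInv q i), inv, mul_one]
  refine ⟨?_, ?_, inv, ?_, ?_, ?_, ?_, ?_, ?_, ?_, ?_⟩
  · intro i j h; have := rel (.k_mul_k i j h); rwa [map_mul, map_one] at this
  · intro i; have := rel (.k_mul_kInv i); rwa [map_mul, map_one] at this
  · intro i; have := rel (.k_ePos_same i)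
    rw [map_mul, map_mul, map_smul] at this; exact conj _ _ _ this
  · intro i; have := rel (.k_eNeg_same i)
    rw [map_mul, map_mul, map_smul] at this; exact conj _ _ _ this
  · intro i j h; have := rel (.k_ePos_ne i j h)
    rw [map_mul, map_mul, map_smul] at this; exact conj _ _ _ this
  · intro i j h; have := rel (.k_eNeg_ne i j h)
    rw [map_mul, map_mul, map_smul] at this; exact conj _ _ _ this
  · intro i; have := rel (.comm_same i)
    rwa [Ring.lie_def, map_sub, map_mul, map_mul, map_smul, map_sub] at this
  · intro i j h; have := rel (.comm_ne i j h)
    rw [Ring.lie_def, map_sub, map_mul, map_mul, map_zero] at this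
    exact sub_eq_zero.1 this
  · intro i j h; have := rel (.serre_ePos i j h)
    rwa [map_qSerre, map_zero] at this
  · intro i j h; have := rel (.serre_eNeg i j h)
    rwa [map_qSerre, map_zero] at this

section lift
variable {A : Type*} [Ring A] [Algebra ℂ A] {q : ℂˣ} {E F K KI : Fin 2 → A}

def genMap (E F K KI : Fin 2 → A) : LoopGen → A
  | .ePos i => E i
  | .eNeg i => F i
  | .k i => K i
  | .kInv i => KI i

theorem lift_aux (h : IsLoopFamily q E F K KI) ⦃a b : FreeAlgebra ℂ LoopGen⦄
    (r : LoopRel q a b) : FreeAlgebra.lift ℂ (genMap E F K KI) a =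
      FreeAlgebra.lift ℂ (genMap E F K KI) b := by
  have conj : ∀ (i : Fin 2) (x : A) (c : ℂ), K i * x = c • (x * K i) → K i * x * KI i = c • x := by
    intro i x c hx
    rw [hx, smul_mul_assoc, mul_assoc, h.k_mul_kInv, mul_one]
  cases r with
  | k_mul_k i j hij => simpa [genMap] using h.k_mul_k i j hij
  | k_mul_kInv i => simpa [genMap] using h.k_mul_kInv i
  | kInv_mul_k i => simpa [genMap] using h.kInv_mul_k i
  | k_ePos_same i => simpa [genMap] using conj _ _ _ (h.k_ePos_same i)
  | k_eNeg_same i => simpa [genMap] using conj _ _ _ (h.k_eNeg_same i)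
  | k_ePos_ne i j hij => simpa [genMap] using conj _ _ _ (h.k_ePos_ne i j hij)
  | k_eNeg_ne i j hij => simpa [genMap] using conj _ _ _ (h.k_eNeg_ne i j hij)
  | comm_same i => simpa [genMap, Ring.lie_def] using h.comm_same i
  | comm_ne i j hij => simpa [genMap, Ring.lie_def, sub_eq_zero] using h.comm_ne i j hij
  | serre_ePos i j hij => simpa [genMap, map_qSerre] using h.serre_ePos i j hij
  | serre_eNeg i j hij => simpa [genMap, map_qSerre] using h.serre_eNeg i j hij

/-- The algebra homomorphism from `𝓛` given by a family that satisfies the defining relations. -/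
noncomputable def lift (h : IsLoopFamily q E F K KI) : LoopAlg q →ₐ[ℂ] A :=
  RingQuot.liftAlgHom ℂ ⟨FreeAlgebra.lift ℂ (genMap E F K KI), lift_aux h⟩

theorem lift_gen (h : IsLoopFamily q E F K KI) (g : LoopGen) :
    lift h (gen q g) = genMap E F K KI g := by
  have := RingQuot.liftAlgHom_mkAlgHom_apply ℂ (FreeAlgebra.lift ℂ (genMap E F K KI))
    (s := LoopRel q) (lift_aux h) (FreeAlgebra.ι ℂ g)
  exact this.trans (FreeAlgebra.lift_ι_apply _ _)

end lift

theorem coproduct_aux (q : ℂˣ) : IsLoopFamily (A := LoopAlg q ⊗[ℂ] LoopAlg q) q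
    (fun i => k q i ⊗ₜ ePos q i + ePos q i ⊗ₜ 1)
    (fun i => 1 ⊗ₜ eNeg q i + eNeg q i ⊗ₜ kInv q i)
    (fun i => k q i ⊗ₜ k q i) (fun i => kInv q i ⊗ₜ kInv q i) := by
  have hq : (q : ℂ) ≠ 0 := q.ne_zero
  have i1 : (q : ℂ)⁻¹ ^ 2 * (q : ℂ) ^ 2 = 1 := by field_simp
  have i2 : (q : ℂ) ^ 2 * (q : ℂ)⁻¹ ^ 2 = 1 := by field_simp
  have h := isLoopFamily q
  have kk : ∀ i, k q i * kInv q i = kInv q i * k q i := fun i => by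
    rw [h.k_mul_kInv, h.kInv_mul_k]
  have kj : ∀ i j, i ≠ j → k q i * k q j = k q j * k q i := fun i j hij => by
    rw [h.k_mul_k i j hij, h.k_mul_k j i hij.symm]
  have kij : ∀ i j, i ≠ j → k q i * kInv q j = kInv q j * k q i := fun i j hij => by
    have := inv_rule (c := 1) (d := 1) (h.k_mul_kInv j) (h.kInv_mul_k j) (by norm_num)
      (by rw [one_smul]; exact (kj i j hij).symm : k q j * k q i = (1 : ℂ) • (k q i * k q j))
    rw [one_smul] at this; exact this.symm
  have jE := fun i => inv_rule (h.k_mul_kInv i) (h.kInv_mul_k i) i1 (h.k_ePos_same i)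
  have jF := fun i => inv_rule (h.k_mul_kInv i) (h.kInv_mul_k i) i2 (h.k_eNeg_same i)
  have jE' := fun i j hij => inv_rule (h.k_mul_kInv i) (h.kInv_mul_k i) i2 (h.k_ePos_ne i j hij)
  have jF' := fun i j hij => inv_rule (h.k_mul_kInv i) (h.kInv_mul_k i) i1 (h.k_eNeg_ne i j hij)
  have kinvij : ∀ i j, i ≠ j → kInv q i * kInv q j = kInv q j * kInv q i := fun i j hij => by
    have := inv_rule (c := 1) (d := 1) (h.k_mul_kInv i) (h.kInv_mul_k i) (by norm_num)
      (by rw [one_smul]; exact (kij i j hij) : k q i * kInv q j = (1 : ℂ) • (kInv q j * k q i))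
    rwa [one_smul] at this
  have serre_left : ∀ (x y z : LoopAlg q), qSerre q (x ⊗ₜ[ℂ] z : LoopAlg q ⊗[ℂ] LoopAlg q) (y ⊗ₜ z) =
      qSerre q x y ⊗ₜ (z * z * z * z) := by
    intro x y z
    simp only [qSerre_eq, Algebra.TensorProduct.tmul_mul_tmul, TensorProduct.sub_tmul,
      TensorProduct.add_tmul, TensorProduct.smul_tmul']
  constructor
  · intro i j hij
    simp only [Algebra.TensorProduct.tmul_mul_tmul, h.k_mul_k i j hij,
      Algebra.TensorProduct.one_def]
  · intro i
    simp only [Algebra.TensorProduct.tmul_mul_tmul, h.k_mul_kInv i,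
      Algebra.TensorProduct.one_def]
  · intro i
    simp only [Algebra.TensorProduct.tmul_mul_tmul, h.kInv_mul_k i,
      Algebra.TensorProduct.one_def]
  · intro i
    simp only [mul_add, add_mul, Algebra.TensorProduct.tmul_mul_tmul, h.k_ePos_same i, mul_one,
      one_mul, TensorProduct.tmul_smul, ← TensorProduct.smul_tmul', smul_add]
  · intro i
    simp only [mul_add, add_mul, Algebra.TensorProduct.tmul_mul_tmul, h.k_eNeg_same i, mul_one,
      one_mul, TensorProduct.tmul_smul, ← TensorProduct.smul_tmul', smul_add, kk]
  · intro i j hij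
    simp only [mul_add, add_mul, Algebra.TensorProduct.tmul_mul_tmul, h.k_ePos_ne i j hij, mul_one,
      one_mul, TensorProduct.tmul_smul, ← TensorProduct.smul_tmul', smul_add, kj i j hij]
  · intro i j hij
    simp only [mul_add, add_mul, Algebra.TensorProduct.tmul_mul_tmul, h.k_eNeg_ne i j hij, mul_one,
      one_mul, TensorProduct.tmul_smul, ← TensorProduct.smul_tmul', smul_add, kij i j hij]
  · intro i
    have e : ∀ a b c : LoopAlg q, a * b - b * a = c → a * b = b * a + c := by
      intro a b c h; rw [← h]; abel
    simp only [mul_add, add_mul, Algebra.TensorProduct.tmul_mul_tmul, h.k_eNeg_same i, mul_one,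
      one_mul, TensorProduct.tmul_smul, ← TensorProduct.smul_tmul', smul_add, jE,
      e _ _ _ (h.comm_same i), TensorProduct.add_tmul, TensorProduct.tmul_add,
      TensorProduct.tmul_sub, TensorProduct.sub_tmul, smul_sub, smul_smul, i1, i2, one_smul]
    abel
  · intro i j hij
    simp only [mul_add, add_mul, Algebra.TensorProduct.tmul_mul_tmul, h.k_eNeg_ne i j hij, mul_one,
      one_mul, TensorProduct.tmul_smul, ← TensorProduct.smul_tmul', smul_add, jE' j i hij.symm,
      h.comm_ne i j hij, smul_smul, i1, i2, one_smul]
    abel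
  · intro i j hij
    apply qSerre_add_add
    · simp only [Algebra.TensorProduct.tmul_mul_tmul, h.k_ePos_same i, mul_one, one_mul,
        ← TensorProduct.smul_tmul']
    · simp only [Algebra.TensorProduct.tmul_mul_tmul, h.k_ePos_ne i j hij, mul_one, one_mul,
        ← TensorProduct.smul_tmul']
    · simp only [Algebra.TensorProduct.tmul_mul_tmul, h.k_ePos_ne j i hij.symm, mul_one, one_mul,
        ← TensorProduct.smul_tmul']
    · have s := h.serre_ePos i j hij
      have c1 : k q i * k q j = 1 := h.k_mul_k i j hij
      have c2 : k q j * k q i = 1 := h.k_mul_k j i hij.symm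
      have c4 : ∀ t, k q i * (k q j * t) = t := fun t => by rw [← mul_assoc, c1, one_mul]
      have c3 : ∀ t, k q j * (k q i * t) = t := fun t => by rw [← mul_assoc, c2, one_mul]
      rw [qSerre_eq] at s ⊢
      simp only [Algebra.TensorProduct.tmul_mul_tmul, mul_assoc, c1, c2, c3, c4, mul_one, one_mul]
      simp only [mul_assoc] at s
      rw [← TensorProduct.tmul_smul, ← TensorProduct.tmul_smul, ← TensorProduct.tmul_sub,
        ← TensorProduct.tmul_add, ← TensorProduct.tmul_sub, s,
        TensorProduct.tmul_zero]
    · rw [serre_left, h.serre_ePos i j hij, TensorProduct.zero_tmul]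
  · intro i j hij
    rw [add_comm, add_comm ((1 : LoopAlg q) ⊗ₜ[ℂ] eNeg q j)]
    apply qSerre_add_add
    · simp only [Algebra.TensorProduct.tmul_mul_tmul, jF, mul_one, one_mul,
        TensorProduct.tmul_smul]
    · simp only [Algebra.TensorProduct.tmul_mul_tmul, jF' i j hij, mul_one, one_mul,
        TensorProduct.tmul_smul]
    · simp only [Algebra.TensorProduct.tmul_mul_tmul, jF' j i hij.symm, mul_one, one_mul,
        TensorProduct.tmul_smul]
    · have s := h.serre_eNeg i j hij
      have c1 := kinvij i j hij
      rw [qSerre_eq] at s ⊢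
      have c2 : ∀ t, kInv q i * (kInv q j * t) = kInv q j * (kInv q i * t) := fun t => by
        rw [← mul_assoc, c1, mul_assoc]
      simp only [Algebra.TensorProduct.tmul_mul_tmul, mul_assoc, c1, c2]
      simp only [mul_assoc] at s
      rw [TensorProduct.smul_tmul', TensorProduct.smul_tmul', ← TensorProduct.sub_tmul,
        ← TensorProduct.add_tmul, ← TensorProduct.sub_tmul, s,
        TensorProduct.zero_tmul]
    · have s := h.serre_eNeg i j hij
      rw [qSerre_eq] at s ⊢
      simp only [Algebra.TensorProduct.tmul_mul_tmul, mul_one]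
      rw [← TensorProduct.tmul_smul, ← TensorProduct.tmul_smul, ← TensorProduct.tmul_sub,
        ← TensorProduct.tmul_add, ← TensorProduct.tmul_sub, s, TensorProduct.tmul_zero]

/-- The coproduct `Δ : 𝓛 → 𝓛 ⊗ 𝓛`, determined by `Δ(kᵢ^{±1}) = kᵢ^{±1} ⊗ kᵢ^{±1}`,
`Δ(e⁺ᵢ) = kᵢ ⊗ e⁺ᵢ + e⁺ᵢ ⊗ 1` and `Δ(e⁻ᵢ) = 1 ⊗ e⁻ᵢ + e⁻ᵢ ⊗ kᵢ⁻¹`; the last equation is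
equivalent to `Δ(e⁻ᵢ kᵢ) = kᵢ ⊗ e⁻ᵢ kᵢ + e⁻ᵢ kᵢ ⊗ 1`, see `coproduct_eNeg_mul_k`. -/
noncomputable def coproduct (q : ℂˣ) : LoopAlg q →ₐ[ℂ] LoopAlg q ⊗[ℂ] LoopAlg q :=
  lift (coproduct_aux q)

theorem coproduct_eNeg_mul_k (q : ℂˣ) (i : Fin 2) : coproduct q (eNeg q i * k q i) =
    k q i ⊗ₜ (eNeg q i * k q i) + (eNeg q i * k q i) ⊗ₜ 1 := by
  have e1 : coproduct q (eNeg q i) = 1 ⊗ₜ eNeg q i + eNeg q i ⊗ₜ kInv q i :=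
    lift_gen (coproduct_aux q) _
  have e2 : coproduct q (k q i) = k q i ⊗ₜ k q i := lift_gen (coproduct_aux q) _
  rw [map_mul, e1, e2, add_mul, Algebra.TensorProduct.tmul_mul_tmul,
    Algebra.TensorProduct.tmul_mul_tmul, one_mul, (isLoopFamily q).kInv_mul_k]

end LoopAlg


/-- The three cases `(ε, ε*) = (1, 1), (1, 0), (0, 0)`. -/
inductive Kind : Type
  | first
  | second
  | third

namespace Kind
/-- The parameter `ε`. -/
def eps : Kind → ℂ
  | first => 1
  | second => 1
  | third => 0
/-- The parameter `ε*`. -/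
def epsStar : Kind → ℂ
  | first => 1
  | second => 0
  | third => 0
end Kind

open LoopAlg in
/-- The algebra `𝓛_κ` whose modules are considered: `𝓛` itself if `(ε, ε*) = (1, 1)`, the
subalgebra of `𝓛` generated by all generators except `e⁻₀` if `(ε, ε*) = (1, 0)`, and the Borel
subalgebra generated by `e⁺₀, e⁺₁, kᵢ^{±1}` if `(ε, ε*) = (0, 0)`. -/
noncomputable def subLoop (q : ℂˣ) : Kind → Subalgebra ℂ (LoopAlg q)
  | .first => ⊤
  | .second => Algebra.adjoin ℂ
      {ePos q 0, ePos q 1, eNeg q 1, k q 0, k q 1, kInv q 0, kInv q 1}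
  | .third => Algebra.adjoin ℂ {ePos q 0, ePos q 1, k q 0, k q 1, kInv q 0, kInv q 1}

section subLoop
open LoopAlg
variable (q : ℂˣ) (κ : Kind)

theorem ePos_mem (i : Fin 2) : ePos q i ∈ subLoop q κ := by
  cases κ
  · exact Algebra.mem_top
  all_goals exact Algebra.subset_adjoin (by fin_cases i <;> simp)

theorem k_mem (i : Fin 2) : k q i ∈ subLoop q κ := by
  cases κ
  · exact Algebra.mem_top
  all_goals exact Algebra.subset_adjoin (by fin_cases i <;> simp)

theorem kInv_mem (i : Fin 2) : kInv q i ∈ subLoop q κ := by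
  cases κ
  · exact Algebra.mem_top
  all_goals exact Algebra.subset_adjoin (by fin_cases i <;> simp)

theorem eps_smul_eNeg_mem : κ.eps • (eNeg q 1 * k q 1) ∈ subLoop q κ := by
  cases κ
  · exact Algebra.mem_top
  · exact Subalgebra.smul_mem _ (mul_mem (Algebra.subset_adjoin (by simp)) (k_mem q .second 1)) _
  · simp [Kind.eps]

theorem epsStar_smul_eNeg_mem : κ.epsStar • (eNeg q 0 * k q 0) ∈ subLoop q κ := by
  cases κ
  · exact Algebra.mem_top
  · simp [Kind.epsStar]
  · simp [Kind.epsStar]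

/-- The natural (injective) map `𝓛_κ ⊗ 𝓛_κ → 𝓛 ⊗ 𝓛`. -/
noncomputable def subLoopMap : subLoop q κ ⊗[ℂ] subLoop q κ →ₐ[ℂ] LoopAlg q ⊗[ℂ] LoopAlg q :=
  Algebra.TensorProduct.map (subLoop q κ).val (subLoop q κ).val

theorem subLoopMap_injective : Function.Injective (subLoopMap q κ) :=
  TensorProduct.map_injective_of_flat_flat (subLoop q κ).val.toLinearMap
    (subLoop q κ).val.toLinearMap Subtype.val_injective Subtype.val_injective

theorem coproduct_mem (u : subLoop q κ) : coproduct q u ∈ (subLoopMap q κ).range := by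
  have tm : ∀ {a b}, a ∈ subLoop q κ → b ∈ subLoop q κ → a ⊗ₜ[ℂ] b ∈ (subLoopMap q κ).range :=
    fun {a b} ha hb => ⟨⟨a, ha⟩ ⊗ₜ ⟨b, hb⟩, rfl⟩
  have hk : ∀ i, coproduct q (k q i) ∈ (subLoopMap q κ).range := fun i => by
    rw [coproduct, lift_gen]; exact tm (k_mem q κ i) (k_mem q κ i)
  have hkI : ∀ i, coproduct q (kInv q i) ∈ (subLoopMap q κ).range := fun i => by
    rw [coproduct, lift_gen]; exact tm (kInv_mem q κ i) (kInv_mem q κ i)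
  have hE : ∀ i, coproduct q (ePos q i) ∈ (subLoopMap q κ).range := fun i => by
    rw [coproduct, lift_gen]
    exact add_mem (tm (k_mem q κ i) (ePos_mem q κ i)) (tm (ePos_mem q κ i) (one_mem _))
  have hF : ∀ i, eNeg q i ∈ subLoop q κ →
      coproduct q (eNeg q i) ∈ (subLoopMap q κ).range := fun i hi => by
    rw [coproduct, lift_gen]
    exact add_mem (tm (one_mem _) hi) (tm hi (kInv_mem q κ i))
  obtain ⟨u, hu⟩ := u
  change u ∈ (subLoopMap q κ).range.comap (coproduct q)
  revert u
  change subLoop q κ ≤ _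
  cases κ with
  | first =>
    intro u _
    have surj : Function.Surjective (subLoop q .first).val.toLinearMap :=
      fun x => ⟨⟨x, Algebra.mem_top⟩, rfl⟩
    exact TensorProduct.map_surjective surj surj (coproduct q u)
  | second =>
    refine Algebra.adjoin_le ?_
    rintro _ (rfl | rfl | rfl | rfl | rfl | rfl | rfl)
    exacts [hE 0, hE 1, hF 1 (Algebra.subset_adjoin (by simp)), hk 0, hk 1, hkI 0, hkI 1]
  | third =>
    refine Algebra.adjoin_le ?_
    rintro _ (rfl | rfl | rfl | rfl | rfl | rfl)
    exacts [hE 0, hE 1, hk 0, hk 1, hkI 0, hkI 1]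

/-- The restriction `𝓛_κ → 𝓛_κ ⊗ 𝓛_κ` of the coproduct of `𝓛`. -/
noncomputable def subCoproduct : subLoop q κ →ₐ[ℂ] subLoop q κ ⊗[ℂ] subLoop q κ :=
  ((AlgEquiv.ofInjective (subLoopMap q κ) (subLoopMap_injective q κ)).symm : _ →ₐ[ℂ] _).comp
    (((coproduct q).comp (subLoop q κ).val).codRestrict (subLoopMap q κ).range
      (coproduct_mem q κ))

theorem subLoopMap_subCoproduct (u : subLoop q κ) :
    subLoopMap q κ (subCoproduct q κ u) = coproduct q u := by
  have := AlgEquiv.apply_symm_apply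
    (AlgEquiv.ofInjective (subLoopMap q κ) (subLoopMap_injective q κ))
    ⟨coproduct q u, coproduct_mem q κ u⟩
  exact congrArg Subtype.val this

end subLoop

/-- The generators `x, y, k, k⁻¹`. -/
inductive TGen : Type
  | x | y | k | kInv

namespace TGen
abbrev X : FreeAlgebra ℂ TGen := FreeAlgebra.ι ℂ x
abbrev Y : FreeAlgebra ℂ TGen := FreeAlgebra.ι ℂ y
abbrev K : FreeAlgebra ℂ TGen := FreeAlgebra.ι ℂ k
abbrev KI : FreeAlgebra ℂ TGen := FreeAlgebra.ι ℂ kInv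
end TGen

/-- The constant `δ' = -(q - q⁻¹)(q² - q⁻²)(q³ - q⁻³)q⁴`. -/
noncomputable def deltaPrime (q : ℂˣ) : ℂ :=
  -(((q : ℂ) - (q : ℂ)⁻¹) * ((q : ℂ) ^ 2 - (q : ℂ)⁻¹ ^ 2) * ((q : ℂ) ^ 3 - (q : ℂ)⁻¹ ^ 3) *
    (q : ℂ) ^ 4)

open TGen in
/-- The defining relations of the augmented TD-algebra. -/
inductive TRel (q : ℂˣ) (κ : Kind) : FreeAlgebra ℂ TGen → FreeAlgebra ℂ TGen → Prop
  | k_mul_kInv : TRel q κ (K * KI) 1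
  | kInv_mul_k : TRel q κ (KI * K) 1
  | k_x : TRel q κ (K * X * KI) ((q : ℂ) ^ 2 • X)
  | k_y : TRel q κ (K * Y * KI) ((q : ℂ)⁻¹ ^ 2 • Y)
  | td_x : TRel q κ (qSerre q X Y)
      (deltaPrime q • (κ.epsStar • (X ^ 2 * K ^ 2) - κ.eps • (KI ^ 2 * X ^ 2)))
  | td_y : TRel q κ (qSerre q Y X)
      (deltaPrime q • (-(κ.epsStar • (K ^ 2 * Y ^ 2)) + κ.eps • (Y ^ 2 * KI ^ 2)))

/-- The augmented TD-algebra `𝓣` for `(ε, ε*)`, by generators and relations. -/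
def TAlg (q : ℂˣ) (κ : Kind) : Type := RingQuot (TRel q κ)

noncomputable instance (q : ℂˣ) (κ : Kind) : Ring (TAlg q κ) :=
  inferInstanceAs (Ring (RingQuot (TRel q κ)))
noncomputable instance (q : ℂˣ) (κ : Kind) : Algebra ℂ (TAlg q κ) :=
  inferInstanceAs (Algebra ℂ (RingQuot (TRel q κ)))

/-- The image of a generator in `𝓣`. -/
noncomputable def TAlg.gen (q : ℂˣ) (κ : Kind) (g : TGen) : TAlg q κ :=
  RingQuot.mkAlgHom ℂ (TRel q κ) (FreeAlgebra.ι ℂ g)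

section phi
open LoopAlg

/-- The constant `α = -q⁻¹(q - q⁻¹)²`. -/
noncomputable def alpha (q : ℂˣ) : ℂ := -((q : ℂ)⁻¹ * ((q : ℂ) - (q : ℂ)⁻¹) ^ 2)

/-- The images of the generators under `φ_s`: `x ↦ α(s e⁺₀ + ε s⁻¹ e⁻₁ k₁)`,
`y ↦ ε* s e⁻₀ k₀ + s⁻¹ e⁺₁`, `k ↦ s k₀`. -/
noncomputable def phiGen (q : ℂˣ) (κ : Kind) (s : ℂˣ) : TGen → subLoop q κ
  | .x => alpha q • ((s : ℂ) • ⟨ePos q 0, ePos_mem q κ 0⟩ +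
      (s : ℂ)⁻¹ • ⟨κ.eps • (eNeg q 1 * k q 1), eps_smul_eNeg_mem q κ⟩)
  | .y => (s : ℂ) • ⟨κ.epsStar • (eNeg q 0 * k q 0), epsStar_smul_eNeg_mem q κ⟩ +
      (s : ℂ)⁻¹ • ⟨ePos q 1, ePos_mem q κ 1⟩
  | .k => (s : ℂ) • ⟨k q 0, k_mem q κ 0⟩
  | .kInv => (s : ℂ)⁻¹ • ⟨kInv q 0, kInv_mem q κ 0⟩

theorem phi_aux (q : ℂˣ) (κ : Kind) (s : ℂˣ) ⦃a b : FreeAlgebra ℂ TGen⦄ (r : TRel q κ a b) :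
    FreeAlgebra.lift ℂ (phiGen q κ s) a = FreeAlgebra.lift ℂ (phiGen q κ s) b := by
  have hq : (q : ℂ) ≠ 0 := q.ne_zero
  have hs : (s : ℂ) ≠ 0 := s.ne_zero
  have i1 : (q : ℂ)⁻¹ ^ 2 * (q : ℂ) ^ 2 = 1 := by field_simp
  have i2 : (q : ℂ) ^ 2 * (q : ℂ)⁻¹ ^ 2 = 1 := by field_simp
  have h := isLoopFamily q
  have n01 : (0 : Fin 2) ≠ 1 := by decide
  have n10 : (1 : Fin 2) ≠ 0 := by decide
  have hk1 : k q 1 = kInv q 0 := by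
    calc k q 1 = kInv q 0 * (k q 0 * k q 1) := by rw [← mul_assoc, h.kInv_mul_k, one_mul]
      _ = kInv q 0 := by rw [h.k_mul_k 0 1 n01, mul_one]
  have hkI1 : kInv q 1 = k q 0 := by
    calc kInv q 1 = (k q 0 * k q 1) * kInv q 1 := by rw [h.k_mul_k 0 1 n01, one_mul]
      _ = k q 0 := by rw [mul_assoc, h.k_mul_kInv, mul_one]
  set A := ePos q 0 with hA
  set D := ePos q 1 with hD
  set F0 := eNeg q 0 with hF0
  set F1 := eNeg q 1 with hF1
  set κ₀ := k q 0 with hκ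
  set κ₁ := kInv q 0 with hκ'
  have kk : κ₀ * κ₁ = 1 := h.k_mul_kInv 0
  have kk' : κ₁ * κ₀ = 1 := h.kInv_mul_k 0
  have kA : κ₀ * A = (q : ℂ) ^ 2 • (A * κ₀) := h.k_ePos_same 0
  have kD : κ₀ * D = (q : ℂ)⁻¹ ^ 2 • (D * κ₀) := h.k_ePos_ne 0 1 n01
  have kF0 : κ₀ * F0 = (q : ℂ)⁻¹ ^ 2 • (F0 * κ₀) := h.k_eNeg_same 0
  have kF1 : κ₀ * F1 = (q : ℂ) ^ 2 • (F1 * κ₀) := h.k_eNeg_ne 0 1 n01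
  have jA := inv_rule kk kk' i1 kA
  have jD := inv_rule kk kk' i2 kD
  have jF0 := inv_rule kk kk' i2 kF0
  have jF1 := inv_rule kk kk' i1 kF1
  set c : ℂ := ((q : ℂ) - (q : ℂ)⁻¹)⁻¹ with hc
  have cAF : A * F0 = F0 * A + c • (κ₀ - κ₁) := by
    have := h.comm_same 0
    rw [← this]; abel
  have cDF : F1 * D = D * F1 - c • (κ₁ - κ₀) := by
    have := h.comm_same 1
    rw [hkI1, hk1] at this
    rw [← this]; abel
  have cAF1 : A * F1 = F1 * A := h.comm_ne 0 1 n01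
  have cDF0 : D * F0 = F0 * D := h.comm_ne 1 0 n10
  have sF : ∀ (F F' K K' : LoopAlg q) (c d : ℂ), d * c = 1 → K * F = c • (F * K) →
      K' * F = d • (F * K') → K * F' = d • (F' * K) → K' * F' = c • (F' * K') →
      K * K' = 1 → K' * K = 1 →
      qSerre q F F' = 0 → qSerre q (F * K) (F' * K') = 0 := by
    intro F F' K K' c d hcd h1 h2 h3 h4 h5 h6 hS
    have hcd' : c * d = 1 := by rw [mul_comm, hcd]
    have hcd2 : ∀ t, d * (c * t) = t := fun t => by rw [← mul_assoc, hcd, one_mul]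
    have hcd3 : ∀ t, c * (d * t) = t := fun t => by rw [← mul_assoc, hcd', one_mul]
    have h5' : ∀ t, K * (K' * t) = t := fun t => by rw [← mul_assoc, h5, one_mul]
    have h6' : ∀ t, K' * (K * t) = t := fun t => by rw [← mul_assoc, h6, one_mul]
    have e : qSerre q (F * K) (F' * K') = qSerre q F F' * (K * K) := by
      simp only [qSerre_eq, mul_assoc, h2, h3, h4, assoc_rule h1, assoc_rule h2,
        assoc_rule h3, assoc_rule h4, h5, h6, h5', h6', mul_one, mul_smul_comm, smul_mul_assoc,
        smul_smul, add_mul, sub_mul, hcd, hcd', hcd2, hcd3, one_smul]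
    rw [e, hS, zero_mul]
  have main := td_aux q c (alpha q * s) (alpha q * (s : ℂ)⁻¹ * κ.eps) (s * κ.epsStar) (s : ℂ)⁻¹
    (A' := A) (B := F1 * κ₁) (C := F0 * κ₀) (D := D) kk kk' kA
    (by rw [← mul_assoc, kF1, smul_mul_assoc, mul_assoc, mul_assoc, kk, kk'])
    (by rw [← mul_assoc, kF0, smul_mul_assoc])
    kD
    (by rw [← mul_assoc, cAF1, mul_assoc, mul_assoc, jA]; simp only [mul_smul_comm, smul_smul, i2, one_smul, mul_assoc])
    (by rw [← mul_assoc, cDF0, mul_assoc, mul_assoc, kD]; simp only [mul_smul_comm, smul_smul, i2, one_smul, mul_assoc])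
    (by rw [← mul_assoc, cAF, add_mul, mul_assoc, mul_assoc, kA]
        simp only [smul_mul_assoc, mul_smul_comm, smul_smul, i1, i2, kk', sub_mul, one_smul, mul_assoc])
    (by rw [mul_assoc, jD, mul_smul_comm, ← mul_assoc, cDF, sub_mul, smul_sub]
        simp only [smul_mul_assoc, smul_smul, kk, sub_mul, mul_assoc])
    (h.serre_ePos 0 1 n01)
    (sF _ _ _ _ _ _ i2 jF1 kF1 jF0 kF0 kk' kk (h.serre_eNeg 1 0 n10))
    (sF _ _ _ _ _ _ i2 kF0 jF0 kF1 jF1 kk kk' (h.serre_eNeg 0 1 n01))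
    (h.serre_ePos 1 0 n10)
  obtain ⟨m1, m2, m3, m4⟩ := main
  have hx : (phiGen q κ s .x : LoopAlg q) =
      (alpha q * s) • A + (alpha q * (s : ℂ)⁻¹ * κ.eps) • (F1 * κ₁) := by
    simp [phiGen, smul_add, smul_smul, mul_assoc, hk1, hA, hF1]
  have hy : (phiGen q κ s .y : LoopAlg q) = (s * κ.epsStar) • (F0 * κ₀) + (s : ℂ)⁻¹ • D := by
    simp [phiGen, smul_smul, hF0, hD, hκ]
  have hk : (phiGen q κ s .k : LoopAlg q) = (s : ℂ) • κ₀ := by simp [phiGen, hκ]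
  have hkI : (phiGen q κ s .kInv : LoopAlg q) = (s : ℂ)⁻¹ • κ₁ := by simp [phiGen, hκ']
  set x : subLoop q κ := phiGen q κ s .x
  set y : subLoop q κ := phiGen q κ s .y
  rw [← hx] at m1 m2
  rw [← hy] at m3 m4
  have hδ : alpha q * (c * (q : ℂ) ^ 5 * (q ^ 2 - (q : ℂ)⁻¹ ^ 2) * (q ^ 3 - (q : ℂ)⁻¹ ^ 3)) =
      deltaPrime q := by
    have hz : ((q : ℂ) - (q : ℂ)⁻¹) ^ 2 * c = (q : ℂ) - (q : ℂ)⁻¹ := by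
      rw [hc, pow_two, mul_self_mul_inv]
    have hq5 : (q : ℂ)⁻¹ * (q : ℂ) ^ 5 = (q : ℂ) ^ 4 := by field_simp
    simp only [alpha, deltaPrime]
    linear_combination (-(q : ℂ)⁻¹ * (q : ℂ) ^ 5 * (q ^ 2 - (q : ℂ)⁻¹ ^ 2) *
      (q ^ 3 - (q : ℂ)⁻¹ ^ 3)) * hz - (((q : ℂ) - (q : ℂ)⁻¹) * (q ^ 2 - (q : ℂ)⁻¹ ^ 2) *
      (q ^ 3 - (q : ℂ)⁻¹ ^ 3)) * hq5
  have hss : (s : ℂ) * (s : ℂ)⁻¹ = 1 := by field_simp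
  have hss' : (s : ℂ)⁻¹ * (s : ℂ) = 1 := by field_simp
  have kx : κ₀ * (x : LoopAlg q) = (q : ℂ) ^ 2 • ((x : LoopAlg q) * κ₀) := by
    rw [hx, mul_add, add_mul, mul_smul_comm, mul_smul_comm, kA, ← mul_assoc, kF1,
      smul_mul_assoc, smul_mul_assoc, smul_mul_assoc, mul_assoc, mul_assoc, mul_assoc, kk, kk']
    module
  have ky : κ₀ * (y : LoopAlg q) = (q : ℂ)⁻¹ ^ 2 • ((y : LoopAlg q) * κ₀) := by
    rw [hy, mul_add, add_mul, mul_smul_comm, mul_smul_comm, kD, ← mul_assoc, kF0,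
      smul_mul_assoc, smul_mul_assoc, smul_mul_assoc]
    module
  have hq1 : ∀ u v : subLoop q κ, ((qSerre q u v : subLoop q κ) : LoopAlg q) =
      qSerre q (u : LoopAlg q) v := fun u v => map_qSerre q (subLoop q κ).val u v
  cases r with
  | k_mul_kInv =>
    simp only [map_mul, map_one, FreeAlgebra.lift_ι_apply]
    apply Subtype.ext
    rw [MulMemClass.coe_mul, hk, hkI, smul_mul_smul_comm, kk, hss, one_smul]; rfl
  | kInv_mul_k =>
    simp only [map_mul, map_one, FreeAlgebra.lift_ι_apply]
    apply Subtype.ext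
    rw [MulMemClass.coe_mul, hk, hkI, smul_mul_smul_comm, kk', hss', one_smul]; rfl
  | k_x =>
    simp only [map_mul, map_smul, FreeAlgebra.lift_ι_apply]
    apply Subtype.ext
    change (phiGen q κ s .k : LoopAlg q) * (x : LoopAlg q) * (phiGen q κ s .kInv : LoopAlg q) =
      (q : ℂ) ^ 2 • (x : LoopAlg q)
    rw [hk, hkI, smul_mul_assoc, smul_mul_smul_comm, kx, smul_mul_assoc, mul_assoc, kk, hss,
      one_smul, mul_one]
  | k_y =>
    simp only [map_mul, map_smul, FreeAlgebra.lift_ι_apply]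
    apply Subtype.ext
    change (phiGen q κ s .k : LoopAlg q) * (y : LoopAlg q) * (phiGen q κ s .kInv : LoopAlg q) =
      (q : ℂ)⁻¹ ^ 2 • (y : LoopAlg q)
    rw [hk, hkI, smul_mul_assoc, smul_mul_smul_comm, ky, smul_mul_assoc, mul_assoc, kk, hss,
      one_smul, mul_one]
  | td_x =>
    simp only [map_qSerre, map_mul, map_smul, map_sub, map_pow, FreeAlgebra.lift_ι_apply]
    apply Subtype.ext
    change ((qSerre q x y : subLoop q κ) : LoopAlg q) = deltaPrime q • (κ.epsStar •
      ((x : LoopAlg q) ^ 2 * (phiGen q κ s .k : LoopAlg q) ^ 2) - κ.eps •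
      ((phiGen q κ s .kInv : LoopAlg q) ^ 2 * (x : LoopAlg q) ^ 2))
    rw [hq1, hk, hkI, hy, qSerre_add_right, qSerre_smul_right, qSerre_smul_right, m1, m2, ← hδ,
      smul_pow, smul_pow, mul_smul_comm, smul_mul_assoc]
    match_scalars <;> field_simp
  | td_y =>
    simp only [map_qSerre, map_mul, map_smul, map_add, map_neg, map_pow, FreeAlgebra.lift_ι_apply]
    apply Subtype.ext
    change ((qSerre q y x : subLoop q κ) : LoopAlg q) = deltaPrime q • (-(κ.epsStar •
      ((phiGen q κ s .k : LoopAlg q) ^ 2 * (y : LoopAlg q) ^ 2)) + κ.eps •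
      ((y : LoopAlg q) ^ 2 * (phiGen q κ s .kInv : LoopAlg q) ^ 2))
    rw [hq1, hk, hkI, hx, qSerre_add_right, qSerre_smul_right, qSerre_smul_right, m3, m4, ← hδ,
      smul_pow, smul_pow, mul_smul_comm, smul_mul_assoc]
    match_scalars <;> field_simp

/-- The algebra homomorphism `φ_s : 𝓣 → 𝓛_κ`. -/
noncomputable def phi (q : ℂˣ) (κ : Kind) (s : ℂˣ) : TAlg q κ →ₐ[ℂ] subLoop q κ :=
  RingQuot.liftAlgHom ℂ ⟨FreeAlgebra.lift ℂ (phiGen q κ s), phi_aux q κ s⟩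

end phi


/-- The `q`-integer `[j] = (q^j - q^(-j)) / (q - q⁻¹)`. -/
noncomputable def qInt (q : ℂˣ) (j : ℤ) : ℂ :=
  ((q : ℂ) ^ j - (q : ℂ) ^ (-j)) / ((q : ℂ) - (q : ℂ)⁻¹)

/-- The standard basis vector `v_j` of `ℂ^(ℓ+1)` for `0 ≤ j ≤ ℓ`, and `v_j = 0` for other `j`. -/
def stdVec (ℓ : ℕ) (j : ℤ) : Fin (ℓ + 1) → ℂ := fun i => if (i : ℤ) = j then 1 else 0

/-- The operator `v_j ↦ c_j v_{j+t}` (`0 ≤ j ≤ ℓ`). -/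
noncomputable def stdOp (ℓ : ℕ) (c : ℤ → ℂ) (t : ℤ) : Module.End ℂ (Fin (ℓ + 1) → ℂ) :=
  (Pi.basisFun ℂ (Fin (ℓ + 1))).constr ℂ fun j => c j • stdVec ℓ (j + t)

theorem stdVec_eq_zero {ℓ : ℕ} {j : ℤ} (h : j < 0 ∨ (ℓ : ℤ) < j) : stdVec ℓ j = 0 := by
  funext i
  have hi := i.isLt
  have : ¬ (i : ℤ) = j := by omega
  simp [stdVec, this]

theorem stdVec_coe {ℓ : ℕ} (j : Fin (ℓ + 1)) : stdVec ℓ (j : ℤ) = Pi.basisFun ℂ (Fin (ℓ + 1)) j := by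
  funext i
  simp [stdVec, Pi.single_apply, Fin.ext_iff]

theorem stdOp_stdVec {ℓ : ℕ} {c : ℤ → ℂ} {t : ℤ}
    (h : ∀ j : ℤ, (j < 0 ∨ (ℓ : ℤ) < j) → c j • stdVec ℓ (j + t) = 0) (j : ℤ) :
    stdOp ℓ c t (stdVec ℓ j) = c j • stdVec ℓ (j + t) := by
  by_cases hj : j < 0 ∨ (ℓ : ℤ) < j
  · rw [h j hj, stdVec_eq_zero hj, map_zero]
  · have hj' : j.toNat < ℓ + 1 := by omega
    have e : (((⟨j.toNat, hj'⟩ : Fin (ℓ + 1)) : ℕ) : ℤ) = j := by simp; omega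
    rw [← e, stdVec_coe, stdOp, Module.Basis.constr_basis]

theorem end_ext {ℓ : ℕ} {f g : Module.End ℂ (Fin (ℓ + 1) → ℂ)}
    (h : ∀ j : ℤ, f (stdVec ℓ j) = g (stdVec ℓ j)) : f = g :=
  (Pi.basisFun ℂ (Fin (ℓ + 1))).ext fun j => by rw [← stdVec_coe]; exact h j

noncomputable def lowerOp (q : ℂˣ) (ℓ : ℕ) := stdOp ℓ (fun j => qInt q (ℓ - j + 1)) (-1)
noncomputable def raiseOp (q : ℂˣ) (ℓ : ℕ) := stdOp ℓ (fun j => qInt q (j + 1)) 1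
noncomputable def weightOp (q : ℂˣ) (ℓ : ℕ) := stdOp ℓ (fun j => (q : ℂ) ^ (ℓ - 2 * j)) 0
noncomputable def weightOpInv (q : ℂˣ) (ℓ : ℕ) := stdOp ℓ (fun j => (q : ℂ) ^ (2 * j - ℓ)) 0

section ops
variable (q : ℂˣ) (ℓ : ℕ) (j : ℤ)

theorem lowerOp_apply : lowerOp q ℓ (stdVec ℓ j) = qInt q (ℓ - j + 1) • stdVec ℓ (j - 1) := by
  refine stdOp_stdVec (fun j hj => ?_) j
  by_cases h : j = ℓ + 1
  · simp [h, qInt]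
  · rw [stdVec_eq_zero (by omega), smul_zero]

theorem raiseOp_apply : raiseOp q ℓ (stdVec ℓ j) = qInt q (j + 1) • stdVec ℓ (j + 1) := by
  refine stdOp_stdVec (fun j hj => ?_) j
  by_cases h : j = -1
  · simp [h, qInt]
  · rw [stdVec_eq_zero (by omega), smul_zero]

theorem weightOp_apply : weightOp q ℓ (stdVec ℓ j) = (q : ℂ) ^ (ℓ - 2 * j) • stdVec ℓ j := by
  have := stdOp_stdVec (ℓ := ℓ) (c := fun j => (q : ℂ) ^ (ℓ - 2 * j)) (t := 0)
    (fun j hj => by rw [stdVec_eq_zero (by omega), smul_zero]) j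
  rwa [add_zero] at this

theorem weightOpInv_apply :
    weightOpInv q ℓ (stdVec ℓ j) = (q : ℂ) ^ (2 * j - ℓ) • stdVec ℓ j := by
  have := stdOp_stdVec (ℓ := ℓ) (c := fun j => (q : ℂ) ^ (2 * j - ℓ)) (t := 0)
    (fun j hj => by rw [stdVec_eq_zero (by omega), smul_zero]) j
  rwa [add_zero] at this

theorem weight_mul_inv : weightOp q ℓ * weightOpInv q ℓ = 1 := end_ext fun j => by
  have hq : (q : ℂ) ≠ 0 := q.ne_zero
  rw [Module.End.mul_apply, weightOpInv_apply, map_smul, weightOp_apply, smul_smul,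
    ← zpow_add₀ hq, Module.End.one_apply]
  ring_nf; simp

theorem inv_mul_weight : weightOpInv q ℓ * weightOp q ℓ = 1 := end_ext fun j => by
  have hq : (q : ℂ) ≠ 0 := q.ne_zero
  rw [Module.End.mul_apply, weightOp_apply, map_smul, weightOpInv_apply, smul_smul,
    ← zpow_add₀ hq, Module.End.one_apply]
  ring_nf; simp

theorem weight_mul_lower :
    weightOp q ℓ * lowerOp q ℓ = (q : ℂ) ^ 2 • (lowerOp q ℓ * weightOp q ℓ) :=
  end_ext fun j => by
  have hq : (q : ℂ) ≠ 0 := q.ne_zero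
  rw [Module.End.mul_apply, lowerOp_apply, map_smul, weightOp_apply, LinearMap.smul_apply,
    Module.End.mul_apply, weightOp_apply, map_smul, lowerOp_apply, smul_smul, smul_smul, smul_smul]
  congr 1
  have : (ℓ : ℤ) - 2 * (j - 1) = 2 + (ℓ - 2 * j) := by ring
  rw [this, zpow_add₀ hq]
  norm_cast; ring

theorem weight_mul_raise :
    weightOp q ℓ * raiseOp q ℓ = (q : ℂ)⁻¹ ^ 2 • (raiseOp q ℓ * weightOp q ℓ) :=
  end_ext fun j => by
  have hq : (q : ℂ) ≠ 0 := q.ne_zero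
  rw [Module.End.mul_apply, raiseOp_apply, map_smul, weightOp_apply, LinearMap.smul_apply,
    Module.End.mul_apply, weightOp_apply, map_smul, raiseOp_apply, smul_smul, smul_smul, smul_smul]
  congr 1
  have : (ℓ : ℤ) - 2 * (j + 1) = -2 + (ℓ - 2 * j) := by ring
  rw [this, zpow_add₀ hq, zpow_neg, inv_pow]
  norm_cast; ring

theorem qInt_identity : qInt q (j + 1) * qInt q (ℓ - j) - qInt q (ℓ - j + 1) * qInt q j =
    ((q : ℂ) - (q : ℂ)⁻¹)⁻¹ * ((q : ℂ) ^ (ℓ - 2 * j) - (q : ℂ) ^ (2 * j - ℓ)) := by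
  have hq : (q : ℂ) ≠ 0 := q.ne_zero
  by_cases hz : (q : ℂ) - (q : ℂ)⁻¹ = 0
  · simp [qInt, hz]
  · simp only [qInt]
    have e1 : (q : ℂ) ^ (ℓ - 2 * j) = (q : ℂ) ^ (ℓ : ℤ) * ((q : ℂ) ^ j)⁻¹ * ((q : ℂ) ^ j)⁻¹ := by
      rw [zpow_sub₀ hq, two_mul, zpow_add₀ hq]; field_simp
    have e2 : (q : ℂ) ^ (2 * j - ℓ) = (q : ℂ) ^ j * (q : ℂ) ^ j * ((q : ℂ) ^ (ℓ : ℤ))⁻¹ := by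
      rw [zpow_sub₀ hq, two_mul, zpow_add₀ hq]; field_simp
    rw [e1, e2]
    simp only [neg_add, neg_sub, zpow_add₀ hq, zpow_sub₀ hq, zpow_neg, zpow_one]
    have hY : (q : ℂ) ^ j ≠ 0 := zpow_ne_zero _ hq
    have hL : (q : ℂ) ^ (ℓ : ℤ) ≠ 0 := zpow_ne_zero _ hq
    generalize (q : ℂ) ^ j = Y at *
    generalize (q : ℂ) ^ (ℓ : ℤ) = Z at *
    generalize hw : (q : ℂ) - (q : ℂ)⁻¹ = w at *
    field_simp
    have hw' : w * q = q ^ 2 - 1 := by rw [← hw]; field_simp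
    linear_combination (Y ^ 4 - Z ^ 2) * hw'

theorem lower_raise : lowerOp q ℓ * raiseOp q ℓ - raiseOp q ℓ * lowerOp q ℓ =
    ((q : ℂ) - (q : ℂ)⁻¹)⁻¹ • (weightOp q ℓ - weightOpInv q ℓ) := end_ext fun j => by
  simp only [LinearMap.sub_apply, LinearMap.smul_apply, Module.End.mul_apply, raiseOp_apply,
    lowerOp_apply, weightOp_apply, weightOpInv_apply, map_smul, smul_smul]
  rw [← sub_smul, smul_smul, sub_add_cancel, add_sub_cancel_right, ← sub_smul, ← qInt_identity]
  ring_nf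
end ops


section evalRep
open LoopAlg Filter Topology

theorem evalFamily (q : ℂˣ) (ℓ : ℕ) (a : ℂˣ) : IsLoopFamily q
    ![((a : ℂ) * q) • raiseOp q ℓ, lowerOp q ℓ]
    ![((a : ℂ)⁻¹ * (q : ℂ)⁻¹) • lowerOp q ℓ, raiseOp q ℓ]
    ![weightOpInv q ℓ, weightOp q ℓ] ![weightOp q ℓ, weightOpInv q ℓ] := by
  have hq : (q : ℂ) ≠ 0 := q.ne_zero
  have ha : (a : ℂ) ≠ 0 := a.ne_zero
  have i1 : (q : ℂ)⁻¹ ^ 2 * (q : ℂ) ^ 2 = 1 := by field_simp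
  have i2 : (q : ℂ) ^ 2 * (q : ℂ)⁻¹ ^ 2 = 1 := by field_simp
  have i3 : ((a : ℂ) * q) * ((a : ℂ)⁻¹ * (q : ℂ)⁻¹) = 1 := by field_simp
  have w1 := weight_mul_inv q ℓ
  have w2 := inv_mul_weight q ℓ
  have l1 := weight_mul_lower q ℓ
  have r1 := weight_mul_raise q ℓ
  have l2 := inv_rule w1 w2 i1 l1
  have r2 := inv_rule w1 w2 i2 r1
  have lr := lower_raise q ℓ
  obtain ⟨s1, s2⟩ := qSerre_of_sl2 q w1 w2 l1 r1 lr
  constructor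
  · intro i j h; fin_cases i <;> fin_cases j <;> simp_all
  · intro i; fin_cases i <;> simp_all
  · intro i; fin_cases i <;> simp_all
  · intro i; fin_cases i
    · simp [-inv_pow, mul_smul_comm, smul_mul_assoc, r2, smul_comm ((q : ℂ) ^ 2)]
    · simpa using l1
  · intro i; fin_cases i
    · simp [-inv_pow, mul_smul_comm, smul_mul_assoc, l2, smul_comm ((q : ℂ)⁻¹ ^ 2)]
    · simpa using r1
  · intro i j h; fin_cases i <;> fin_cases j
    · exact absurd rfl h
    · simpa using l2
    · simp [-inv_pow, mul_smul_comm, smul_mul_assoc, r1, smul_comm ((q : ℂ)⁻¹ ^ 2)]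
    · exact absurd rfl h
  · intro i j h; fin_cases i <;> fin_cases j
    · exact absurd rfl h
    · simpa using r2
    · simp [-inv_pow, mul_smul_comm, smul_mul_assoc, l1, smul_comm ((q : ℂ) ^ 2)]
    · exact absurd rfl h
  · intro i; fin_cases i
    · change (((a : ℂ) * q) • raiseOp q ℓ) * (((a : ℂ)⁻¹ * (q : ℂ)⁻¹) • lowerOp q ℓ) -
        (((a : ℂ)⁻¹ * (q : ℂ)⁻¹) • lowerOp q ℓ) * (((a : ℂ) * q) • raiseOp q ℓ) =
        ((q : ℂ) - (q : ℂ)⁻¹)⁻¹ • (weightOpInv q ℓ - weightOp q ℓ)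
      rw [smul_mul_smul_comm, smul_mul_smul_comm, i3, mul_comm _ ((a : ℂ) * q), i3, one_smul,
        one_smul, ← neg_sub, lr, ← neg_sub (weightOp q ℓ), smul_neg]
    · exact lr
  · intro i j h; fin_cases i <;> fin_cases j
    · exact absurd rfl h
    · simp
    · simp
    · exact absurd rfl h
  · intro i j h; fin_cases i <;> fin_cases j
    · exact absurd rfl h
    · change qSerre q (((a : ℂ) * q) • raiseOp q ℓ) (lowerOp q ℓ) = 0
      rw [qSerre_smul_left, s1, smul_zero]
    · change qSerre q (lowerOp q ℓ) (((a : ℂ) * q) • raiseOp q ℓ) = 0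
      rw [qSerre_smul_right, s2, smul_zero]
    · exact absurd rfl h
  · intro i j h; fin_cases i <;> fin_cases j
    · exact absurd rfl h
    · change qSerre q (((a : ℂ)⁻¹ * (q : ℂ)⁻¹) • lowerOp q ℓ) (raiseOp q ℓ) = 0
      rw [qSerre_smul_left, s2, smul_zero]
    · change qSerre q (raiseOp q ℓ) (((a : ℂ)⁻¹ * (q : ℂ)⁻¹) • lowerOp q ℓ) = 0
      rw [qSerre_smul_right, s1, smul_zero]
    · exact absurd rfl h

/-- The evaluation module of `𝓛` for `a ≠ 0`, as a representation. -/
noncomputable def loopEval (q : ℂˣ) (ℓ : ℕ) (a : ℂˣ) :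
    LoopAlg q →ₐ[ℂ] Module.End ℂ (Fin (ℓ + 1) → ℂ) :=
  lift (evalFamily q ℓ a)

/-- The formulas for the action of the generators on the standard basis of the evaluation module
`V(ℓ, a)`. The formula for `e⁻₀` is required only for `𝓛`, the one for `e⁻₁` only where `e⁻₁` is
one of the generators; `k₀⁻¹`, `k₁⁻¹` act as the inverses of `k₀`, `k₁`. -/
structure IsEvalAction {q : ℂˣ} {κ : Kind} {ℓ : ℕ} (a : ℂ)
    (ρ : subLoop q κ →ₐ[ℂ] Module.End ℂ (Fin (ℓ + 1) → ℂ)) : Prop where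
  k_zero : ∀ j : ℤ, ρ ⟨k q 0, k_mem q κ 0⟩ (stdVec ℓ j) =
    (q : ℂ) ^ (2 * j - ℓ) • stdVec ℓ j
  k_one : ∀ j : ℤ, ρ ⟨k q 1, k_mem q κ 1⟩ (stdVec ℓ j) =
    (q : ℂ) ^ (ℓ - 2 * j) • stdVec ℓ j
  ePos_zero : ∀ j : ℤ, ρ ⟨ePos q 0, ePos_mem q κ 0⟩ (stdVec ℓ j) =
    (a * q * qInt q (j + 1)) • stdVec ℓ (j + 1)
  eNeg_zero : κ = .first → ∀ h : eNeg q 0 ∈ subLoop q κ, ∀ j : ℤ, ρ ⟨eNeg q 0, h⟩ (stdVec ℓ j) =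
    (a⁻¹ * (q : ℂ)⁻¹ * qInt q (ℓ - j + 1)) • stdVec ℓ (j - 1)
  ePos_one : ∀ j : ℤ, ρ ⟨ePos q 1, ePos_mem q κ 1⟩ (stdVec ℓ j) =
    qInt q (ℓ - j + 1) • stdVec ℓ (j - 1)
  eNeg_one : κ ≠ .third → ∀ h : eNeg q 1 ∈ subLoop q κ, ∀ j : ℤ, ρ ⟨eNeg q 1, h⟩ (stdVec ℓ j) =
    qInt q (j + 1) • stdVec ℓ (j + 1)

theorem isEvalAction_loopEval (q : ℂˣ) (κ : Kind) (ℓ : ℕ) (a : ℂˣ) :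
    IsEvalAction (κ := κ) (a : ℂ) ((loopEval q ℓ a).comp (subLoop q κ).val) := by
  constructor
  · intro j
    have e : loopEval q ℓ a (k q 0) = weightOpInv q ℓ := lift_gen _ _
    exact (LinearMap.congr_fun e _).trans (weightOpInv_apply q ℓ j)
  · intro j
    have e : loopEval q ℓ a (k q 1) = weightOp q ℓ := lift_gen _ _
    exact (LinearMap.congr_fun e _).trans (weightOp_apply q ℓ j)
  · intro j
    have e : loopEval q ℓ a (ePos q 0) = ((a : ℂ) * q) • raiseOp q ℓ := lift_gen _ _
    refine (LinearMap.congr_fun e _).trans ?_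
    rw [LinearMap.smul_apply, raiseOp_apply, smul_smul]
  · intro _ _ j
    have e : loopEval q ℓ a (eNeg q 0) = ((a : ℂ)⁻¹ * (q : ℂ)⁻¹) • lowerOp q ℓ := lift_gen _ _
    refine (LinearMap.congr_fun e _).trans ?_
    rw [LinearMap.smul_apply, lowerOp_apply, smul_smul]
  · intro j
    have e : loopEval q ℓ a (ePos q 1) = lowerOp q ℓ := lift_gen _ _
    exact (LinearMap.congr_fun e _).trans (lowerOp_apply q ℓ j)
  · intro _ _ j
    have e : loopEval q ℓ a (eNeg q 1) = raiseOp q ℓ := lift_gen _ _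
    exact (LinearMap.congr_fun e _).trans (raiseOp_apply q ℓ j)

/-- The matrix of the action of `u` on `V(ℓ, a)`. -/
noncomputable def evalMat (q : ℂˣ) (ℓ : ℕ) (u : LoopAlg q) (a : ℂˣ) :
    Matrix (Fin (ℓ + 1)) (Fin (ℓ + 1)) ℂ := LinearMap.toMatrixAlgEquiv' (loopEval q ℓ a u)

/-- The filter `a → 0` on `ℂ^×`. -/
noncomputable def toZero : Filter ℂˣ := comap (fun a : ℂˣ => (a : ℂ)) (𝓝[≠] 0)

instance : NeBot toZero := by
  refine NeBot.comap_of_range_mem inferInstance ?_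
  filter_upwards [self_mem_nhdsWithin] with a ha
  exact ⟨Units.mk0 a ha, rfl⟩

theorem tendsto_toZero : Tendsto (fun a : ℂˣ => (a : ℂ)) toZero (𝓝 0) :=
  tendsto_comap.mono_right nhdsWithin_le_nhds

/-- The elements of `𝓛` whose action on `V(ℓ, a)` has a limit as `a → 0`. -/
noncomputable def limitSubalgebra (q : ℂˣ) (ℓ : ℕ) : Subalgebra ℂ (LoopAlg q) where
  carrier := {u | ∃ M, Tendsto (evalMat q ℓ u) toZero (𝓝 M)}
  mul_mem' := by
    rintro u v ⟨M, hM⟩ ⟨N, hN⟩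
    refine ⟨M * N, (hM.mul hN).congr fun a => ?_⟩
    simp [evalMat]
  add_mem' := by
    rintro u v ⟨M, hM⟩ ⟨N, hN⟩
    refine ⟨M + N, (hM.add hN).congr fun a => ?_⟩
    simp [evalMat]
  algebraMap_mem' c := ⟨algebraMap ℂ _ c, tendsto_const_nhds.congr fun a => by
    simp only [evalMat, AlgHom.commutes, AlgEquiv.commutes]⟩

/-- The limit of the actions on `V(ℓ, a)` as `a → 0`. -/
noncomputable def limitMat (q : ℂˣ) (ℓ : ℕ) :
    limitSubalgebra q ℓ →ₐ[ℂ] Matrix (Fin (ℓ + 1)) (Fin (ℓ + 1)) ℂ where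
  toFun u := u.2.choose
  map_one' := tendsto_nhds_unique (1 : limitSubalgebra q ℓ).2.choose_spec
    (tendsto_const_nhds.congr fun a => by simp [evalMat])
  map_zero' := tendsto_nhds_unique (0 : limitSubalgebra q ℓ).2.choose_spec
    (tendsto_const_nhds.congr fun a => by simp [evalMat])
  map_mul' u v := tendsto_nhds_unique (u * v).2.choose_spec
    ((u.2.choose_spec.mul v.2.choose_spec).congr fun a => by simp [evalMat])
  map_add' u v := tendsto_nhds_unique (u + v).2.choose_spec
    ((u.2.choose_spec.add v.2.choose_spec).congr fun a => by simp [evalMat])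
  commutes' c := tendsto_nhds_unique (algebraMap ℂ (limitSubalgebra q ℓ) c).2.choose_spec
    (tendsto_const_nhds.congr fun a => by
      change _ = LinearMap.toMatrixAlgEquiv' (loopEval q ℓ a (algebraMap ℂ _ c))
      simp only [AlgHom.commutes, AlgEquiv.commutes])

theorem limitMat_eq {q : ℂˣ} {ℓ : ℕ} (u : limitSubalgebra q ℓ)
    {M : Matrix (Fin (ℓ + 1)) (Fin (ℓ + 1)) ℂ} (h : Tendsto (evalMat q ℓ u) toZero (𝓝 M)) :
    limitMat q ℓ u = M := tendsto_nhds_unique u.2.choose_spec h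

theorem tendsto_ePos_zero (q : ℂˣ) (ℓ : ℕ) :
    Tendsto (evalMat q ℓ (ePos q 0)) toZero (𝓝 0) := by
  have : Tendsto (fun a : ℂˣ => ((a : ℂ) * q) • LinearMap.toMatrixAlgEquiv' (raiseOp q ℓ))
      toZero (𝓝 ((0 * (q : ℂ)) • LinearMap.toMatrixAlgEquiv' (raiseOp q ℓ))) :=
    (tendsto_toZero.mul_const _).smul_const _
  rw [zero_mul, zero_smul] at this
  refine this.congr fun a => ?_
  rw [evalMat, loopEval, lift_gen, ← map_smul]; rfl

theorem tendsto_gen {q : ℂˣ} {ℓ : ℕ} (g : LoopGen) (f : Module.End ℂ (Fin (ℓ + 1) → ℂ))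
    (h : ∀ a, loopEval q ℓ a (gen q g) = f) :
    Tendsto (evalMat q ℓ (gen q g)) toZero (𝓝 (LinearMap.toMatrixAlgEquiv' f)) :=
  tendsto_const_nhds.congr fun a => by rw [evalMat, h]

theorem subLoop_second_le (q : ℂˣ) (ℓ : ℕ) : subLoop q .second ≤ limitSubalgebra q ℓ := by
  refine Algebra.adjoin_le ?_
  rintro _ (rfl | rfl | rfl | rfl | rfl | rfl | rfl)
  · exact ⟨_, tendsto_ePos_zero q ℓ⟩
  all_goals exact ⟨_, tendsto_gen _ _ fun a => lift_gen (evalFamily q ℓ a) _⟩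

/-- The evaluation module `V(ℓ, 0)` of the subalgebra for `(ε, ε*) = (1, 0)`. -/
noncomputable def limitEval (q : ℂˣ) (ℓ : ℕ) :
    subLoop q .second →ₐ[ℂ] Module.End ℂ (Fin (ℓ + 1) → ℂ) :=
  (LinearMap.toMatrixAlgEquiv' (R := ℂ) (n := Fin (ℓ + 1))).symm.toAlgHom.comp
    ((limitMat q ℓ).comp (Subalgebra.inclusion (subLoop_second_le q ℓ)))

theorem limitEval_eq {q : ℂˣ} {ℓ : ℕ} {u : LoopAlg q} (hu : u ∈ subLoop q .second)
    {f : Module.End ℂ (Fin (ℓ + 1) → ℂ)}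
    (h : Tendsto (evalMat q ℓ u) toZero (𝓝 (LinearMap.toMatrixAlgEquiv' f))) :
    limitEval q ℓ ⟨u, hu⟩ = f := by
  have e := limitMat_eq ⟨u, subLoop_second_le q ℓ hu⟩ h
  exact (congrArg (LinearMap.toMatrixAlgEquiv' (R := ℂ) (n := Fin (ℓ + 1))).symm e).trans
    (AlgEquiv.symm_apply_apply _ f)

theorem limitEval_gen {q : ℂˣ} {ℓ : ℕ} (g : LoopGen) (hg : gen q g ∈ subLoop q .second)
    (f : Module.End ℂ (Fin (ℓ + 1) → ℂ)) (h : ∀ a, loopEval q ℓ a (gen q g) = f) :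
    limitEval q ℓ ⟨gen q g, hg⟩ = f :=
  limitEval_eq hg (tendsto_gen g f h)

theorem isEvalAction_limitEval (q : ℂˣ) (ℓ : ℕ) :
    IsEvalAction (κ := .second) 0 (limitEval q ℓ) := by
  constructor
  · intro j
    have e := limitEval_gen (ℓ := ℓ) (.k 0) (k_mem q _ 0) (weightOpInv q ℓ) fun a => lift_gen _ _
    exact (LinearMap.congr_fun e _).trans (weightOpInv_apply q ℓ j)
  · intro j
    have e := limitEval_gen (ℓ := ℓ) (.k 1) (k_mem q _ 1) (weightOp q ℓ) fun a => lift_gen _ _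
    exact (LinearMap.congr_fun e _).trans (weightOp_apply q ℓ j)
  · intro j
    have e : limitEval q ℓ ⟨ePos q 0, ePos_mem q .second 0⟩ = 0 :=
      limitEval_eq _ (by rw [map_zero]; exact tendsto_ePos_zero q ℓ)
    rw [zero_mul, zero_mul, zero_smul, e, LinearMap.zero_apply]
  · intro h; exact absurd h (by simp)
  · intro j
    have e := limitEval_gen (ℓ := ℓ) (.ePos 1) (ePos_mem q _ 1) (lowerOp q ℓ) fun a => lift_gen _ _
    exact (LinearMap.congr_fun e _).trans (lowerOp_apply q ℓ j)
  · intro _ h j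
    have e := limitEval_gen (ℓ := ℓ) (.eNeg 1) h (raiseOp q ℓ) fun a => lift_gen _ _
    exact (LinearMap.congr_fun e _).trans (raiseOp_apply q ℓ j)

theorem exists_evalAction (q : ℂˣ) (κ : Kind) (ℓ : ℕ) (a : ℂ) (h : κ = .second ∨ a ≠ 0) :
    ∃ ρ : subLoop q κ →ₐ[ℂ] Module.End ℂ (Fin (ℓ + 1) → ℂ), IsEvalAction a ρ := by
  by_cases ha : a = 0
  · obtain rfl : κ = .second := h.resolve_right (not_not_intro ha)
    subst ha
    exact ⟨_, isEvalAction_limitEval q ℓ⟩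
  · exact ⟨_, isEvalAction_loopEval q κ ℓ (Units.mk0 a ha)⟩

end evalRep


/-- The representation of `𝓛_κ` on the evaluation module `V(ℓ, a)`, whose underlying space is
`ℂ^(ℓ+1)`; it is determined by the formulas in `IsEvalAction` because the elements occurring there
generate `𝓛_κ`. -/
noncomputable def evalRep (q : ℂˣ) (κ : Kind) (ℓ : ℕ) (a : ℂ) (h : κ = .second ∨ a ≠ 0) :
    subLoop q κ →ₐ[ℂ] Module.End ℂ (Fin (ℓ + 1) → ℂ) :=
  (exists_evalAction q κ ℓ a h).choose

theorem evalRep_spec (q : ℂˣ) (κ : Kind) (ℓ : ℕ) (a : ℂ) (h : κ = .second ∨ a ≠ 0) :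
    IsEvalAction a (evalRep q κ ℓ a h) :=
  (exists_evalAction q κ ℓ a h).choose_spec

/-- The representation of `𝓛_κ` on `V ⊗ W` through the coproduct. -/
noncomputable def tensorRep {q : ℂˣ} {κ : Kind} {V W : Type*} [AddCommGroup V] [Module ℂ V]
    [AddCommGroup W] [Module ℂ W] (ρ : subLoop q κ →ₐ[ℂ] Module.End ℂ V)
    (ρ' : subLoop q κ →ₐ[ℂ] Module.End ℂ W) : subLoop q κ →ₐ[ℂ] Module.End ℂ (V ⊗[ℂ] W) :=
  (Module.endTensorEndAlgHom (R := ℂ) (A := ℂ) (M := V) (N := W)).comp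
    ((Algebra.TensorProduct.map ρ ρ').comp (subCoproduct q κ))

/-- The parameters `(ℓ, a)` of an evaluation module of `𝓛_κ`: `ℓ ≥ 1`, and `a ≠ 0` unless
`(ε, ε*) = (1, 0)`. -/
structure EvalParam (κ : Kind) : Type where
  ℓ : ℕ
  a : ℂ
  one_le : 1 ≤ ℓ
  ne_zero : κ = .second ∨ a ≠ 0

/-- A complex vector space together with a representation of `𝓛_κ` on it. -/
structure LoopRep (q : ℂˣ) (κ : Kind) : Type 1 where
  carrier : Type
  [addCommGroup : AddCommGroup carrier]
  [module : Module ℂ carrier]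
  ρ : subLoop q κ →ₐ[ℂ] Module.End ℂ carrier

attribute [instance] LoopRep.addCommGroup LoopRep.module

/-- The tensor product `V(ℓ₁, a₁) ⊗ (V(ℓ₂, a₂) ⊗ (⋯ ⊗ V(ℓₙ, aₙ)))` for the nonempty list
`p :: l` of parameters. -/
noncomputable def evalTensor (q : ℂˣ) {κ : Kind} :
    EvalParam κ → List (EvalParam κ) → LoopRep q κ
  | p, [] => ⟨Fin (p.ℓ + 1) → ℂ, evalRep q κ p.ℓ p.a p.ne_zero⟩
  | p, p' :: l => ⟨(Fin (p.ℓ + 1) → ℂ) ⊗[ℂ] (evalTensor q p' l).carrier,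
      tensorRep (evalRep q κ p.ℓ p.a p.ne_zero) (evalTensor q p' l).ρ⟩

section weights
variable {q : ℂˣ} {κ : Kind} {V : Type*} [AddCommGroup V] [Module ℂ V]
  (τ : TAlg q κ →ₐ[ℂ] Module.End ℂ V)

/-- The eigenspace `U_i` of `k` on `V` for the eigenvalue `s q^(2i-d)`. For `q` not a root of unity
these eigenvalues are pairwise distinct. -/
noncomputable def weightSpace (s : ℂˣ) (d i : ℕ) : Submodule ℂ V :=
  Module.End.eigenspace (τ (TAlg.gen q κ .k)) ((s : ℂ) * (q : ℂ) ^ (2 * (i : ℤ) - d))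

/-- The `𝓣`-module `V` has a weight-space decomposition `V = ⊕_{i=0}^d U_i` of type `s` and
diameter `d`, where `k` acts on `U_i` as `s q^(2i-d)`, and the highest weight space `U_0` is
one-dimensional. -/
structure HasWeightDecomposition (s : ℂˣ) (d : ℕ) : Prop where
  isInternal : DirectSum.IsInternal fun i : Fin (d + 1) => weightSpace τ s d i
  finrank_highest : Module.finrank ℂ (weightSpace τ s d 0) = 1

/-- The eigenvalue `σ_i(V)` of `y^i x^i` on the one-dimensional highest weight space `U_0`
(see `sigma_spec`). -/
noncomputable def sigma (s : ℂˣ) (d i : ℕ) : ℂ :=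
  Classical.epsilon fun c : ℂ => ∀ v ∈ weightSpace τ s d 0,
    τ (TAlg.gen q κ .y ^ i * TAlg.gen q κ .x ^ i) v = c • v

theorem TAlg.k_mul (q : ℂˣ) (κ : Kind) :
    TAlg.gen q κ .k * TAlg.gen q κ .x = (q : ℂ) ^ 2 • (TAlg.gen q κ .x * TAlg.gen q κ .k) ∧
    TAlg.gen q κ .k * TAlg.gen q κ .y = (q : ℂ)⁻¹ ^ 2 • (TAlg.gen q κ .y * TAlg.gen q κ .k) := by
  have rel : ∀ {a b}, TRel q κ a b →
      RingQuot.mkAlgHom ℂ (TRel q κ) a = RingQuot.mkAlgHom ℂ (TRel q κ) b :=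
    fun h => RingQuot.mkAlgHom_rel ℂ h
  have inv : TAlg.gen q κ .kInv * TAlg.gen q κ .k = 1 := by
    have := rel (.kInv_mul_k (q := q) (κ := κ)); rwa [map_mul, map_one] at this
  have conj : ∀ (g : TAlg q κ) (c : ℂ), TAlg.gen q κ .k * g * TAlg.gen q κ .kInv = c • g →
      TAlg.gen q κ .k * g = c • (g * TAlg.gen q κ .k) := by
    intro g c h
    rw [← smul_mul_assoc, ← h, mul_assoc _ (TAlg.gen q κ .kInv), inv, mul_one]
  refine ⟨conj _ _ ?_, conj _ _ ?_⟩
  · have := rel (.k_x (q := q) (κ := κ)); rwa [map_mul, map_mul, map_smul] at this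
  · have := rel (.k_y (q := q) (κ := κ)); rwa [map_mul, map_mul, map_smul] at this

theorem sigma_spec {τ : TAlg q κ →ₐ[ℂ] Module.End ℂ V} {s : ℂˣ} {d : ℕ}
    (h : HasWeightDecomposition τ s d) (i : ℕ) : ∀ v ∈ weightSpace τ s d 0,
    τ (TAlg.gen q κ .y ^ i * TAlg.gen q κ .x ^ i) v = sigma τ s d i • v := by
  refine Classical.epsilon_spec (p := fun c : ℂ => ∀ v ∈ weightSpace τ s d 0,
    τ (TAlg.gen q κ .y ^ i * TAlg.gen q κ .x ^ i) v = c • v) ?_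
  obtain ⟨hx, hy⟩ := TAlg.k_mul q κ
  have px : ∀ n : ℕ, TAlg.gen q κ .k * TAlg.gen q κ .x ^ n =
      ((q : ℂ) ^ 2) ^ n • (TAlg.gen q κ .x ^ n * TAlg.gen q κ .k) := by
    intro n
    induction n with
    | zero => simp
    | succ n ih =>
      rw [pow_succ, ← mul_assoc, ih, smul_mul_assoc, mul_assoc, hx, mul_smul_comm, smul_smul,
        pow_succ ((q : ℂ) ^ 2), mul_assoc]
  have py : ∀ n : ℕ, TAlg.gen q κ .k * TAlg.gen q κ .y ^ n =
      ((q : ℂ)⁻¹ ^ 2) ^ n • (TAlg.gen q κ .y ^ n * TAlg.gen q κ .k) := by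
    intro n
    induction n with
    | zero => simp
    | succ n ih =>
      rw [pow_succ, ← mul_assoc, ih, smul_mul_assoc, mul_assoc, hy, mul_smul_comm, smul_smul,
        pow_succ ((q : ℂ)⁻¹ ^ 2), mul_assoc]
  have hq : (q : ℂ) ≠ 0 := q.ne_zero
  have comm : TAlg.gen q κ .k * (TAlg.gen q κ .y ^ i * TAlg.gen q κ .x ^ i) =
      (TAlg.gen q κ .y ^ i * TAlg.gen q κ .x ^ i) * TAlg.gen q κ .k := by
    rw [← mul_assoc, py, smul_mul_assoc, mul_assoc, px, mul_smul_comm, smul_smul, ← mul_pow,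
      ← mul_pow, inv_mul_cancel₀ hq, one_pow, one_pow, one_smul, mul_assoc]
  have maps : ∀ v ∈ weightSpace τ s d 0,
      τ (TAlg.gen q κ .y ^ i * TAlg.gen q κ .x ^ i) v ∈ weightSpace τ s d 0 := by
    intro v hv
    rw [weightSpace, Module.End.mem_eigenspace_iff] at hv ⊢
    rw [← Module.End.mul_apply, ← map_mul, comm, map_mul, Module.End.mul_apply, hv, map_smul]
  obtain ⟨w, hw, hspan⟩ := finrank_eq_one_iff'.1 h.finrank_highest
  obtain ⟨c, hc⟩ := hspan ⟨_, maps w w.2⟩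
  refine ⟨c, fun v hv => ?_⟩
  obtain ⟨b, hb⟩ := hspan ⟨v, hv⟩
  have hb' : b • (w : V) = v := congrArg Subtype.val hb
  have hc' : c • (w : V) = τ (TAlg.gen q κ .y ^ i * TAlg.gen q κ .x ^ i) w :=
    congrArg Subtype.val hc
  rw [← hb', map_smul, ← hc', smul_comm]

open Polynomial in
/-- The Drinfeld polynomial of a `𝓣`-module `V` of type `s` and diameter `d`,
`P_V(X) = Q⁻¹ ∑_{i=0}^d σ_i(V) ∏_{j=i+1}^d (q^j - q^(-j))² (ε s⁻² q^(2(d-j)) + ε* s² q^(-2(d-j)) - X)`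
with `Q = (-1)^d ∏_{j=1}^d (q^j - q^(-j))²`. -/
noncomputable def drinfeldPoly (s : ℂˣ) (d : ℕ) : ℂ[X] :=
  C ((-1) ^ d * ∏ j ∈ Finset.Icc 1 d, ((q : ℂ) ^ j - (q : ℂ)⁻¹ ^ j) ^ 2)⁻¹ *
    ∑ i ∈ Finset.range (d + 1), C (sigma τ s d i) *
      ∏ j ∈ Finset.Icc (i + 1) d, (C (((q : ℂ) ^ j - (q : ℂ)⁻¹ ^ j) ^ 2) *
        (C (κ.eps * (s : ℂ)⁻¹ ^ 2 * (q : ℂ) ^ (2 * (d - j)) +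
          κ.epsStar * (s : ℂ) ^ 2 * (q : ℂ)⁻¹ ^ (2 * (d - j))) - X))

end weights

/-- The `q`-string `S(ℓ, a)`: the multiset of the `a q^(2i-ℓ+1)` for `0 ≤ i ≤ ℓ - 1`. -/
noncomputable def qString (q : ℂˣ) (ℓ : ℕ) (a : ℂ) : Multiset ℂ :=
  (Multiset.range ℓ).map fun i => a * (q : ℂ) ^ (2 * (i : ℤ) - ℓ + 1)

end AugTD

namespace AugTD

/-! The subalgebra `φ_s(𝓣)` behaves as a coideal. If V is an `𝓛_κ`-module via `φ_s` and W an
`𝓛_κ`-module, then on V ⊗ W the generator k acts as k ⊗ k₀, x as x ⊗ 1 + α(k ⊗ e⁺₀ + k⁻¹ ⊗ εe⁻₁k₁),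
and y as y ⊗ 1 + k ⊗ ε*e⁻₀k₀ + k⁻¹ ⊗ e⁺₁. These formulas see V only through its `𝓣`-operators, so
they make sense for bare operators (`TDOps`, `LoopOps`), and the weight relations are all the
structure that the argument needs. In particular W via `φ_s` is the tensor product of W with the
line on which k = s and x = y = 0 (`charOps_tensor`), whose polynomial is 1. Both parts of the
theorem therefore follow from one fact: tensoring any V with V(ℓ, a) multiplies the Drinfel'd
polynomial by the polynomial of the string S(ℓ, a) (`TDOps.IsDrinfeld.tensor_eval`).

For ℓ = 1 this is a computation. Applying y^(n+1) x^(n+1) to u ⊗ v₀, with u of highest weight, gives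
σ'_(n+1) = σ_(n+1) - (q^(n+1) - q^(-n-1))² (ε r⁻² q^(2(d-n)) + ε* r² q^(-2(d-n)) + a + εε*a⁻¹) σ_n
(`tensor_sigma`). This is exactly how the coefficients change when the polynomial is multiplied by λ
+ a + εε*a⁻¹ (`sum_prod_Icc_succ`).

For larger ℓ there is a homomorphism V(ℓ+1, a) → V(1, aq^(-ℓ)) ⊗ V(ℓ, aq) with v₀ ↦ v₀ ⊗ v₀
(`fusion_intertwines`), and S(ℓ+1, a) is the union of the two strings S(1, aq^(-ℓ)) and S(ℓ, aq).
The scalars σ_i depend on the orbit of the highest weight vector alone, so they may be computed in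
the larger module, and induction on ℓ applies. Associativity then handles several tensor factors.

The weight decompositions come from adding weights: the weights r q^(2i-d) are distinct because q is
not a root of unity, and index 0 in a tensor product arises only from index 0 in both factors, hence
from a line. -/

/-! ### Distinct powers of q and independent subspaces. -/

theorem zpow_injective_of_pow_ne_one {q : ℂˣ} (hq : ∀ n : ℕ, 0 < n → q ^ n ≠ 1) :
    Function.Injective fun n : ℤ => (q : ℂ) ^ n := by
  have h : ∀ m n : ℤ, m < n → (q : ℂ) ^ m ≠ (q : ℂ) ^ n := by
    intro m n hmn e
    refine hq (n - m).toNat (by omega) (Units.ext ?_)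
    have e2 : (q : ℂ) ^ (n - m) = 1 := by
      rw [zpow_sub₀ q.ne_zero, ← e, div_self (zpow_ne_zero _ q.ne_zero)]
    rw [← Int.toNat_of_nonneg (show 0 ≤ n - m by omega), zpow_natCast] at e2
    simpa using e2
  intro m n e
  rcases lt_trichotomy m n with hmn | hmn | hmn
  · exact absurd e (h m n hmn)
  · exact hmn
  · exact absurd e.symm (h n m hmn)

/-- By the modular law: `G i` and the sum of the other `E j` span everything, and the latter meets
`E i` trivially. This is how a spanning family inside the weight spaces is seen to exhaust them, so
that the highest weight space is a line without any dimension count. -/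
theorem eq_of_le_of_iSup_eq_top {ι R M : Type*} [Ring R] [AddCommGroup M] [Module R M]
    {E G : ι → Submodule R M} (hE : iSupIndep E) (hle : ∀ i, G i ≤ E i) (hG : ⨆ i, G i = ⊤)
    (i : ι) : G i = E i := by
  refine le_antisymm (hle i) ?_
  have h1 : G i ⊔ ⨆ (j) (_ : j ≠ i), E j = ⊤ := by
    rw [eq_top_iff, ← hG, iSup_le_iff]
    intro j
    by_cases hj : j = i
    · subst hj; exact le_sup_left
    · exact (hle j).trans ((le_iSup₂ (f := fun j (_ : j ≠ i) => E j) j hj).trans le_sup_right)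
  calc E i = (G i ⊔ ⨆ (j) (_ : j ≠ i), E j) ⊓ E i := by rw [h1, top_inf_eq]
    _ = G i ⊔ (⨆ (j) (_ : j ≠ i), E j) ⊓ E i := (sup_inf_assoc_of_le _ (hle i))
    _ ≤ G i := by rw [(hE i).symm.eq_bot, sup_bot_eq]

/-! ### Bare operators and their tensor products. -/

/-- Operators by which the generators `k, k⁻¹, x, y` of `𝓣` act on a vector space. -/
structure TDOps (V : Type*) [AddCommGroup V] [Module ℂ V] where
  K : Module.End ℂ V
  Ki : Module.End ℂ V
  X : Module.End ℂ V
  Y : Module.End ℂ V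

/-- Operators by which `k₀, k₀⁻¹, e⁺₀, ε e⁻₁ k₁, e⁺₁, ε* e⁻₀ k₀` act on a vector space. -/
structure LoopOps (W : Type*) [AddCommGroup W] [Module ℂ W] where
  k : Module.End ℂ W
  ki : Module.End ℂ W
  e0 : Module.End ℂ W
  f1 : Module.End ℂ W
  e1 : Module.End ℂ W
  f0 : Module.End ℂ W

section
variable {V V' W W' : Type*} [AddCommGroup V] [Module ℂ V] [AddCommGroup V'] [Module ℂ V']
  [AddCommGroup W] [Module ℂ W] [AddCommGroup W'] [Module ℂ W']

/-- The weight relations between the operators of a `𝓣`-module. -/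
structure TDOps.IsWeighted (T : TDOps V) (q : ℂˣ) : Prop where
  K_mul_Ki : T.K * T.Ki = 1
  Ki_mul_K : T.Ki * T.K = 1
  K_mul_X : T.K * T.X = (q : ℂ) ^ 2 • (T.X * T.K)
  K_mul_Y : T.K * T.Y = (q : ℂ)⁻¹ ^ 2 • (T.Y * T.K)

/-- The weight relations between the operators of an `𝓛_κ`-module. -/
structure LoopOps.IsWeighted (A : LoopOps W) (q : ℂˣ) : Prop where
  k_mul_ki : A.k * A.ki = 1
  ki_mul_k : A.ki * A.k = 1
  k_mul_e0 : A.k * A.e0 = (q : ℂ) ^ 2 • (A.e0 * A.k)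
  k_mul_f1 : A.k * A.f1 = (q : ℂ) ^ 2 • (A.f1 * A.k)
  k_mul_e1 : A.k * A.e1 = (q : ℂ)⁻¹ ^ 2 • (A.e1 * A.k)
  k_mul_f0 : A.k * A.f0 = (q : ℂ)⁻¹ ^ 2 • (A.f0 * A.k)

/-- The linear map `f` commutes with the operators. -/
structure TDOps.Intertwines (T : TDOps V) (T' : TDOps V') (f : V →ₗ[ℂ] V') : Prop where
  K : ∀ v, f (T.K v) = T'.K (f v)
  Ki : ∀ v, f (T.Ki v) = T'.Ki (f v)
  X : ∀ v, f (T.X v) = T'.X (f v)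
  Y : ∀ v, f (T.Y v) = T'.Y (f v)

/-- The linear map `f` commutes with the operators. -/
structure LoopOps.Intertwines (A : LoopOps W) (A' : LoopOps W') (f : W →ₗ[ℂ] W') : Prop where
  k : ∀ v, f (A.k v) = A'.k (f v)
  ki : ∀ v, f (A.ki v) = A'.ki (f v)
  e0 : ∀ v, f (A.e0 v) = A'.e0 (f v)
  f1 : ∀ v, f (A.f1 v) = A'.f1 (f v)
  e1 : ∀ v, f (A.e1 v) = A'.e1 (f v)
  f0 : ∀ v, f (A.f0 v) = A'.f0 (f v)

open TensorProduct in
/-- The operators of the tensor product of two `𝓛_κ`-modules. -/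
noncomputable def LoopOps.tensor (A : LoopOps W) (A' : LoopOps W') : LoopOps (W ⊗[ℂ] W') where
  k := map A.k A'.k
  ki := map A.ki A'.ki
  e0 := map A.k A'.e0 + map A.e0 1
  f1 := map A.ki A'.f1 + map A.f1 1
  e1 := map A.ki A'.e1 + map A.e1 1
  f0 := map A.k A'.f0 + map A.f0 1

open TensorProduct in
/-- The operators on the tensor product of a `𝓣`-module with an `𝓛_κ`-module. When the
`𝓣`-module comes from an `𝓛_κ`-module via `φ_s`, this is the tensor product via `φ_s`. -/
noncomputable def TDOps.tensor (T : TDOps V) (q : ℂˣ) (A : LoopOps W) : TDOps (V ⊗[ℂ] W) where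
  K := map T.K A.k
  Ki := map T.Ki A.ki
  X := map T.X 1 + alpha q • (map T.K A.e0 + map T.Ki A.f1)
  Y := map T.Y 1 + (map T.K A.f0 + map T.Ki A.e1)

/-- The operators of an `𝓛_κ`-module regarded as a `𝓣`-module via `φ_s`. -/
noncomputable def LoopOps.twist (A : LoopOps W) (q s : ℂˣ) : TDOps W where
  K := (s : ℂ) • A.k
  Ki := (s : ℂ)⁻¹ • A.ki
  X := alpha q • ((s : ℂ) • A.e0 + (s : ℂ)⁻¹ • A.f1)
  Y := (s : ℂ) • A.f0 + (s : ℂ)⁻¹ • A.e1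

/-- The one-dimensional `𝓣`-module on which `k` acts as `s` and `x`, `y` act as zero. -/
noncomputable def charOps (s : ℂˣ) : TDOps ℂ where
  K := (s : ℂ) • 1
  Ki := (s : ℂ)⁻¹ • 1
  X := 0
  Y := 0

/-- This is coassociativity: k acts diagonally, so both bracketings expand x and y into the same
terms, in which powers of k stand to the left of the one factor acted on. It moves an evaluation
module from the right factor into the module on the left, which drives the inductions on ℓ and on
the number of factors. -/
theorem TDOps.tensor_assoc (T : TDOps V) (q : ℂˣ) (A : LoopOps W) (A' : LoopOps W') :
    ((T.tensor q A).tensor q A').Intertwines (T.tensor q (A.tensor A'))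
      (TensorProduct.assoc ℂ V W W' : (V ⊗[ℂ] W) ⊗[ℂ] W' →ₗ[ℂ] V ⊗[ℂ] (W ⊗[ℂ] W')) := by
  constructor <;> intro v
  all_goals
    induction v with
    | zero => simp
    | add a b ha hb => simp only [map_add, ha, hb]
    | tmul x c =>
      induction x with
      | zero => simp
      | add a b ha hb => simp only [map_add, TensorProduct.add_tmul, ha, hb]
      | tmul a b =>
        simp [TDOps.tensor, LoopOps.tensor, TensorProduct.add_tmul, TensorProduct.tmul_add,
          ← TensorProduct.smul_tmul']
        try module

theorem TDOps.tensor_lTensor (T : TDOps V) (q : ℂˣ) {A : LoopOps W} {A' : LoopOps W'}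
    {f : W →ₗ[ℂ] W'} (h : A.Intertwines A' f) :
    (T.tensor q A).Intertwines (T.tensor q A') (f.lTensor V) := by
  constructor <;> intro v
  all_goals
    induction v with
    | zero => simp
    | add a b ha hb => simp only [map_add, ha, hb]
    | tmul a b => simp [TDOps.tensor, h.k, h.ki, h.e0, h.f1, h.e1, h.f0]

/-- Each summand carries s or s⁻¹ once, and the first factor can absorb it, as the scalar in K = s
k₀ or in its own twisted X and Y. Hence the second factor stays untwisted and the type of V ⊗ V' is
that of V. -/
theorem LoopOps.twist_tensor (A : LoopOps W) (A' : LoopOps W') (q s : ℂˣ) :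
    (A.tensor A').twist q s = (A.twist q s).tensor q A' := by
  simp only [LoopOps.twist, LoopOps.tensor, TDOps.tensor, TDOps.mk.injEq,
    TensorProduct.map_smul_left, TensorProduct.map_add_left]
  refine ⟨trivial, trivial, ?_, ?_⟩ <;> module

/-- On the line with x = y = 0 and k = s the surviving terms of X and Y are precisely the formulas
for `φ_s`. Thus a module via `φ_s` is a special case of a tensor product with a `𝓣`-module. -/
theorem charOps_tensor (A : LoopOps W) (q s : ℂˣ) :
    ((charOps s).tensor q A).Intertwines (A.twist q s)
      (TensorProduct.lid ℂ W : ℂ ⊗[ℂ] W →ₗ[ℂ] W) := by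
  constructor <;> intro v
  all_goals
    induction v with
    | zero => simp
    | add a b ha hb => simp only [map_add, ha, hb]
    | tmul a b =>
      simp [TDOps.tensor, charOps, LoopOps.twist, smul_smul]
      try module

theorem TDOps.tensor_isWeighted {T : TDOps V} {A : LoopOps W} {q : ℂˣ}
    (h : T.IsWeighted q) (h' : A.IsWeighted q) : (T.tensor q A).IsWeighted q := by
  constructor <;>
    simp only [TDOps.tensor, mul_add, add_mul, ← TensorProduct.map_mul, h.K_mul_Ki, h.Ki_mul_K,
      h'.k_mul_ki, h'.ki_mul_k, h.K_mul_X, h.K_mul_Y, h'.k_mul_e0, h'.k_mul_f1,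
      h'.k_mul_e1, h'.k_mul_f0, TensorProduct.map_one, one_mul, mul_one, mul_smul_comm,
      smul_mul_assoc, TensorProduct.map_smul_left, TensorProduct.map_smul_right, smul_add,
      smul_comm (alpha q)]

end

/-! ### Highest weight decompositions and the scalars σ. -/

section highestWeight
variable {V V' W W' : Type*} [AddCommGroup V] [Module ℂ V] [AddCommGroup V'] [Module ℂ V']
  [AddCommGroup W] [Module ℂ W] [AddCommGroup W'] [Module ℂ W'] {q : ℂˣ}

/-- The eigenspace of `f` for the eigenvalue `r q^(2i-d)`. -/
noncomputable def wt (q : ℂˣ) (f : Module.End ℂ V) (r : ℂ) (d : ℕ) (i : ℤ) : Submodule ℂ V :=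
  f.eigenspace (r * (q : ℂ) ^ (2 * i - d))

/-- The eigenspace of `f` for the eigenvalue `r q^(2i-d)` if `i ≠ 0`, and the line through `u` if
`i = 0`. -/
noncomputable def wtLine (q : ℂˣ) (f : Module.End ℂ V) (r : ℂ) (d : ℕ) (u : V) (i : ℕ) :
    Submodule ℂ V :=
  if i = 0 then Submodule.span ℂ {u} else wt q f r d i

/-- The space is the sum of the eigenspaces of `f` for the `r q^(2i-d)`, `0 ≤ i ≤ d`, and the one
for `i = 0` is the line through the nonzero vector `u`. -/
structure IsHighest (q : ℂˣ) (f : Module.End ℂ V) (r : ℂ) (d : ℕ) (u : V) : Prop where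
  ne_zero : u ≠ 0
  mem : u ∈ wt q f r d 0
  iSup_eq : ⨆ i : Fin (d + 1), wtLine q f r d u i = ⊤

theorem mem_wt {f : Module.End ℂ V} {r : ℂ} {d : ℕ} {i : ℤ} {v : V} :
    v ∈ wt q f r d i ↔ f v = (r * (q : ℂ) ^ (2 * i - d)) • v := Module.End.mem_eigenspace_iff

theorem wtLine_le {f : Module.End ℂ V} {r : ℂ} {d : ℕ} {u : V} (hu : u ∈ wt q f r d 0) (i : ℕ) :
    wtLine q f r d u i ≤ wt q f r d i := by
  unfold wtLine
  split_ifs with h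
  · subst h; simpa [Submodule.span_le] using hu
  · exact le_rfl

/-- The index runs over all integers, so that vectors pushed below weight 0 or above weight d also
lie in members of the independent family. -/
theorem wt_iSupIndep (hq : ∀ n : ℕ, 0 < n → q ^ n ≠ 1) (f : Module.End ℂ V) {r : ℂ} (hr : r ≠ 0)
    (d : ℕ) : iSupIndep (wt q f r d) := by
  refine (Module.End.eigenspaces_iSupIndep f).comp (f := fun i : ℤ => r * (q : ℂ) ^ (2 * i - d)) ?_
  intro i j h
  have := zpow_injective_of_pow_ne_one hq (mul_left_cancel₀ hr h)
  omega

theorem IsHighest.wtLine_eq (hq : ∀ n : ℕ, 0 < n → q ^ n ≠ 1) {f : Module.End ℂ V} {r : ℂ}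
    (hr : r ≠ 0) {d : ℕ} {u : V} (h : IsHighest q f r d u) (i : Fin (d + 1)) :
    wtLine q f r d u i = wt q f r d i :=
  eq_of_le_of_iSup_eq_top
    ((wt_iSupIndep hq f hr d).comp (f := fun i : Fin (d + 1) => (i : ℤ))
      fun i j h => Fin.ext (by simpa using h))
    (fun i => wtLine_le h.mem i) h.iSup_eq i

theorem IsHighest.wt_zero (hq : ∀ n : ℕ, 0 < n → q ^ n ≠ 1) {f : Module.End ℂ V} {r : ℂ}
    (hr : r ≠ 0) {d : ℕ} {u : V} (h : IsHighest q f r d u) :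
    wt q f r d 0 = Submodule.span ℂ {u} := by
  simpa [wtLine] using (h.wtLine_eq hq hr 0).symm

theorem IsHighest.iSup_wt {f : Module.End ℂ V} {r : ℂ} {d : ℕ} {u : V}
    (h : IsHighest q f r d u) : ⨆ i : Fin (d + 1), wt q f r d (i : ℕ) = ⊤ :=
  top_le_iff.1 (h.iSup_eq.symm.le.trans (iSup_mono fun i => wtLine_le h.mem i))

/-- The spaces with index 0, …, d already span, and any further one is independent of them. This
supplies all the vanishing used later: x^(d+1) u = 0 and y^(n+1) x^n u = 0. -/
theorem IsHighest.wt_eq_bot (hq : ∀ n : ℕ, 0 < n → q ^ n ≠ 1) {f : Module.End ℂ V} {r : ℂ}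
    (hr : r ≠ 0) {d : ℕ} {u : V} (h : IsHighest q f r d u) {i : ℤ} (hi : i < 0 ∨ (d : ℤ) < i) :
    wt q f r d i = ⊥ := by
  refine disjoint_self.1 ((wt_iSupIndep hq f hr d i).mono_right ?_)
  rw [show (⨆ (j) (_ : j ≠ i), wt q f r d j) = ⊤ from ?_]
  · exact le_top
  · rw [eq_top_iff, ← h.iSup_wt, iSup_le_iff]
    intro j
    have := j.isLt
    exact le_iSup₂_of_le (f := fun (j : ℤ) (_ : j ≠ i) => wt q f r d j) (j : ℕ) (by omega) le_rfl

theorem wt_tmul {f : Module.End ℂ V} {g : Module.End ℂ W} {r r' : ℂ} {d d' : ℕ} {i j : ℤ} {v : V}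
    {w : W} (hv : v ∈ wt q f r d i) (hw : w ∈ wt q g r' d' j) :
    v ⊗ₜ w ∈ wt q (TensorProduct.map f g) (r * r') (d + d') (i + j) := by
  rw [mem_wt] at *
  rw [TensorProduct.map_tmul, hv, hw, TensorProduct.smul_tmul_smul,
    show 2 * (i + j) - ((d + d' : ℕ) : ℤ) = (2 * i - d) + (2 * j - d') by push_cast; ring,
    zpow_add₀ q.ne_zero]
  congr 1; ring

/-- Products of weight vectors span the tensor product and indices add, so the index 0 is reached
only as 0 + 0, where line times line is a line. -/
theorem IsHighest.tensor {f : Module.End ℂ V} {g : Module.End ℂ W} {r r' : ℂ} {d d' : ℕ} {u : V}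
    {u' : W} (h : IsHighest q f r d u) (h' : IsHighest q g r' d' u') :
    IsHighest q (TensorProduct.map f g) (r * r') (d + d') (u ⊗ₜ u') := by
  refine ⟨?_, by simpa using wt_tmul h.mem h'.mem, ?_⟩
  · intro h0
    -- Functionals not vanishing on u and u' give a functional φ ⊗ ψ not vanishing on u ⊗ u'.
    obtain ⟨φ, hφ⟩ := not_forall.1 (mt (Module.forall_dual_apply_eq_zero_iff ℂ u).1 h.ne_zero)
    obtain ⟨ψ, hψ⟩ := not_forall.1 (mt (Module.forall_dual_apply_eq_zero_iff ℂ u').1 h'.ne_zero)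
    have := congrArg (TensorProduct.lid ℂ ℂ) (congrArg (TensorProduct.map φ ψ) h0)
    simp [hφ, hψ] at this
  · rw [eq_top_iff, ← TensorProduct.map₂_mk_top_top_eq_top, ← h.iSup_eq, ← h'.iSup_eq,
      Submodule.map₂_iSup_left, iSup_le_iff]
    intro i
    rw [Submodule.map₂_iSup_right, iSup_le_iff]
    intro j
    have hi := i.isLt
    have hj := j.isLt
    refine le_iSup_of_le (⟨i + j, by omega⟩ : Fin (d + d' + 1)) (Submodule.map₂_le.2 ?_)
    intro v hv w hw
    by_cases h0 : (i : ℕ) + j = 0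
    · have hi0 : (i : ℕ) = 0 := by omega
      have hj0 : (j : ℕ) = 0 := by omega
      simp only [wtLine, hi0, hj0, if_true, Submodule.mem_span_singleton] at hv hw ⊢
      obtain ⟨a, rfl⟩ := hv
      obtain ⟨b, rfl⟩ := hw
      exact ⟨a * b, by rw [TensorProduct.mk_apply, TensorProduct.smul_tmul_smul]⟩
    · rw [wtLine, if_neg h0]
      simpa using wt_tmul (wtLine_le h.mem _ hv) (wtLine_le h'.mem _ hw)

theorem IsHighest.map {f : Module.End ℂ V} {g : Module.End ℂ W} {r : ℂ} {d : ℕ} {u : V}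
    (h : IsHighest q f r d u) (e : V ≃ₗ[ℂ] W) (he : ∀ v, e (f v) = g (e v)) :
    IsHighest q g r d (e u) := by
  have hw : ∀ i v, v ∈ wt q f r d i → e v ∈ wt q g r d i := by
    intro i v hv
    rw [mem_wt] at *
    rw [← he, hv, map_smul]
  refine ⟨by simpa using h.ne_zero, hw _ _ h.mem, ?_⟩
  rw [eq_top_iff, ← e.range, LinearMap.range_eq_map, ← h.iSup_eq, Submodule.map_iSup]
  refine iSup_mono fun i => ?_
  rw [Submodule.map_le_iff_le_comap]
  intro v hv
  unfold wtLine at *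
  split_ifs at * with h0
  · obtain ⟨a, rfl⟩ := Submodule.mem_span_singleton.1 hv
    exact Submodule.mem_span_singleton.2 ⟨a, by simp⟩
  · exact hw _ _ hv

theorem TDOps.IsWeighted.X_mem {T : TDOps V} (h : T.IsWeighted q) {r : ℂ} {d : ℕ} {i : ℤ} {v : V}
    (hv : v ∈ wt q T.K r d i) : T.X v ∈ wt q T.K r d (i + 1) := by
  rw [mem_wt] at *
  rw [← Module.End.mul_apply, h.K_mul_X, LinearMap.smul_apply, Module.End.mul_apply, hv, map_smul,
    smul_smul, show 2 * (i + 1) - (d : ℤ) = (2 * i - d) + 2 by ring, zpow_add₀ q.ne_zero]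
  congr 1
  rw [zpow_ofNat]; ring

theorem TDOps.IsWeighted.Y_mem {T : TDOps V} (h : T.IsWeighted q) {r : ℂ} {d : ℕ} {i : ℤ} {v : V}
    (hv : v ∈ wt q T.K r d i) : T.Y v ∈ wt q T.K r d (i - 1) := by
  rw [mem_wt] at *
  rw [← Module.End.mul_apply, h.K_mul_Y, LinearMap.smul_apply, Module.End.mul_apply, hv, map_smul,
    smul_smul, show 2 * (i - 1) - (d : ℤ) = (2 * i - d) + -2 by ring, zpow_add₀ q.ne_zero, zpow_neg,
    inv_pow]
  congr 1
  rw [zpow_ofNat]; ring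

theorem TDOps.IsWeighted.X_pow_mem {T : TDOps V} (h : T.IsWeighted q) {r : ℂ} {d : ℕ} {i : ℤ}
    {v : V} (hv : v ∈ wt q T.K r d i) (n : ℕ) : (T.X ^ n) v ∈ wt q T.K r d (i + n) := by
  induction n with
  | zero => simpa using hv
  | succ n ih =>
    rw [pow_succ', Module.End.mul_apply, Nat.cast_succ, ← add_assoc]
    exact h.X_mem ih

theorem TDOps.IsWeighted.Y_pow_mem {T : TDOps V} (h : T.IsWeighted q) {r : ℂ} {d : ℕ} {i : ℤ}
    {v : V} (hv : v ∈ wt q T.K r d i) (n : ℕ) : (T.Y ^ n) v ∈ wt q T.K r d (i - n) := by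
  induction n with
  | zero => simpa using hv
  | succ n ih =>
    rw [pow_succ', Module.End.mul_apply, Nat.cast_succ, ← sub_sub]
    exact h.Y_mem ih

theorem TDOps.IsWeighted.Ki_apply {T : TDOps V} (h : T.IsWeighted q) {m : ℂ} (hm : m ≠ 0) {v : V}
    (hv : T.K v = m • v) : T.Ki v = m⁻¹ • v := by
  have : T.Ki (T.K v) = v := by rw [← Module.End.mul_apply, h.Ki_mul_K, Module.End.one_apply]
  rw [hv, map_smul] at this
  rw [← this, smul_smul, inv_mul_cancel₀ hm, one_smul, this]

/-- `σ i` is the eigenvalue of `y^i x^i` on `u`. -/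
def TDOps.IsSigma (T : TDOps V) (u : V) (σ : ℕ → ℂ) : Prop :=
  ∀ i, (T.Y ^ i) ((T.X ^ i) u) = σ i • u

/-- The operator y^i x^i raises the weight index by i and lowers it by i, so it preserves the
highest weight line. -/
theorem exists_isSigma (hq : ∀ n : ℕ, 0 < n → q ^ n ≠ 1) {T : TDOps V} (hT : T.IsWeighted q)
    {r : ℂ} (hr : r ≠ 0) {d : ℕ} {u : V} (h : IsHighest q T.K r d u) : ∃ σ, T.IsSigma u σ := by
  have : ∀ i, ∃ c : ℂ, (T.Y ^ i) ((T.X ^ i) u) = c • u := by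
    intro i
    have := hT.Y_pow_mem (hT.X_pow_mem h.mem i) i
    rw [add_sub_cancel_right, h.wt_zero hq hr, Submodule.mem_span_singleton] at this
    obtain ⟨c, hc⟩ := this
    exact ⟨c, hc.symm⟩
  choose σ hσ using this
  exact ⟨σ, hσ⟩

/-- The scalars pass along any intertwiner, injective or not; when `f u` is nonzero they are also
determined by the image. The fusion map is used in this way. -/
theorem TDOps.Intertwines.isSigma {T : TDOps V} {T' : TDOps V'} {f : V →ₗ[ℂ] V'}
    (h : T.Intertwines T' f) {u : V} {σ : ℕ → ℂ} (hσ : T.IsSigma u σ) : T'.IsSigma (f u) σ := by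
  have hX : ∀ n v, f ((T.X ^ n) v) = (T'.X ^ n) (f v) := by
    intro n
    induction n with
    | zero => simp
    | succ n ih => intro v; simp only [pow_succ, Module.End.mul_apply, ih, h.X]
  have hY : ∀ n v, f ((T.Y ^ n) v) = (T'.Y ^ n) (f v) := by
    intro n
    induction n with
    | zero => simp
    | succ n ih => intro v; simp only [pow_succ, Module.End.mul_apply, ih, h.Y]
  intro i
  rw [← hX, ← hY, hσ, map_smul]

theorem TDOps.IsSigma.unique {T : TDOps V} {u : V} (hu : u ≠ 0) {σ σ' : ℕ → ℂ}
    (h : T.IsSigma u σ) (h' : T.IsSigma u σ') : σ = σ' :=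
  funext fun i => smul_left_injective ℂ hu ((h i).symm.trans (h' i))

end highestWeight

/-! ### How the polynomial grows by a linear factor. -/

section drinfeldPolyOf
open Polynomial

/-- The Drinfeld polynomial of type `r` and diameter `d` with the given eigenvalues `σ`. -/
noncomputable def drinfeldPolyOf (q : ℂˣ) (κ : Kind) (r : ℂˣ) (d : ℕ) (σ : ℕ → ℂ) : ℂ[X] :=
  C ((-1) ^ d * ∏ j ∈ Finset.Icc 1 d, ((q : ℂ) ^ j - (q : ℂ)⁻¹ ^ j) ^ 2)⁻¹ *
    ∑ i ∈ Finset.range (d + 1), C (σ i) *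
      ∏ j ∈ Finset.Icc (i + 1) d, (C (((q : ℂ) ^ j - (q : ℂ)⁻¹ ^ j) ^ 2) *
        (C (κ.eps * (r : ℂ)⁻¹ ^ 2 * (q : ℂ) ^ (2 * (d - j)) +
          κ.epsStar * (r : ℂ) ^ 2 * (q : ℂ)⁻¹ ^ (2 * (d - j))) - X))

theorem pow_sub_inv_pow_ne_zero {q : ℂˣ} (hq : ∀ n : ℕ, 0 < n → q ^ n ≠ 1) {j : ℕ} (hj : 0 < j) :
    (q : ℂ) ^ j - (q : ℂ)⁻¹ ^ j ≠ 0 := by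
  intro h
  have h1 : (q : ℂ) ^ (j : ℤ) = (q : ℂ) ^ (-(j : ℤ)) := by
    rw [zpow_neg, zpow_natCast, ← inv_pow]; exact sub_eq_zero.1 h
  have := zpow_injective_of_pow_ne_one hq h1
  omega

/-- Write P_i for the product from i + 1 to d + 1, so that P_i = b_(i+1) (F(d-i) - X) P_(i+1).
Inserting the recursion for σ', the coefficient of σ_i b_(i+1) P_(i+1) becomes (F(d-i) - X) -
(F(d-i) + c) = -(X + c), independent of i. What remains is the sum for diameter d times b_(d+1), and
the normalising constant absorbs -b_(d+1). -/
theorem sum_prod_Icc_succ (b F : ℕ → ℂ) (d : ℕ) {σ σ' : ℕ → ℂ} {c : ℂ} (hb : b (d + 1) ≠ 0)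
    (h0 : σ' 0 = σ 0) (hd : σ (d + 1) = 0)
    (h : ∀ n ≤ d, σ' (n + 1) = σ (n + 1) - b (n + 1) * (F (d - n) + c) * σ n) :
    C ((-1) ^ (d + 1) * ∏ j ∈ Finset.Icc 1 (d + 1), b j)⁻¹ *
      ∑ i ∈ Finset.range (d + 1 + 1), C (σ' i) *
        ∏ j ∈ Finset.Icc (i + 1) (d + 1), (C (b j) * (C (F (d + 1 - j)) - X)) =
    (C ((-1) ^ d * ∏ j ∈ Finset.Icc 1 d, b j)⁻¹ *
      ∑ i ∈ Finset.range (d + 1), C (σ i) *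
        ∏ j ∈ Finset.Icc (i + 1) d, (C (b j) * (C (F (d - j)) - X))) * (X + C c) := by
  obtain ⟨P, hP⟩ : ∃ P : ℕ → ℂ[X], ∀ i, P i =
      ∏ j ∈ Finset.Icc (i + 1) (d + 1), (C (b j) * (C (F (d + 1 - j)) - X)) := ⟨_, fun _ => rfl⟩
  simp only [← hP]
  have hI : ∀ i, Finset.Ioc (i + 1) (d + 1) = Finset.Icc (i + 1 + 1) (d + 1) := fun i => by
    ext j; simp only [Finset.mem_Ioc, Finset.mem_Icc]; omega
  have hPs : ∀ i ≤ d, P i = C (b (i + 1)) * (C (F (d - i)) - X) * P (i + 1) := by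
    intro i hi
    rw [hP, hP, ← Finset.mul_prod_Ioc_eq_prod_Icc (by omega : i + 1 ≤ d + 1), Nat.add_sub_add_right, hI]
  -- The argument F(d+1-j) depends on d+1-j alone, so shifting j by one turns these factors into
  -- those for diameter d. The factors b_j do not shift: b_(i+1) completes the product at the bottom
  -- and b_(d+1) splits off at the top.
  have hR : ∀ i ≤ d, C (b (i + 1)) * P (i + 1) = C (b (d + 1)) *
      ∏ j ∈ Finset.Icc (i + 1) d, (C (b j) * (C (F (d - j)) - X)) := by
    intro i hi
    simp only [hP]
    have e1 : ∏ j ∈ Finset.Icc (i + 1 + 1) (d + 1), (C (F (d + 1 - j)) - X) =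
        ∏ j ∈ Finset.Icc (i + 1) d, (C (F (d - j)) - X) := by
      rw [← Finset.map_add_right_Icc, Finset.prod_map]
      simp
    have e2 : C (b (i + 1)) * ∏ j ∈ Finset.Icc (i + 1 + 1) (d + 1), C (b j) =
        C (b (d + 1)) * ∏ j ∈ Finset.Icc (i + 1) d, C (b j) := by
      have := Finset.mul_prod_Ioc_eq_prod_Icc (f := fun j => C (b j)) (by omega : i + 1 ≤ d + 1)
      rw [Finset.prod_Icc_succ_top (by omega : i + 1 ≤ d + 1)] at this
      rw [mul_comm (C (b (d + 1))), ← this, hI]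
    rw [Finset.prod_mul_distrib, Finset.prod_mul_distrib, e1, ← mul_assoc, e2, mul_assoc]
  have hsum : ∑ i ∈ Finset.range (d + 2), C (σ' i) * P i =
      ∑ i ∈ Finset.range (d + 1), C (σ i) * (-(X + C c) * (C (b (i + 1)) * P (i + 1))) := by
    -- The top term drops because σ_(d+1) = 0; both sums then run over 0, …, d.
    have e1 : ∑ i ∈ Finset.range (d + 2), C (σ i) * P i =
        ∑ i ∈ Finset.range (d + 1), C (σ i) * P i := by
      rw [Finset.sum_range_succ, hd, C_0, zero_mul, add_zero]
    have e2 : ∑ i ∈ Finset.range (d + 2), C (σ' i) * P i =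
        ∑ i ∈ Finset.range (d + 2), C (σ i) * P i - ∑ i ∈ Finset.range (d + 1),
          C (b (i + 1) * (F (d - i) + c) * σ i) * P (i + 1) := by
      rw [Finset.sum_range_succ', Finset.sum_range_succ' _ (d + 1), h0, add_sub_right_comm,
        ← Finset.sum_sub_distrib]
      congr 1
      refine Finset.sum_congr rfl fun i hi => ?_
      rw [h i (by simpa [Nat.lt_succ_iff] using hi), C_sub, sub_mul]
    rw [e2, e1, ← Finset.sum_sub_distrib]
    refine Finset.sum_congr rfl fun i hi => ?_
    rw [hPs i (by simpa [Nat.lt_succ_iff] using hi)]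
    simp only [C_mul, C_add]
    ring
  rw [hsum, Finset.prod_Icc_succ_top (by omega : 1 ≤ d + 1)]
  -- Raising the diameter multiplies the constant Q by -b_(d+1).
  have hQ : C ((-1) ^ (d + 1) * ((∏ j ∈ Finset.Icc 1 d, b j) * b (d + 1)))⁻¹ * C (b (d + 1)) =
      - C ((-1) ^ d * ∏ j ∈ Finset.Icc 1 d, b j)⁻¹ := by
    rw [← C_mul, ← C_neg, pow_succ, ← mul_assoc, mul_inv, mul_assoc, inv_mul_cancel₀ hb, mul_one,
      mul_neg_one, neg_mul, inv_neg]
  have e3 : ∑ i ∈ Finset.range (d + 1), C (σ i) * (-(X + C c) * (C (b (i + 1)) * P (i + 1))) =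
      -(C (b (d + 1)) * (∑ i ∈ Finset.range (d + 1), C (σ i) *
      ∏ j ∈ Finset.Icc (i + 1) d, (C (b j) * (C (F (d - j)) - X))) * (X + C c)) := by
    rw [Finset.mul_sum, Finset.sum_mul, ← Finset.sum_neg_distrib]
    refine Finset.sum_congr rfl fun i hi => ?_
    rw [hR i (by simpa [Nat.lt_succ_iff] using hi)]
    ring
  rw [e3, mul_neg, ← mul_assoc, ← mul_assoc, hQ]
  ring

theorem drinfeldPolyOf_succ {q : ℂˣ} (hq : ∀ n : ℕ, 0 < n → q ^ n ≠ 1) (κ : Kind) (r : ℂˣ) (d : ℕ)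
    {σ σ' : ℕ → ℂ} {c : ℂ} (h0 : σ' 0 = σ 0) (hd : σ (d + 1) = 0)
    (h : ∀ n ≤ d, σ' (n + 1) = σ (n + 1) - ((q : ℂ) ^ (n + 1) - (q : ℂ)⁻¹ ^ (n + 1)) ^ 2 *
      (κ.eps * (r : ℂ)⁻¹ ^ 2 * (q : ℂ) ^ (2 * (d - n)) +
        κ.epsStar * (r : ℂ) ^ 2 * (q : ℂ)⁻¹ ^ (2 * (d - n)) + c) * σ n) :
    drinfeldPolyOf q κ r (d + 1) σ' = drinfeldPolyOf q κ r d σ * (X + C c) := by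
  exact sum_prod_Icc_succ (fun j => ((q : ℂ) ^ j - (q : ℂ)⁻¹ ^ j) ^ 2)
    (fun n => κ.eps * (r : ℂ)⁻¹ ^ 2 * (q : ℂ) ^ (2 * n) +
      κ.epsStar * (r : ℂ) ^ 2 * (q : ℂ)⁻¹ ^ (2 * n)) d
    (pow_ne_zero 2 (pow_sub_inv_pow_ne_zero hq (Nat.succ_pos d))) h0 hd h

theorem drinfeldPolyOf_zero (q : ℂˣ) (κ : Kind) (r : ℂˣ) (σ : ℕ → ℂ) :
    drinfeldPolyOf q κ r 0 σ = C (σ 0) := by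
  simp [drinfeldPolyOf]

/-- The polynomial `∏_{c ∈ S(ℓ, a)} (X + c + ε ε* c⁻¹)`. -/
noncomputable def stringPoly (q : ℂˣ) (κ : Kind) (ℓ : ℕ) (a : ℂ) : ℂ[X] :=
  ((qString q ℓ a).map fun c => X + C (c + κ.eps * κ.epsStar * c⁻¹)).prod

theorem stringPoly_zero (q : ℂˣ) (κ : Kind) (a : ℂ) : stringPoly q κ 0 a = 1 := by
  simp [stringPoly, qString]

/-- The first element of S(ℓ+1, a) is aq^(-ℓ), and the others form S(ℓ, aq). These are the
parameters of the two factors of the fusion map. -/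
theorem stringPoly_succ (q : ℂˣ) (κ : Kind) (ℓ : ℕ) (a : ℂ) :
    stringPoly q κ (ℓ + 1) a =
      (X + C (a * (q : ℂ) ^ (-(ℓ : ℤ)) + κ.eps * κ.epsStar * (a * (q : ℂ) ^ (-(ℓ : ℤ)))⁻¹)) *
        stringPoly q κ ℓ (a * q) := by
  have e : ∀ ℓ a, stringPoly q κ ℓ a = ∏ i ∈ Finset.range ℓ,
      (X + C (a * (q : ℂ) ^ (2 * (i : ℤ) - ℓ + 1) +
        κ.eps * κ.epsStar * (a * (q : ℂ) ^ (2 * (i : ℤ) - ℓ + 1))⁻¹)) := by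
    intro ℓ a
    simp only [stringPoly, qString, Multiset.map_map, Multiset.bind_def, Multiset.pure_def,
      Multiset.bind_singleton]
    rfl
  rw [e, e, Finset.prod_range_succ', mul_comm]
  have h1 : 2 * ((0 : ℕ) : ℤ) - ((ℓ + 1 : ℕ) : ℤ) + 1 = -ℓ := by push_cast; ring
  have h2 : ∀ i : ℕ, a * (q : ℂ) ^ (2 * ((i + 1 : ℕ) : ℤ) - ((ℓ + 1 : ℕ) : ℤ) + 1) =
      a * q * (q : ℂ) ^ (2 * (i : ℤ) - ℓ + 1) := by
    intro i
    rw [show 2 * ((i + 1 : ℕ) : ℤ) - ((ℓ + 1 : ℕ) : ℤ) + 1 = 1 + (2 * (i : ℤ) - ℓ + 1) by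
      push_cast; ring, zpow_add₀ q.ne_zero, zpow_one, mul_assoc]
  simp only [h1, h2]

end drinfeldPolyOf

/-! ### Tensoring with a two-dimensional evaluation module. -/

section eval
variable {q : ℂˣ} {κ : Kind}

theorem sub_inv_ne_zero (hq : ∀ n : ℕ, 0 < n → q ^ n ≠ 1) : (q : ℂ) - (q : ℂ)⁻¹ ≠ 0 := by
  simpa using pow_sub_inv_pow_ne_zero hq one_pos

theorem qInt_one (hq : ∀ n : ℕ, 0 < n → q ^ n ≠ 1) : qInt q 1 = 1 := by
  simp [qInt, sub_inv_ne_zero hq]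

theorem qInt_succ (hq : ∀ n : ℕ, 0 < n → q ^ n ≠ 1) (j : ℤ) :
    qInt q (j + 1) = (q : ℂ) ^ j + (q : ℂ)⁻¹ * qInt q j := by
  have h := sub_inv_ne_zero hq
  have hq0 := q.ne_zero
  rw [qInt, qInt, div_eq_iff h, add_mul, mul_assoc, div_mul_cancel₀ _ h, neg_add, zpow_add₀ hq0,
    zpow_add₀ hq0, zpow_neg_one, zpow_one]
  ring

/-- The mirror image of `qInt_succ` under q ↦ q⁻¹. The two recursions sum the geometric series in q²
and in q⁻² met below. -/
theorem qInt_succ' (hq : ∀ n : ℕ, 0 < n → q ^ n ≠ 1) (j : ℤ) :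
    qInt q (j + 1) = (q : ℂ) ^ (-j) + q * qInt q j := by
  have h := sub_inv_ne_zero hq
  have hq0 := q.ne_zero
  have e : (q : ℂ) * (((q : ℂ) ^ j - (q : ℂ) ^ (-j)) / ((q : ℂ) - (q : ℂ)⁻¹)) *
      ((q : ℂ) - (q : ℂ)⁻¹) = q * ((q : ℂ) ^ j - (q : ℂ) ^ (-j)) := by
    rw [mul_assoc, div_mul_cancel₀ _ h]
  rw [qInt, qInt, div_eq_iff h, add_mul, e, neg_add, zpow_add₀ hq0,
    zpow_add₀ hq0, zpow_neg_one, zpow_one]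
  ring

/-- The operators act on the standard basis as on the evaluation module `V(ℓ, a)`. -/
structure LoopOps.IsEval {ℓ : ℕ} (A : LoopOps (Fin (ℓ + 1) → ℂ)) (q : ℂˣ) (κ : Kind) (a : ℂ) :
    Prop where
  k : ∀ j : ℤ, A.k (stdVec ℓ j) = (q : ℂ) ^ (2 * j - ℓ) • stdVec ℓ j
  ki : ∀ j : ℤ, A.ki (stdVec ℓ j) = (q : ℂ) ^ (ℓ - 2 * j) • stdVec ℓ j
  e0 : ∀ j : ℤ, A.e0 (stdVec ℓ j) = (a * q * qInt q (j + 1)) • stdVec ℓ (j + 1)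
  f1 : ∀ j : ℤ, A.f1 (stdVec ℓ j) =
    (κ.eps * ((q : ℂ) ^ (ℓ - 2 * j) * qInt q (j + 1))) • stdVec ℓ (j + 1)
  e1 : ∀ j : ℤ, A.e1 (stdVec ℓ j) = qInt q (ℓ - j + 1) • stdVec ℓ (j - 1)
  f0 : ∀ j : ℤ, A.f0 (stdVec ℓ j) = (κ.epsStar * ((q : ℂ) ^ (2 * j - ℓ) *
    (a⁻¹ * (q : ℂ)⁻¹ * qInt q (ℓ - j + 1)))) • stdVec ℓ (j - 1)

theorem LoopOps.IsEval.isHighest {ℓ : ℕ} {A : LoopOps (Fin (ℓ + 1) → ℂ)} {a : ℂ}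
    (h : A.IsEval q κ a) : IsHighest q A.k 1 ℓ (stdVec ℓ 0) := by
  have hmem : ∀ j : ℤ, stdVec ℓ j ∈ wt q A.k 1 ℓ j := fun j => by
    rw [mem_wt, h.k, one_mul]
  refine ⟨fun h0 => ?_, hmem 0, ?_⟩
  · simpa [stdVec] using congrFun h0 0
  · rw [eq_top_iff, ← (Pi.basisFun ℂ (Fin (ℓ + 1))).span_eq, Submodule.span_le]
    rintro _ ⟨i, rfl⟩
    rw [← stdVec_coe]
    refine Submodule.mem_iSup_of_mem i ?_
    unfold wtLine
    split_ifs with h0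
    · rw [h0]; exact Submodule.mem_span_singleton_self _
    · exact hmem _

section one
variable {V : Type*} [AddCommGroup V] [Module ℂ V] {T : TDOps V}
  {A : LoopOps (Fin (1 + 1) → ℂ)} {a : ℂ}

theorem TDOps.IsWeighted.K_X_pow (hT : T.IsWeighted q) {m : ℂ} {w : V} (hw : T.K w = m • w)
    (n : ℕ) : T.K ((T.X ^ n) w) = (m * (q : ℂ) ^ (2 * (n : ℤ))) • (T.X ^ n) w := by
  -- Any eigenvector is a weight vector of index 0 for the type m and the diameter 0.
  have := hT.X_pow_mem (r := m) (d := 0) (i := 0) (v := w) (by rw [mem_wt]; simpa using hw) n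
  rw [mem_wt] at this
  simpa using this

theorem TDOps.IsWeighted.K_Y_pow (hT : T.IsWeighted q) {m : ℂ} {w : V} (hw : T.K w = m • w)
    (n : ℕ) : T.K ((T.Y ^ n) w) = (m * (q : ℂ) ^ (-(2 * (n : ℤ)))) • (T.Y ^ n) w := by
  have := hT.Y_pow_mem (r := m) (d := 0) (i := 0) (v := w) (by rw [mem_wt]; simpa using hw) n
  rw [mem_wt] at this
  simpa using this

/-- Since v₂ = 0, at most one of the n + 1 factors can move v₀ to v₁. Doing so at height i
contributes αq(a m q^(2i) + ε m⁻¹ q^(-2i)), and summing over 0 ≤ i ≤ n yields [n+1] times q^n and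
q^(-n). -/
theorem tensor_X_pow (hq : ∀ n : ℕ, 0 < n → q ^ n ≠ 1) (hT : T.IsWeighted q)
    (hA : A.IsEval q κ a) {m : ℂ} (hm : m ≠ 0) {w : V} (hw : T.K w = m • w) (n : ℕ) :
    ((T.tensor q A).X ^ (n + 1)) (w ⊗ₜ stdVec 1 0) = (T.X ^ (n + 1)) w ⊗ₜ[ℂ] stdVec 1 0 +
      (alpha q * q * qInt q (n + 1) * (a * m * (q : ℂ) ^ (n : ℤ) +
        κ.eps * m⁻¹ * (q : ℂ) ^ (-(n : ℤ)))) • ((T.X ^ n) w ⊗ₜ[ℂ] stdVec 1 1) := by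
  have hq0 := q.ne_zero
  have q1 := qInt_one hq
  have v2 : stdVec 1 2 = 0 := stdVec_eq_zero (by norm_num)
  have h1 : ∀ v, (T.tensor q A).X (v ⊗ₜ stdVec 1 1) = T.X v ⊗ₜ stdVec 1 1 := by
    intro v
    simp [TDOps.tensor, hA.e0, hA.f1, v2]
  have h0 : ∀ n : ℕ, (T.tensor q A).X ((T.X ^ n) w ⊗ₜ stdVec 1 0) =
      (T.X ^ (n + 1)) w ⊗ₜ stdVec 1 0 + (alpha q * q * (a * m * (q : ℂ) ^ (2 * (n : ℤ)) +
        κ.eps * m⁻¹ * (q : ℂ) ^ (-(2 * (n : ℤ))))) • ((T.X ^ n) w ⊗ₜ stdVec 1 1) := by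
    intro n
    have e := hT.K_X_pow hw n
    have e' := hT.Ki_apply (mul_ne_zero hm (zpow_ne_zero _ hq0)) e
    simp only [TDOps.tensor, LinearMap.add_apply, LinearMap.smul_apply, TensorProduct.map_tmul,
      hA.e0, hA.f1, e, e', zero_add, q1, TensorProduct.tmul_smul, ← TensorProduct.smul_tmul',
      Module.End.one_apply, pow_succ' _ n, Module.End.mul_apply, mul_inv, zpow_neg]
    norm_num
    module
  induction n with
  | zero =>
    have := h0 0
    simp only [pow_zero, Module.End.one_apply] at this
    simpa [q1] using this
  | succ n ih =>
    rw [pow_succ', Module.End.mul_apply, ih, map_add, map_smul, h0, h1, ← Module.End.mul_apply T.X,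
      ← pow_succ' T.X, add_assoc, ← add_smul]
    congr 2
    push_cast
    have r1 := qInt_succ hq (n + 1)
    have r2 := qInt_succ' hq (n + 1)
    have z1 : (q : ℂ) ^ (2 * ((n : ℤ) + 1)) = (q : ℂ) ^ ((n : ℤ) + 1) * (q : ℂ) ^ ((n : ℤ) + 1) := by
      rw [← zpow_add₀ hq0]; ring_nf
    have z2 : (q : ℂ) ^ (-(2 * ((n : ℤ) + 1))) =
        (q : ℂ) ^ (-((n : ℤ) + 1)) * (q : ℂ) ^ (-((n : ℤ) + 1)) := by
      rw [← zpow_add₀ hq0]; ring_nf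
    have z3 : (q : ℂ) ^ (n : ℤ) = (q : ℂ) ^ ((n : ℤ) + 1) * (q : ℂ)⁻¹ := by
      rw [zpow_add_one₀ hq0]; field_simp
    have z4 : (q : ℂ) ^ (-(n : ℤ)) = (q : ℂ) ^ (-((n : ℤ) + 1)) * q := by
      rw [← zpow_add_one₀ hq0]; ring_nf
    rw [z1, z2, z3, z4]
    linear_combination (-(alpha q * q * a * m * (q : ℂ) ^ ((n : ℤ) + 1))) * r1 -
      (alpha q * q * κ.eps * m⁻¹ * (q : ℂ) ^ (-((n : ℤ) + 1))) * r2

theorem tensor_Y_zero (hA : A.IsEval q κ a) (w : V) :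
    (T.tensor q A).Y (w ⊗ₜ stdVec 1 0) = T.Y w ⊗ₜ[ℂ] stdVec 1 0 := by
  have v2 : stdVec 1 (-1) = 0 := stdVec_eq_zero (by norm_num)
  simp [TDOps.tensor, hA.e1, hA.f0, v2]

theorem tensor_Y_pow_zero (hA : A.IsEval q κ a) (w : V) (n : ℕ) :
    ((T.tensor q A).Y ^ n) (w ⊗ₜ stdVec 1 0) = (T.Y ^ n) w ⊗ₜ[ℂ] stdVec 1 0 := by
  induction n with
  | zero => rfl
  | succ n ih => rw [pow_succ', Module.End.mul_apply, ih, tensor_Y_zero hA, pow_succ',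
      Module.End.mul_apply]

/-- The counterpart of `tensor_X_pow`: v₁ drops to v₀ at most once, and once there y acts on the
left factor only. -/
theorem tensor_Y_pow (hq : ∀ n : ℕ, 0 < n → q ^ n ≠ 1) (hT : T.IsWeighted q)
    (hA : A.IsEval q κ a) {m : ℂ} (hm : m ≠ 0) {w : V} (hw : T.K w = m • w) (n : ℕ) :
    ((T.tensor q A).Y ^ (n + 1)) (w ⊗ₜ stdVec 1 1) = (T.Y ^ (n + 1)) w ⊗ₜ[ℂ] stdVec 1 1 +
      (qInt q (n + 1) * (κ.epsStar * a⁻¹ * m * (q : ℂ) ^ (-(n : ℤ)) +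
        m⁻¹ * (q : ℂ) ^ (n : ℤ))) • ((T.Y ^ n) w ⊗ₜ[ℂ] stdVec 1 0) := by
  have hq0 := q.ne_zero
  have q1 := qInt_one hq
  have h1 : ∀ n : ℕ, (T.tensor q A).Y ((T.Y ^ n) w ⊗ₜ stdVec 1 1) =
      (T.Y ^ (n + 1)) w ⊗ₜ stdVec 1 1 + (κ.epsStar * a⁻¹ * m * (q : ℂ) ^ (-(2 * (n : ℤ))) +
        m⁻¹ * (q : ℂ) ^ (2 * (n : ℤ))) • ((T.Y ^ n) w ⊗ₜ stdVec 1 0) := by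
    intro n
    have e := hT.K_Y_pow hw n
    have e' := hT.Ki_apply (mul_ne_zero hm (zpow_ne_zero _ hq0)) e
    -- On v₁ the factor q from k₀ cancels the q⁻¹ in the formula for e⁻₀, which leaves ε*a⁻¹.
    have e3 : (q : ℂ) * (q : ℂ)⁻¹ = 1 := mul_inv_cancel₀ hq0
    simp only [TDOps.tensor, LinearMap.add_apply, TensorProduct.map_tmul,
      hA.e1, hA.f0, e, e', TensorProduct.tmul_smul, ← TensorProduct.smul_tmul',
      Module.End.one_apply, pow_succ' _ n, Module.End.mul_apply, mul_inv, zpow_neg, inv_inv]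
    norm_num [q1]
    match_scalars
    linear_combination (κ.epsStar * a⁻¹ * m * ((q : ℂ) ^ (2 * (n : ℤ)))⁻¹) * e3
  induction n with
  | zero =>
    have := h1 0
    simp only [pow_zero, Module.End.one_apply] at this
    simpa [q1] using this
  | succ n ih =>
    rw [pow_succ', Module.End.mul_apply, ih, map_add, map_smul, h1, tensor_Y_zero hA,
      ← Module.End.mul_apply T.Y, ← pow_succ' T.Y, add_assoc, ← add_smul]
    congr 2
    push_cast
    have r1 := qInt_succ hq (n + 1)
    have r2 := qInt_succ' hq (n + 1)
    have z1 : (q : ℂ) ^ (2 * ((n : ℤ) + 1)) = (q : ℂ) ^ ((n : ℤ) + 1) * (q : ℂ) ^ ((n : ℤ) + 1) := by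
      rw [← zpow_add₀ hq0]; ring_nf
    have z2 : (q : ℂ) ^ (-(2 * ((n : ℤ) + 1))) =
        (q : ℂ) ^ (-((n : ℤ) + 1)) * (q : ℂ) ^ (-((n : ℤ) + 1)) := by
      rw [← zpow_add₀ hq0]; ring_nf
    have z3 : (q : ℂ) ^ (n : ℤ) = (q : ℂ) ^ ((n : ℤ) + 1) * (q : ℂ)⁻¹ := by
      rw [zpow_add_one₀ hq0]; field_simp
    have z4 : (q : ℂ) ^ (-(n : ℤ)) = (q : ℂ) ^ (-((n : ℤ) + 1)) * q := by
      rw [← zpow_add_one₀ hq0]; ring_nf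
    rw [z1, z2, z3, z4]
    linear_combination (-(m⁻¹ * (q : ℂ) ^ ((n : ℤ) + 1))) * r1 -
      (κ.epsStar * a⁻¹ * m * (q : ℂ) ^ (-((n : ℤ) + 1))) * r2

/-- Expanding x^(n+1) gives x^(n+1)u ⊗ v₀ and a multiple of x^n u ⊗ v₁. Under y^(n+1) the first
yields σ_(n+1), the second σ_n times the product of the two coefficients; its remaining term
contains y^(n+1) x^n u, of weight index -1, and vanishes. -/
theorem tensor_sigma (hq : ∀ n : ℕ, 0 < n → q ^ n ≠ 1) (ha : κ = .second ∨ a ≠ 0)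
    (hT : T.IsWeighted q) (hA : A.IsEval q κ a) {r : ℂˣ} {d : ℕ} {u : V}
    (h : IsHighest q T.K r d u) {σ : ℕ → ℂ} (hσ : T.IsSigma u σ) {n : ℕ} (hn : n ≤ d) :
    ((T.tensor q A).Y ^ (n + 1)) (((T.tensor q A).X ^ (n + 1)) (u ⊗ₜ stdVec 1 0)) =
    (σ (n + 1) - ((q : ℂ) ^ (n + 1) - (q : ℂ)⁻¹ ^ (n + 1)) ^ 2 *
      (κ.eps * (r : ℂ)⁻¹ ^ 2 * (q : ℂ) ^ (2 * (d - n)) +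
        κ.epsStar * (r : ℂ) ^ 2 * (q : ℂ)⁻¹ ^ (2 * (d - n)) +
          (a + κ.eps * κ.epsStar * a⁻¹)) * σ n) • (u ⊗ₜ stdVec 1 0) := by
  have hq0 := q.ne_zero
  have hr := r.ne_zero
  have hu : T.K u = ((r : ℂ) * (q : ℂ) ^ (-(d : ℤ))) • u := by simpa using mem_wt.1 h.mem
  have hm : (r : ℂ) * (q : ℂ) ^ (-(d : ℤ)) ≠ 0 := mul_ne_zero hr (zpow_ne_zero _ hq0)
  have hz : (T.Y ^ (n + 1)) ((T.X ^ n) u) = 0 := by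
    have := hT.Y_pow_mem (hT.X_pow_mem h.mem n) (n + 1)
    rwa [h.wt_eq_bot hq hr (by left; push_cast; omega), Submodule.mem_bot] at this
  rw [tensor_X_pow hq hT hA hm hu, map_add, map_smul, tensor_Y_pow_zero hA,
    tensor_Y_pow hq hT hA (mul_ne_zero hm (zpow_ne_zero _ hq0)) (hT.K_X_pow hu n), hσ, hσ, hz,
    TensorProduct.zero_tmul, zero_add, ← TensorProduct.smul_tmul', ← TensorProduct.smul_tmul',
    smul_smul, smul_smul, ← add_smul]
  congr 1
  -- The constant α is such that αq[n+1]² = -(q^(n+1) - q^(-n-1))², the factor in the definition of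
  -- the polynomial.
  have hA2 : alpha q * q * qInt q (n + 1) * qInt q (n + 1) =
      -((q : ℂ) ^ (n + 1) - (q : ℂ)⁻¹ ^ (n + 1)) ^ 2 := by
    have h1 : qInt q (n + 1) * ((q : ℂ) - (q : ℂ)⁻¹) = (q : ℂ) ^ (n + 1) - (q : ℂ)⁻¹ ^ (n + 1) := by
      rw [qInt, div_mul_cancel₀ _ (sub_inv_ne_zero hq), inv_pow, zpow_neg]
      norm_cast
    rw [← h1, alpha]
    field_simp
  -- For a = 0 the convention 0⁻¹ = 0 is harmless: then ε* = 0.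
  have hae : κ.epsStar * (a * a⁻¹) = κ.epsStar := by
    rcases ha with rfl | ha
    · simp [Kind.epsStar]
    · rw [mul_inv_cancel₀ ha, mul_one]
  obtain ⟨e, rfl⟩ := Nat.exists_eq_add_of_le hn
  have z1 : (q : ℂ) ^ (-((n + e : ℕ) : ℤ)) = ((q : ℂ) ^ n)⁻¹ * ((q : ℂ) ^ e)⁻¹ := by
    rw [zpow_neg, zpow_natCast, pow_add, mul_inv]
  have z2 : (q : ℂ) ^ (2 * (n : ℤ)) = (q : ℂ) ^ n * (q : ℂ) ^ n := by
    rw [two_mul, zpow_add₀ hq0, zpow_natCast]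
  have z3 : (q : ℂ) ^ (-(n : ℤ)) = ((q : ℂ) ^ n)⁻¹ := by rw [zpow_neg, zpow_natCast]
  rw [z1, z2, z3, zpow_natCast, Nat.add_sub_cancel_left, pow_mul', pow_mul' (q : ℂ)⁻¹, inv_pow _ e]
  have hn0 : (q : ℂ) ^ n ≠ 0 := pow_ne_zero _ hq0
  have he0 : (q : ℂ) ^ e ≠ 0 := pow_ne_zero _ hq0
  -- With z = r q^(n-d) this reads (az + εz⁻¹)(ε*a⁻¹z + z⁻¹) = εz⁻² + ε*z² + a + εε*a⁻¹; here N =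
  -- q^n and M = q^(d-n).
  have main : (a * ((r : ℂ) * (((q : ℂ) ^ n)⁻¹ * ((q : ℂ) ^ e)⁻¹)) * (q : ℂ) ^ n +
        κ.eps * ((r : ℂ) * (((q : ℂ) ^ n)⁻¹ * ((q : ℂ) ^ e)⁻¹))⁻¹ * ((q : ℂ) ^ n)⁻¹) *
      (κ.epsStar * a⁻¹ * ((r : ℂ) * (((q : ℂ) ^ n)⁻¹ * ((q : ℂ) ^ e)⁻¹) *
        ((q : ℂ) ^ n * (q : ℂ) ^ n)) * ((q : ℂ) ^ n)⁻¹ +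
        ((r : ℂ) * (((q : ℂ) ^ n)⁻¹ * ((q : ℂ) ^ e)⁻¹) *
          ((q : ℂ) ^ n * (q : ℂ) ^ n))⁻¹ * (q : ℂ) ^ n) =
      κ.eps * (r : ℂ)⁻¹ ^ 2 * ((q : ℂ) ^ e) ^ 2 +
        κ.epsStar * (r : ℂ) ^ 2 * (((q : ℂ) ^ e)⁻¹) ^ 2 + (a + κ.eps * κ.epsStar * a⁻¹) := by
    generalize (q : ℂ) ^ n = N at *
    generalize (q : ℂ) ^ e = M at *
    generalize a⁻¹ = b at *
    field_simp
    linear_combination (r : ℂ) ^ 4 * hae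
  rw [← main]
  linear_combination ((a * ((r : ℂ) * (((q : ℂ) ^ n)⁻¹ * ((q : ℂ) ^ e)⁻¹)) * (q : ℂ) ^ n +
        κ.eps * ((r : ℂ) * (((q : ℂ) ^ n)⁻¹ * ((q : ℂ) ^ e)⁻¹))⁻¹ * ((q : ℂ) ^ n)⁻¹) *
      (κ.epsStar * a⁻¹ * ((r : ℂ) * (((q : ℂ) ^ n)⁻¹ * ((q : ℂ) ^ e)⁻¹) *
        ((q : ℂ) ^ n * (q : ℂ) ^ n)) * ((q : ℂ) ^ n)⁻¹ +
        ((r : ℂ) * (((q : ℂ) ^ n)⁻¹ * ((q : ℂ) ^ e)⁻¹) *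
          ((q : ℂ) ^ n * (q : ℂ) ^ n))⁻¹ * (q : ℂ) ^ n) * σ n) * hA2

end one
end eval

/-! ### From representations to operators. -/

section rep
open LoopAlg
variable {q : ℂˣ} {κ : Kind} {V W W' : Type*} [AddCommGroup V] [Module ℂ V]
  [AddCommGroup W] [Module ℂ W] [AddCommGroup W'] [Module ℂ W']

/-- The operators of an `𝓛_κ`-module. -/
noncomputable def repOps (ρ : subLoop q κ →ₐ[ℂ] Module.End ℂ W) : LoopOps W where
  k := ρ ⟨k q 0, k_mem q κ 0⟩
  ki := ρ ⟨kInv q 0, kInv_mem q κ 0⟩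
  e0 := ρ ⟨ePos q 0, ePos_mem q κ 0⟩
  f1 := ρ ⟨κ.eps • (eNeg q 1 * k q 1), eps_smul_eNeg_mem q κ⟩
  e1 := ρ ⟨ePos q 1, ePos_mem q κ 1⟩
  f0 := ρ ⟨κ.epsStar • (eNeg q 0 * k q 0), epsStar_smul_eNeg_mem q κ⟩

/-- The operators of a `𝓣`-module. -/
noncomputable def algOps (τ : TAlg q κ →ₐ[ℂ] Module.End ℂ V) : TDOps V where
  K := τ (TAlg.gen q κ .k)
  Ki := τ (TAlg.gen q κ .kInv)
  X := τ (TAlg.gen q κ .x)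
  Y := τ (TAlg.gen q κ .y)

theorem algOps_isWeighted (τ : TAlg q κ →ₐ[ℂ] Module.End ℂ V) : (algOps τ).IsWeighted q := by
  have h1 : TAlg.gen q κ .k * TAlg.gen q κ .kInv = 1 := by
    have := RingQuot.mkAlgHom_rel ℂ (TRel.k_mul_kInv (q := q) (κ := κ))
    rwa [map_mul, map_one] at this
  have h2 : TAlg.gen q κ .kInv * TAlg.gen q κ .k = 1 := by
    have := RingQuot.mkAlgHom_rel ℂ (TRel.kInv_mul_k (q := q) (κ := κ))
    rwa [map_mul, map_one] at this
  obtain ⟨h3, h4⟩ := TAlg.k_mul q κ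
  constructor <;> simp only [algOps, ← map_mul, h1, h2, h3, h4, map_one, map_smul]

theorem k_one_eq (q : ℂˣ) : k q 1 = kInv q 0 := by
  have h := isLoopFamily q
  calc k q 1 = kInv q 0 * (k q 0 * k q 1) := by rw [← mul_assoc, h.kInv_mul_k, one_mul]
    _ = kInv q 0 := by rw [h.k_mul_k 0 1 (by decide), mul_one]

theorem repOps_isWeighted (ρ : subLoop q κ →ₐ[ℂ] Module.End ℂ W) : (repOps ρ).IsWeighted q := by
  have h := isLoopFamily q
  have lift : ∀ {x y : LoopAlg q} (c : ℂ) (hx : x ∈ subLoop q κ) (hy : y ∈ subLoop q κ),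
      x * y = c • (y * x) → ρ ⟨x, hx⟩ * ρ ⟨y, hy⟩ = c • (ρ ⟨y, hy⟩ * ρ ⟨x, hx⟩) := by
    intro x y c hx hy e
    rw [← map_mul, ← map_mul, ← map_smul]
    exact congrArg ρ (Subtype.ext e)
  constructor
  · rw [repOps, ← map_mul, ← map_one ρ]
    exact congrArg ρ (Subtype.ext (h.k_mul_kInv 0))
  · rw [repOps, ← map_mul, ← map_one ρ]
    exact congrArg ρ (Subtype.ext (h.kInv_mul_k 0))
  · exact lift _ _ _ (h.k_ePos_same 0)
  · refine lift _ _ _ ?_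
    rw [mul_smul_comm, ← mul_assoc, h.k_eNeg_ne 0 1 (by decide), k_one_eq, smul_mul_assoc,
      mul_assoc, h.k_mul_kInv, smul_mul_assoc, mul_assoc, h.kInv_mul_k, smul_comm]
  · exact lift _ _ _ (h.k_ePos_ne 0 1 (by decide))
  · refine lift _ _ _ ?_
    rw [mul_smul_comm, ← mul_assoc, h.k_eNeg_same 0, smul_mul_assoc, smul_mul_assoc, smul_comm]

/-- The restricted coproduct is obtained by inverting an injection, so it is computed by exhibiting
a preimage t of the coproduct of u. -/
theorem tensorRep_apply (ρ : subLoop q κ →ₐ[ℂ] Module.End ℂ W)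
    (ρ' : subLoop q κ →ₐ[ℂ] Module.End ℂ W') {u : subLoop q κ} {t : subLoop q κ ⊗[ℂ] subLoop q κ}
    (h : coproduct q u = subLoopMap q κ t) : tensorRep ρ ρ' u =
      (Module.endTensorEndAlgHom (R := ℂ) (A := ℂ) (M := W) (N := W') :
        Module.End ℂ W ⊗[ℂ] Module.End ℂ W' →ₐ[ℂ] Module.End ℂ (W ⊗[ℂ] W'))
        (Algebra.TensorProduct.map ρ ρ' t) := by
  rw [← subLoopMap_injective q κ ((subLoopMap_subCoproduct q κ u).trans h)]
  rfl

/-- The elements kept in `LoopOps` are those whose coproduct has the form κ ⊗ z + z ⊗ 1 with κ =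
k₀^{±1}, or is diagonal. This is why e⁻ᵢkᵢ is recorded instead of e⁻ᵢ; for index 1 the relation k₁ =
k₀⁻¹ turns k₁ into `ki`. -/
theorem repOps_tensorRep (ρ : subLoop q κ →ₐ[ℂ] Module.End ℂ W)
    (ρ' : subLoop q κ →ₐ[ℂ] Module.End ℂ W') :
    repOps (tensorRep ρ ρ') = (repOps ρ).tensor (repOps ρ') := by
  simp only [repOps, LoopOps.tensor, LoopOps.mk.injEq]
  refine ⟨?_, ?_, ?_, ?_, ?_, ?_⟩
  · exact tensorRep_apply ρ ρ' (t := ⟨k q 0, k_mem q κ 0⟩ ⊗ₜ ⟨k q 0, k_mem q κ 0⟩) (lift_gen _ _)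
  · exact tensorRep_apply ρ ρ' (t := ⟨kInv q 0, kInv_mem q κ 0⟩ ⊗ₜ ⟨kInv q 0, kInv_mem q κ 0⟩)
      (lift_gen _ _)
  · rw [tensorRep_apply ρ ρ' (t := ⟨k q 0, k_mem q κ 0⟩ ⊗ₜ ⟨ePos q 0, ePos_mem q κ 0⟩ +
      ⟨ePos q 0, ePos_mem q κ 0⟩ ⊗ₜ 1) ?_]
    · simp [Module.endTensorEndAlgHom_apply]; rfl
    · rw [map_add]; exact lift_gen (coproduct_aux q) (.ePos 0)
  · rw [tensorRep_apply ρ ρ' (t := ⟨kInv q 0, kInv_mem q κ 0⟩ ⊗ₜ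
      ⟨κ.eps • (eNeg q 1 * k q 1), eps_smul_eNeg_mem q κ⟩ +
      ⟨κ.eps • (eNeg q 1 * k q 1), eps_smul_eNeg_mem q κ⟩ ⊗ₜ 1) ?_]
    · simp [Module.endTensorEndAlgHom_apply]; rfl
    · rw [map_smul, coproduct_eNeg_mul_k, smul_add, map_add, ← TensorProduct.tmul_smul,
        TensorProduct.smul_tmul']
      exact congrArg (· ⊗ₜ[ℂ] (κ.eps • (eNeg q 1 * k q 1)) + _) (k_one_eq q)
  · rw [tensorRep_apply ρ ρ' (t := ⟨kInv q 0, kInv_mem q κ 0⟩ ⊗ₜ ⟨ePos q 1, ePos_mem q κ 1⟩ +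
      ⟨ePos q 1, ePos_mem q κ 1⟩ ⊗ₜ 1) ?_]
    · simp [Module.endTensorEndAlgHom_apply]; rfl
    · rw [map_add]
      refine (lift_gen (coproduct_aux q) (.ePos 1)).trans ?_
      simp only [genMap, k_one_eq]
      rfl
  · rw [tensorRep_apply ρ ρ' (t := ⟨k q 0, k_mem q κ 0⟩ ⊗ₜ
      ⟨κ.epsStar • (eNeg q 0 * k q 0), epsStar_smul_eNeg_mem q κ⟩ +
      ⟨κ.epsStar • (eNeg q 0 * k q 0), epsStar_smul_eNeg_mem q κ⟩ ⊗ₜ 1) ?_]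
    · simp [Module.endTensorEndAlgHom_apply]; rfl
    · rw [map_smul, coproduct_eNeg_mul_k, smul_add, map_add, ← TensorProduct.tmul_smul,
        TensorProduct.smul_tmul']
      rfl

theorem algOps_phi (ρ : subLoop q κ →ₐ[ℂ] Module.End ℂ W) (s : ℂˣ) :
    algOps (ρ.comp (phi q κ s)) = (repOps ρ).twist q s := by
  have e : ∀ g, phi q κ s (TAlg.gen q κ g) = phiGen q κ s g := fun g =>
    (RingQuot.liftAlgHom_mkAlgHom_apply ℂ (FreeAlgebra.lift ℂ (phiGen q κ s)) (phi_aux q κ s)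
      (FreeAlgebra.ι ℂ g)).trans (FreeAlgebra.lift_ι_apply _ _)
  simp only [algOps, LoopOps.twist, repOps, AlgHom.comp_apply, e, phiGen, map_smul, map_add]

theorem repOps_isEval (q : ℂˣ) (κ : Kind) (ℓ : ℕ) (a : ℂ) (h : κ = .second ∨ a ≠ 0) :
    (repOps (evalRep q κ ℓ a h)).IsEval q κ a := by
  have H := evalRep_spec q κ ℓ a h
  set ρ := evalRep q κ ℓ a h
  refine ⟨H.k_zero, ?_, H.ePos_zero, ?_, H.ePos_one, ?_⟩
  · have e : (repOps ρ).ki = ρ ⟨k q 1, k_mem q κ 1⟩ :=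
      congrArg ρ (Subtype.ext (k_one_eq q).symm)
    rw [e]
    exact H.k_one
  · intro j
    -- For (0, 0) the element e⁻₁ is not among the generators, but it enters only with the factor ε
    -- = 0.
    by_cases hκ : κ = .third
    · have e : (repOps ρ).f1 = ρ 0 := congrArg ρ (Subtype.ext (by simp [hκ, Kind.eps]))
      rw [e, map_zero, LinearMap.zero_apply, hκ, Kind.eps, zero_mul, zero_smul]
    · have hm : eNeg q 1 ∈ subLoop q κ := by
        cases κ
        · exact Algebra.mem_top
        · exact Algebra.subset_adjoin (by simp)
        · exact absurd rfl hκ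
      have e : (repOps ρ).f1 = ρ (κ.eps • (⟨eNeg q 1, hm⟩ * ⟨k q 1, k_mem q κ 1⟩)) := rfl
      rw [e, map_smul, map_mul, LinearMap.smul_apply, Module.End.mul_apply, H.k_one, map_smul,
        H.eNeg_one hκ, smul_smul, smul_smul, mul_assoc]
  · intro j
    by_cases hκ : κ = .first
    · have hm : eNeg q 0 ∈ subLoop q κ := by
        subst hκ; exact Algebra.mem_top
      have e : (repOps ρ).f0 = ρ (κ.epsStar • (⟨eNeg q 0, hm⟩ * ⟨k q 0, k_mem q κ 0⟩)) := rfl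
      rw [e, map_smul, map_mul, LinearMap.smul_apply, Module.End.mul_apply, H.k_zero, map_smul,
        H.eNeg_zero hκ, smul_smul, smul_smul, mul_assoc]
    · have h0 : κ.epsStar = 0 := by
        cases κ
        · exact absurd rfl hκ
        · rfl
        · rfl
      have e : (repOps ρ).f0 = ρ 0 := congrArg ρ (Subtype.ext (by simp [h0]))
      rw [e, map_zero, LinearMap.zero_apply, h0, zero_mul, zero_smul]

end rep

/-! ### Mapping V(ℓ+1, a) to a tensor product of shorter modules. -/

section fusion
variable {q : ℂˣ} {κ : Kind}

/-- The map `V(ℓ+1, a) → V(1, a q^(-ℓ)) ⊗ V(ℓ, a q)` that sends the highest weight vector `v_0` to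
`v_0 ⊗ v_0`. -/
noncomputable def fusion (q : ℂˣ) (ℓ : ℕ) :
    (Fin (ℓ + 1 + 1) → ℂ) →ₗ[ℂ] (Fin (1 + 1) → ℂ) ⊗[ℂ] (Fin (ℓ + 1) → ℂ) :=
  (Pi.basisFun ℂ (Fin (ℓ + 1 + 1))).constr ℂ fun j =>
    -- Compatibility with e⁺₁ forces the coefficient: [ℓ-j+2] = q[ℓ-j+1] + q^(j-1-ℓ).
    stdVec 1 0 ⊗ₜ stdVec ℓ j + (q : ℂ) ^ ((j : ℤ) - 1 - ℓ) • (stdVec 1 1 ⊗ₜ stdVec ℓ (j - 1))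

/-- Valid for every integer j, since out of range all three vectors vanish. The verification below
thereby needs no boundary cases. -/
theorem fusion_stdVec (q : ℂˣ) (ℓ : ℕ) (j : ℤ) : fusion q ℓ (stdVec (ℓ + 1) j) =
    stdVec 1 0 ⊗ₜ stdVec ℓ j + (q : ℂ) ^ (j - 1 - ℓ) • (stdVec 1 1 ⊗ₜ stdVec ℓ (j - 1)) := by
  by_cases hj : j < 0 ∨ ((ℓ + 1 : ℕ) : ℤ) < j
  · rw [stdVec_eq_zero hj, stdVec_eq_zero (ℓ := ℓ) (j := j) (by omega),
      stdVec_eq_zero (ℓ := ℓ) (j := j - 1) (by omega),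
      map_zero, TensorProduct.tmul_zero, TensorProduct.tmul_zero, smul_zero, add_zero]
  · obtain ⟨n, rfl⟩ := Int.eq_ofNat_of_zero_le (by omega : 0 ≤ j)
    have hn : n < ℓ + 1 + 1 := by omega
    have := stdVec_coe (⟨n, hn⟩ : Fin (ℓ + 1 + 1))
    simp only at this
    rw [this, fusion, Module.Basis.constr_basis]

theorem comp_eq_comp_of_stdVec {ℓ : ℕ} {M : Type*} [AddCommGroup M] [Module ℂ M]
    {f g : (Fin (ℓ + 1) → ℂ) →ₗ[ℂ] M} (h : ∀ j : ℤ, f (stdVec ℓ j) = g (stdVec ℓ j)) (v) :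
    f v = g v := by
  have : f = g := (Pi.basisFun ℂ (Fin (ℓ + 1))).ext fun j => by rw [← stdVec_coe]; exact h j
  rw [this]

/-- On each basis vector the claim reduces to a power identity or to one of the two recursions for
[j+1]. Comparing the actions of e⁺₀ dictates the parameters: k₀ acts on v₀ of the first factor as
q⁻¹, hence aq in the second factor; the term v₁ ⊗ v_j then requires aq^(-ℓ) in the first. -/
theorem fusion_intertwines (hq : ∀ n : ℕ, 0 < n → q ^ n ≠ 1) {ℓ : ℕ} {a : ℂ}
    {A : LoopOps (Fin (ℓ + 1 + 1) → ℂ)} {B : LoopOps (Fin (1 + 1) → ℂ)}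
    {D : LoopOps (Fin (ℓ + 1) → ℂ)} (hA : A.IsEval q κ a)
    (hB : B.IsEval q κ (a * (q : ℂ) ^ (-(ℓ : ℤ)))) (hD : D.IsEval q κ (a * q)) :
    A.Intertwines (B.tensor D) (fusion q ℓ) := by
  have hq0 := q.ne_zero
  have q1 := qInt_one hq
  have vm : stdVec 1 (-1) = 0 := stdVec_eq_zero (by norm_num)
  have v2 : stdVec 1 2 = 0 := stdVec_eq_zero (by norm_num)
  have h_k : ∀ j, fusion q ℓ (A.k (stdVec (ℓ + 1) j)) =
      (B.tensor D).k (fusion q ℓ (stdVec (ℓ + 1) j)) := by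
    intro j
    have hY : (q : ℂ) ^ j ≠ 0 := zpow_ne_zero _ hq0
    have hZ : (q : ℂ) ^ ℓ ≠ 0 := pow_ne_zero _ hq0
    simp only [fusion_stdVec, hA.k, map_smul, map_add, LoopOps.tensor, LinearMap.add_apply,
      TensorProduct.map_tmul, hB.k, hB.ki, hB.k, hD.k, Module.End.one_apply,
      TensorProduct.tmul_smul, ← TensorProduct.smul_tmul', zero_add, zero_sub, one_add_one_eq_two,
      vm, v2, TensorProduct.zero_tmul, smul_zero, add_zero, sub_self, sub_add_cancel,
      add_sub_cancel_right, Nat.cast_one, q1]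
    match_scalars <;>
    · simp only [zpow_sub₀ hq0, zpow_add₀ hq0, zpow_neg, two_mul, mul_one, mul_zero, zpow_natCast,
        zpow_one, zpow_zero, Nat.cast_add, Nat.cast_one, mul_inv, inv_inv]
      field_simp
  have h_ki : ∀ j, fusion q ℓ (A.ki (stdVec (ℓ + 1) j)) =
      (B.tensor D).ki (fusion q ℓ (stdVec (ℓ + 1) j)) := by
    intro j
    have hY : (q : ℂ) ^ j ≠ 0 := zpow_ne_zero _ hq0
    have hZ : (q : ℂ) ^ ℓ ≠ 0 := pow_ne_zero _ hq0
    simp only [fusion_stdVec, hA.ki, map_smul, map_add, LoopOps.tensor, LinearMap.add_apply,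
      TensorProduct.map_tmul, hB.k, hB.ki, hB.ki, hD.ki, Module.End.one_apply,
      TensorProduct.tmul_smul, ← TensorProduct.smul_tmul', zero_add, zero_sub, one_add_one_eq_two,
      vm, v2, TensorProduct.zero_tmul, smul_zero, add_zero, sub_self, sub_add_cancel,
      add_sub_cancel_right, Nat.cast_one, q1]
    match_scalars <;>
    · simp only [zpow_sub₀ hq0, zpow_add₀ hq0, zpow_neg, two_mul, mul_one, mul_zero, zpow_natCast,
        zpow_one, zpow_zero, Nat.cast_add, Nat.cast_one, mul_inv, inv_inv]
      field_simp
  have h_e0 : ∀ j, fusion q ℓ (A.e0 (stdVec (ℓ + 1) j)) =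
      (B.tensor D).e0 (fusion q ℓ (stdVec (ℓ + 1) j)) := by
    intro j
    have hY : (q : ℂ) ^ j ≠ 0 := zpow_ne_zero _ hq0
    have hZ : (q : ℂ) ^ ℓ ≠ 0 := pow_ne_zero _ hq0
    simp only [fusion_stdVec, hA.e0, map_smul, map_add, LoopOps.tensor, LinearMap.add_apply,
      TensorProduct.map_tmul, hB.k, hB.ki, hB.e0, hD.e0, Module.End.one_apply,
      TensorProduct.tmul_smul, ← TensorProduct.smul_tmul', zero_add, zero_sub, one_add_one_eq_two,
      vm, v2, TensorProduct.zero_tmul, smul_zero, add_zero, sub_self, sub_add_cancel,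
      add_sub_cancel_right, Nat.cast_one, q1]
    rw [qInt_succ' hq j]
    match_scalars <;>
    · simp only [zpow_sub₀ hq0, zpow_add₀ hq0, zpow_neg, two_mul, mul_one, mul_zero, zpow_natCast,
        zpow_one, zpow_zero, Nat.cast_add, Nat.cast_one, mul_inv, inv_inv]
      field_simp
  have h_f1 : ∀ j, fusion q ℓ (A.f1 (stdVec (ℓ + 1) j)) =
      (B.tensor D).f1 (fusion q ℓ (stdVec (ℓ + 1) j)) := by
    intro j
    have hY : (q : ℂ) ^ j ≠ 0 := zpow_ne_zero _ hq0
    have hZ : (q : ℂ) ^ ℓ ≠ 0 := pow_ne_zero _ hq0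
    simp only [fusion_stdVec, hA.f1, map_smul, map_add, LoopOps.tensor, LinearMap.add_apply,
      TensorProduct.map_tmul, hB.k, hB.ki, hB.f1, hD.f1, Module.End.one_apply,
      TensorProduct.tmul_smul, ← TensorProduct.smul_tmul', zero_add, zero_sub, one_add_one_eq_two,
      vm, v2, TensorProduct.zero_tmul, smul_zero, add_zero, sub_self, sub_add_cancel,
      add_sub_cancel_right, Nat.cast_one, q1]
    rw [qInt_succ hq j]
    match_scalars <;>
    · simp only [zpow_sub₀ hq0, zpow_add₀ hq0, zpow_neg, two_mul, mul_one, mul_zero, zpow_natCast,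
        zpow_one, zpow_zero, Nat.cast_add, Nat.cast_one, mul_inv, inv_inv]
      field_simp
  have h_e1 : ∀ j, fusion q ℓ (A.e1 (stdVec (ℓ + 1) j)) =
      (B.tensor D).e1 (fusion q ℓ (stdVec (ℓ + 1) j)) := by
    intro j
    have hY : (q : ℂ) ^ j ≠ 0 := zpow_ne_zero _ hq0
    have hZ : (q : ℂ) ^ ℓ ≠ 0 := pow_ne_zero _ hq0
    simp only [fusion_stdVec, hA.e1, map_smul, map_add, LoopOps.tensor, LinearMap.add_apply,
      TensorProduct.map_tmul, hB.k, hB.ki, hB.e1, hD.e1, Module.End.one_apply,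
      TensorProduct.tmul_smul, ← TensorProduct.smul_tmul', zero_add, zero_sub, one_add_one_eq_two,
      vm, v2, TensorProduct.zero_tmul, smul_zero, add_zero, sub_self, sub_add_cancel,
      add_sub_cancel_right, Nat.cast_one, q1]
    rw [show ((ℓ + 1 : ℕ) : ℤ) - j + 1 = (ℓ - j + 1) + 1 by push_cast; ring,
      show (ℓ : ℤ) - (j - 1) + 1 = (ℓ - j + 1) + 1 by ring, qInt_succ' hq (ℓ - j + 1)]
    match_scalars <;>
    · simp only [zpow_sub₀ hq0, zpow_add₀ hq0, zpow_neg, two_mul, mul_one, mul_zero, zpow_natCast,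
        zpow_one, zpow_zero, Nat.cast_add, Nat.cast_one, mul_inv, inv_inv]
      field_simp
      try ring
  have h_f0 : ∀ j, fusion q ℓ (A.f0 (stdVec (ℓ + 1) j)) =
      (B.tensor D).f0 (fusion q ℓ (stdVec (ℓ + 1) j)) := by
    intro j
    have hY : (q : ℂ) ^ j ≠ 0 := zpow_ne_zero _ hq0
    have hZ : (q : ℂ) ^ ℓ ≠ 0 := pow_ne_zero _ hq0
    simp only [fusion_stdVec, hA.f0, map_smul, map_add, LoopOps.tensor, LinearMap.add_apply,
      TensorProduct.map_tmul, hB.k, hB.ki, hB.f0, hD.f0, Module.End.one_apply,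
      TensorProduct.tmul_smul, ← TensorProduct.smul_tmul', zero_add, zero_sub, one_add_one_eq_two,
      vm, v2, TensorProduct.zero_tmul, smul_zero, add_zero, sub_self, sub_add_cancel,
      add_sub_cancel_right, Nat.cast_one, q1]
    rw [show ((ℓ + 1 : ℕ) : ℤ) - j + 1 = (ℓ - j + 1) + 1 by push_cast; ring,
      show (ℓ : ℤ) - (j - 1) + 1 = (ℓ - j + 1) + 1 by ring, qInt_succ hq (ℓ - j + 1)]
    match_scalars <;>
    · simp only [zpow_sub₀ hq0, zpow_add₀ hq0, zpow_neg, two_mul, mul_one, mul_zero, zpow_natCast,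
        zpow_one, zpow_zero, Nat.cast_add, Nat.cast_one, mul_inv, inv_inv]
      field_simp
      try ring
  exact ⟨comp_eq_comp_of_stdVec (f := fusion q ℓ ∘ₗ A.k) (g := (B.tensor D).k ∘ₗ fusion q ℓ) h_k,
    comp_eq_comp_of_stdVec (f := fusion q ℓ ∘ₗ A.ki) (g := (B.tensor D).ki ∘ₗ fusion q ℓ) h_ki,
    comp_eq_comp_of_stdVec (f := fusion q ℓ ∘ₗ A.e0) (g := (B.tensor D).e0 ∘ₗ fusion q ℓ) h_e0,
    comp_eq_comp_of_stdVec (f := fusion q ℓ ∘ₗ A.f1) (g := (B.tensor D).f1 ∘ₗ fusion q ℓ) h_f1,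
    comp_eq_comp_of_stdVec (f := fusion q ℓ ∘ₗ A.e1) (g := (B.tensor D).e1 ∘ₗ fusion q ℓ) h_e1,
    comp_eq_comp_of_stdVec (f := fusion q ℓ ∘ₗ A.f0) (g := (B.tensor D).f0 ∘ₗ fusion q ℓ) h_f0⟩

end fusion

/-! ### Multiplicativity for evaluation modules and their tensor products. -/

section drinfeld
open Polynomial
variable {q : ℂˣ} {κ : Kind} {V V' W : Type*} [AddCommGroup V] [Module ℂ V]
  [AddCommGroup V'] [Module ℂ V'] [AddCommGroup W] [Module ℂ W]

/-- The operators have a weight space decomposition of type `r` and diameter `d` with highest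
weight space spanned by `u`, and `P` is the Drinfeld polynomial. -/
def TDOps.IsDrinfeld (T : TDOps V) (q : ℂˣ) (κ : Kind) (r : ℂˣ) (d : ℕ) (u : V) (P : ℂ[X]) : Prop :=
  IsHighest q T.K r d u ∧ ∃ σ, T.IsSigma u σ ∧ drinfeldPolyOf q κ r d σ = P

theorem TDOps.IsDrinfeld.map {T : TDOps V} {T' : TDOps V'} {e : V ≃ₗ[ℂ] V'}
    (he : T.Intertwines T' e) {r : ℂˣ} {d : ℕ} {u : V} {P : ℂ[X]} (h : T.IsDrinfeld q κ r d u P) :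
    T'.IsDrinfeld q κ r d (e u) P := by
  obtain ⟨h1, σ, hσ, hP⟩ := h
  exact ⟨h1.map e he.K, σ, he.isSigma hσ, hP⟩

theorem IsHighest.tensor_eval {T : TDOps V} {r : ℂˣ} {d : ℕ} {u : V} (h : IsHighest q T.K r d u)
    {ℓ : ℕ} {A : LoopOps (Fin (ℓ + 1) → ℂ)} {a : ℂ} (hA : A.IsEval q κ a) :
    IsHighest q (T.tensor q A).K r (d + ℓ) (u ⊗ₜ stdVec ℓ 0) := by
  have := h.tensor hA.isHighest
  rwa [mul_one] at this

/-- The recursion of `tensor_sigma` meets the hypotheses of `drinfeldPolyOf_succ`: both sequences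
start with 1, and σ_(d+1) = 0 because x^(d+1) u would have index d + 1. -/
theorem TDOps.IsDrinfeld.tensor_eval_one (hq : ∀ n : ℕ, 0 < n → q ^ n ≠ 1) {T : TDOps V}
    (hT : T.IsWeighted q) {r : ℂˣ} {d : ℕ} {u : V} {P : ℂ[X]} (h : T.IsDrinfeld q κ r d u P)
    {A : LoopOps (Fin (1 + 1) → ℂ)} {a : ℂ} (ha : κ = .second ∨ a ≠ 0) (hA : A.IsEval q κ a)
    (hAw : A.IsWeighted q) :
    (T.tensor q A).IsDrinfeld q κ r (d + 1) (u ⊗ₜ stdVec 1 0)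
      (P * (Polynomial.X + C (a + κ.eps * κ.epsStar * a⁻¹))) := by
  obtain ⟨h1, σ, hσ, rfl⟩ := h
  have h2 := h1.tensor_eval hA
  obtain ⟨σ', hσ'⟩ := exists_isSigma hq (TDOps.tensor_isWeighted hT hAw) r.ne_zero h2
  refine ⟨h2, σ', hσ', drinfeldPolyOf_succ hq κ r d ?_ ?_ fun n hn => ?_⟩
  · have e1 : σ 0 = 1 := by
      have := hσ 0
      simp only [pow_zero, Module.End.one_apply] at this
      exact smul_left_injective ℂ h1.ne_zero (by simpa using this.symm)
    have := hσ' 0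
    simp only [pow_zero, Module.End.one_apply] at this
    rw [e1]
    exact smul_left_injective ℂ h2.ne_zero (by simpa using this.symm)
  · have hX := hT.X_pow_mem h1.mem (d + 1)
    rw [h1.wt_eq_bot hq r.ne_zero (by right; push_cast; omega), Submodule.mem_bot] at hX
    have := hσ (d + 1)
    rw [hX, map_zero] at this
    exact (smul_eq_zero.1 this.symm).resolve_right h1.ne_zero
  · exact smul_left_injective ℂ h2.ne_zero
      ((hσ' (n + 1)).symm.trans (tensor_sigma hq ha hT hA h1 hσ hn))

/-- Induction on ℓ, splitting off a factor V(1, aq^(-ℓ)) by fusion. The module V is quantified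
inside because the induction hypothesis is applied to V ⊗ V(1, aq^(-ℓ)). -/
theorem TDOps.IsDrinfeld.tensor_eval (hq : ∀ n : ℕ, 0 < n → q ^ n ≠ 1) {ℓ : ℕ} :
    ∀ {V : Type*} [AddCommGroup V] [Module ℂ V] {T : TDOps V}
    (_ : T.IsWeighted q) {r : ℂˣ} {d : ℕ} {u : V} {P : ℂ[X]} (_ : T.IsDrinfeld q κ r d u P)
    {a : ℂ} (ha : κ = .second ∨ a ≠ 0),
    (T.tensor q (repOps (evalRep q κ ℓ a ha))).IsDrinfeld q κ r (d + ℓ) (u ⊗ₜ stdVec ℓ 0)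
      (P * stringPoly q κ ℓ a) := by
  induction ℓ with
  | zero =>
    intro V _ _ T hT r d u P h a ha
    have hA := repOps_isEval q κ 0 a ha
    set A := repOps (evalRep q κ 0 a ha)
    have vm : stdVec 0 (-1) = 0 := stdVec_eq_zero (by norm_num)
    have v1 : stdVec 0 1 = 0 := stdVec_eq_zero (by norm_num)
    -- V(0, a) is the trivial line, and v ↦ v ⊗ v₀ transports the scalars.
    have hi : T.Intertwines (T.tensor q A)
        ((TensorProduct.mk ℂ V (Fin (0 + 1) → ℂ)).flip (stdVec 0 0)) := by
      constructor <;> intro v <;>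
        simp [TDOps.tensor, hA.k, hA.ki, hA.e0, hA.f1, hA.e1, hA.f0, vm, v1]
    obtain ⟨h1, σ, hσ, rfl⟩ := h
    exact ⟨h1.tensor_eval hA, σ, hi.isSigma hσ, by rw [stringPoly_zero, mul_one]; rfl⟩
  | succ ℓ ih =>
    intro V _ _ T hT r d u P h a ha
    have hb : κ = .second ∨ a * (q : ℂ) ^ (-(ℓ : ℤ)) ≠ 0 :=
      ha.imp_right fun h0 => mul_ne_zero h0 (zpow_ne_zero _ q.ne_zero)
    have hc : κ = .second ∨ a * (q : ℂ) ≠ 0 := ha.imp_right fun h0 => mul_ne_zero h0 q.ne_zero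
    have hB := repOps_isEval q κ 1 _ hb
    have hBw := repOps_isWeighted (evalRep q κ 1 _ hb)
    have hi := fusion_intertwines hq (repOps_isEval q κ (ℓ + 1) a ha) hB (repOps_isEval q κ ℓ _ hc)
    obtain ⟨h1, σ, hσ, hP⟩ := (ih (TDOps.tensor_isWeighted hT hBw)
      (h.tensor_eval_one hq hT hb hB hBw) hc).map (TDOps.tensor_assoc T q _ _)
    have h2 := h.1.tensor_eval (repOps_isEval q κ (ℓ + 1) a ha)
    obtain ⟨σ', hσ'⟩ := exists_isSigma hq
      (TDOps.tensor_isWeighted hT (repOps_isWeighted (evalRep q κ (ℓ + 1) a ha))) r.ne_zero h2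
    have hf : fusion q ℓ (stdVec (ℓ + 1) 0) = stdVec 1 0 ⊗ₜ stdVec ℓ 0 := by
      rw [fusion_stdVec, stdVec_eq_zero (ℓ := ℓ) (j := 0 - 1) (by omega), TensorProduct.tmul_zero,
        smul_zero, add_zero]
    -- V ⊗ V(ℓ+1, a) and V ⊗ (V(1, aq^(-ℓ)) ⊗ V(ℓ, aq)) share type and diameter, and fusion sends u
    -- ⊗ v₀ to the nonzero highest weight vector of the latter. Equal scalars therefore give equal
    -- polynomials.
    have hσ2 := (TDOps.tensor_lTensor T q hi).isSigma hσ'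
    rw [LinearMap.lTensor_tmul, hf] at hσ2
    obtain rfl : σ = σ' := hσ.unique h1.ne_zero hσ2
    refine ⟨h2, σ, hσ', ?_⟩
    rw [stringPoly_succ, ← mul_assoc, ← hP, add_assoc, add_comm 1 ℓ]

/-- The product of the polynomials of the strings of a list of evaluation parameters. -/
noncomputable def listPoly (q : ℂˣ) (p : EvalParam κ) (l : List (EvalParam κ)) : ℂ[X] :=
  stringPoly q κ p.ℓ p.a * (l.map fun p => stringPoly q κ p.ℓ p.a).prod

/-- The first evaluation module is absorbed into V, and associativity returns it to the right
factor. The polynomial of the evaluation modules does not depend on V, r or d, which is the source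
of multiplicativity. -/
theorem TDOps.IsDrinfeld.tensor_evalTensor (hq : ∀ n : ℕ, 0 < n → q ^ n ≠ 1)
    (l : List (EvalParam κ)) : ∀ (p : EvalParam κ)
    {V : Type*} [AddCommGroup V] [Module ℂ V] {T : TDOps V}
    (_ : T.IsWeighted q) {r : ℂˣ} {d : ℕ} {u : V} {P : ℂ[X]} (_ : T.IsDrinfeld q κ r d u P),
    ∃ u', (T.tensor q (repOps (evalTensor q p l).ρ)).IsDrinfeld q κ r
      (d + (p.ℓ + (l.map EvalParam.ℓ).sum)) u' (P * listPoly q p l) := by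
  induction l with
  | nil =>
    intro p V _ _ T hT r d u P h
    refine ⟨(u ⊗ₜ stdVec p.ℓ 0 : V ⊗[ℂ] (Fin (p.ℓ + 1) → ℂ)), ?_⟩
    have := h.tensor_eval hq hT p.ne_zero (ℓ := p.ℓ)
    simp only [listPoly, List.map_nil, List.prod_nil, List.sum_nil, mul_one, add_zero]
    exact this
  | cons p' l ih =>
    intro p V _ _ T hT r d u P h
    obtain ⟨u', hu'⟩ := ih p' (TDOps.tensor_isWeighted hT (repOps_isWeighted _))
      (h.tensor_eval hq hT p.ne_zero (ℓ := p.ℓ))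
    have := hu'.map (TDOps.tensor_assoc T q _ _)
    rw [← repOps_tensorRep] at this
    have e : d + p.ℓ + (p'.ℓ + (l.map EvalParam.ℓ).sum) =
        d + (p.ℓ + ((p' :: l).map EvalParam.ℓ).sum) := by
      simp only [List.map_cons, List.sum_cons]; ring
    have e' : P * stringPoly q κ p.ℓ p.a * listPoly q p' l = P * listPoly q p (p' :: l) := by
      simp only [listPoly, List.map_cons, List.prod_cons]; ring
    rw [e, e'] at this
    exact ⟨_, this⟩

theorem charOps_isWeighted (q s : ℂˣ) : (charOps s).IsWeighted q := by
  constructor <;> simp [charOps, smul_smul]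

theorem charOps_isDrinfeld (q : ℂˣ) (κ : Kind) (s : ℂˣ) :
    (charOps s).IsDrinfeld q κ s 0 1 1 := by
  -- As x = y = 0, only σ₀ = 1 is nonzero, and for diameter 0 the polynomial is σ₀.
  refine ⟨⟨one_ne_zero, ?_, ?_⟩, fun i => if i = 0 then 1 else 0, ?_, ?_⟩
  · simp [mem_wt, charOps]
  · rw [eq_top_iff]
    intro v _
    refine Submodule.mem_iSup_of_mem 0 ?_
    simp [wtLine, Submodule.mem_span_singleton]
  · intro i
    cases i with
    | zero => simp
    | succ n => simp [charOps]
  · simp [drinfeldPolyOf_zero]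

theorem IsHighest.hasWeightDecomposition (hq : ∀ n : ℕ, 0 < n → q ^ n ≠ 1)
    {τ : TAlg q κ →ₐ[ℂ] Module.End ℂ V} {r : ℂˣ} {d : ℕ} {u : V}
    (h : IsHighest q (algOps τ).K r d u) : HasWeightDecomposition τ r d := by
  refine ⟨(DirectSum.isInternal_submodule_iff_iSupIndep_and_iSup_eq_top _).2 ⟨?_, h.iSup_wt⟩, ?_⟩
  · exact (wt_iSupIndep hq (algOps τ).K r.ne_zero d).comp (f := fun i : Fin (d + 1) => ((i : ℕ) : ℤ))
      fun i j h => Fin.ext (by simpa using h)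
  · have : weightSpace τ r d 0 = Submodule.span ℂ {u} := h.wt_zero hq r.ne_zero
    rw [this]
    exact finrank_span_singleton h.ne_zero

theorem HasWeightDecomposition.exists_isHighest {τ : TAlg q κ →ₐ[ℂ] Module.End ℂ V} {r : ℂˣ}
    {d : ℕ} (h : HasWeightDecomposition τ r d) : ∃ u, IsHighest q (algOps τ).K r d u := by
  obtain ⟨u, hu, hspan⟩ := finrank_eq_one_iff'.1 h.finrank_highest
  have h0 : wt q (algOps τ).K r d 0 = Submodule.span ℂ {(u : V)} := by
    refine le_antisymm (fun v hv => ?_) ((Submodule.span_singleton_le_iff_mem _ _).2 u.2)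
    obtain ⟨c, hc⟩ := hspan ⟨v, hv⟩
    exact Submodule.mem_span_singleton.2 ⟨c, congrArg Subtype.val hc⟩
  refine ⟨u, fun e => hu (Subtype.ext e), u.2, ?_⟩
  rw [eq_top_iff, ← h.isInternal.submodule_iSup_eq_top]
  refine iSup_mono fun i => ?_
  unfold wtLine
  split_ifs with hi
  · rw [← h0, hi]; exact le_rfl
  · exact le_rfl

/-- On a nonzero highest weight vector the eigenvalue is unique, so the chosen `sigma` coincides
with any sequence satisfying `IsSigma`. -/
theorem TDOps.IsDrinfeld.drinfeldPoly_eq (hq : ∀ n : ℕ, 0 < n → q ^ n ≠ 1)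
    {τ : TAlg q κ →ₐ[ℂ] Module.End ℂ V} {r : ℂˣ} {d : ℕ} {u : V} {P : ℂ[X]}
    (h : (algOps τ).IsDrinfeld q κ r d u P) : drinfeldPoly τ r d = P := by
  obtain ⟨h1, σ, hσ, rfl⟩ := h
  have e : sigma τ r d = σ := funext fun i => by
    have := sigma_spec (h1.hasWeightDecomposition hq) i u h1.mem
    rw [map_mul, map_pow, map_pow, Module.End.mul_apply] at this
    exact smul_left_injective ℂ h1.ne_zero (this.symm.trans (hσ i))
  rw [← e]
  rfl

theorem HasWeightDecomposition.exists_isDrinfeld (hq : ∀ n : ℕ, 0 < n → q ^ n ≠ 1)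
    {τ : TAlg q κ →ₐ[ℂ] Module.End ℂ V} {r : ℂˣ} {d : ℕ} (h : HasWeightDecomposition τ r d) :
    ∃ u, (algOps τ).IsDrinfeld q κ r d u (drinfeldPoly τ r d) := by
  obtain ⟨u, hu⟩ := h.exists_isHighest
  obtain ⟨σ, hσ⟩ := exists_isSigma hq (algOps_isWeighted τ) r.ne_zero hu
  have hD : (algOps τ).IsDrinfeld q κ r d u (drinfeldPolyOf q κ r d σ) := ⟨hu, σ, hσ, rfl⟩
  exact ⟨u, by rwa [hD.drinfeldPoly_eq hq]⟩

theorem repOps_intertwines {ρ : subLoop q κ →ₐ[ℂ] Module.End ℂ V}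
    {ρ' : subLoop q κ →ₐ[ℂ] Module.End ℂ V'} {f : V →ₗ[ℂ] V'} (h : ∀ u v, f (ρ u v) = ρ' u (f v)) :
    (repOps ρ).Intertwines (repOps ρ') f :=
  ⟨h _, h _, h _, h _, h _, h _⟩

theorem algOps_tensorRep (ρ : subLoop q κ →ₐ[ℂ] Module.End ℂ V)
    (ρ' : subLoop q κ →ₐ[ℂ] Module.End ℂ V') (s : ℂˣ) :
    algOps ((tensorRep ρ ρ').comp (phi q κ s)) =
      (algOps (ρ.comp (phi q κ s))).tensor q (repOps ρ') := by
  rw [algOps_phi, algOps_phi, repOps_tensorRep, LoopOps.twist_tensor]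

end drinfeld

end AugTD

theorem theorem5p2 (q : ℂˣ) (hq : ∀ n : ℕ, 0 < n → q ^ n ≠ 1) (κ : AugTD.Kind) (s : ℂˣ) :
    (∀ (V : Type*) [AddCommGroup V] [Module ℂ V] [FiniteDimensional ℂ V]
        (V' : Type*) [AddCommGroup V'] [Module ℂ V']
        (ρ : AugTD.subLoop q κ →ₐ[ℂ] Module.End ℂ V)
        (ρ' : AugTD.subLoop q κ →ₐ[ℂ] Module.End ℂ V')
        (r : ℂˣ) (d : ℕ) (p : AugTD.EvalParam κ) (l : List (AugTD.EvalParam κ))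
        (e : V' ≃ₗ[ℂ] (AugTD.evalTensor q p l).carrier),
        AugTD.HasWeightDecomposition (ρ.comp (AugTD.phi q κ s)) r d →
        (∀ u v, e (ρ' u v) = (AugTD.evalTensor q p l).ρ u (e v)) →
        AugTD.HasWeightDecomposition (ρ'.comp (AugTD.phi q κ s)) s
            (p.ℓ + (l.map AugTD.EvalParam.ℓ).sum) ∧
        AugTD.HasWeightDecomposition ((AugTD.tensorRep ρ ρ').comp (AugTD.phi q κ s)) r
            (d + (p.ℓ + (l.map AugTD.EvalParam.ℓ).sum)) ∧
        AugTD.drinfeldPoly ((AugTD.tensorRep ρ ρ').comp (AugTD.phi q κ s)) r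
            (d + (p.ℓ + (l.map AugTD.EvalParam.ℓ).sum)) =
          AugTD.drinfeldPoly (ρ.comp (AugTD.phi q κ s)) r d *
            AugTD.drinfeldPoly (ρ'.comp (AugTD.phi q κ s)) s
              (p.ℓ + (l.map AugTD.EvalParam.ℓ).sum)) ∧
    (∀ (ℓ : ℕ) (a : ℂ) (h : κ = .second ∨ a ≠ 0), 1 ≤ ℓ →
        AugTD.HasWeightDecomposition ((AugTD.evalRep q κ ℓ a h).comp (AugTD.phi q κ s)) s ℓ ∧
        AugTD.drinfeldPoly ((AugTD.evalRep q κ ℓ a h).comp (AugTD.phi q κ s)) s ℓ =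
          ((AugTD.qString q ℓ a).map fun c =>
            Polynomial.X + Polynomial.C (c + κ.eps * κ.epsStar * c⁻¹)).prod) := by
  refine ⟨?_, ?_⟩
  · intro V _ _ _ V' _ _ ρ ρ' r d p l e hV he
    have hi : (AugTD.repOps (AugTD.evalTensor q p l).ρ).Intertwines (AugTD.repOps ρ')
        (e.symm : _ →ₗ[ℂ] V') := AugTD.repOps_intertwines fun u v => by
      apply e.injective
      simp [he]
    obtain ⟨u, hu⟩ := hV.exists_isDrinfeld hq
    -- The same statement is applied twice, to V and to the line with k = s; both times the factor
    -- is `listPoly q p l`.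
    obtain ⟨u₁, h₁⟩ := hu.tensor_evalTensor hq l p (AugTD.algOps_isWeighted _)
    obtain ⟨u₂, h₂⟩ := (AugTD.charOps_isDrinfeld q κ s).tensor_evalTensor hq l p
      (AugTD.charOps_isWeighted q s)
    have h₁' := h₁.map (e := e.symm.lTensor V) (AugTD.TDOps.tensor_lTensor _ q hi)
    have h₂' := (h₂.map (e := e.symm.lTensor ℂ) (AugTD.TDOps.tensor_lTensor _ q hi)).map
      (AugTD.charOps_tensor _ q s)
    rw [← AugTD.algOps_tensorRep] at h₁'
    -- The line has diameter 0 and polynomial 1, so the polynomial of V' is `listPoly q p l` itself.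
    rw [← AugTD.algOps_phi, zero_add, one_mul] at h₂'
    refine ⟨h₂'.1.hasWeightDecomposition hq, h₁'.1.hasWeightDecomposition hq, ?_⟩
    rw [h₁'.drinfeldPoly_eq hq, h₂'.drinfeldPoly_eq hq]
  · intro ℓ a h _
    have h₁ := ((AugTD.charOps_isDrinfeld q κ s).tensor_eval hq (AugTD.charOps_isWeighted q s)
      h (ℓ := ℓ)).map (AugTD.charOps_tensor _ q s)
    rw [← AugTD.algOps_phi, zero_add, one_mul] at h₁
    exact ⟨h₁.1.hasWeightDecomposition hq, h₁.drinfeldPoly_eq hq⟩
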